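/- Let $n\ge 4$, let $Q\in\mathbb{Z}[X_1,\dots,X_n]$ be a non-singular indefinite quadratic form, let $m$ be a non-zero integer, and let $\varepsilon>0$. Write $|\mathbf{x}|=\max_{1\le i\le n}|x_i|$. Then there is a constant $C>0$, depending only on $n$, $Q$, $m$ and $\varepsilon$, such that for every real $H>0$, every integer $\ell\ge 1$ and every $\boldsymbol{\xi}\in(\mathbb{Z}/\ell\mathbb{Z})^n$, $$\#\{\mathbf{x}\in\mathbb{Z}^n:\ Q(\mathbf{x})=m,\ |\mathbf{x}|\le H,\ \mathbf{x}\equiv\boldsymbol{\xi}\bmod \ell\}\ \le\ C\,\max\Bigl(1,\frac{H}{\ell}\Bigr)^{n-3+\varepsilon}\Bigl(1+\frac{H}{\ell^{n/(n-1)}}\Bigr).$$ In particular, whenever $\ell\le H$ the left-hand side is at most $C\,(H/\ell)^{n-3+\varepsilon}\bigl(1+H/\ell^{n/(n-1)}\bigr)$. -/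

import Mathlib

/-- The integral points `x` of the affine quadric `Q = m` with `max |x_i| ≤ H` and
`x ≡ ξ mod ℓ`. A quadratic form with integer coefficients in `n` variables (arbitrary integer
cross terms) is the same thing as a `QuadraticForm ℤ (Fin n → ℤ)`. -/
def quadricPoints {n : ℕ} (Q : QuadraticForm ℤ (Fin n → ℤ)) (m : ℤ) (H : ℝ) (ℓ : ℕ)
    (ξ : Fin n → ZMod ℓ) : Set (Fin n → ℤ) :=
  {x | Q x = m ∧ (∀ i, |(x i : ℝ)| ≤ H) ∧ ∀ i, (x i : ZMod ℓ) = ξ i}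

/-- The set is finite, so its `Set.ncard` is its true number of elements. -/
theorem quadricPoints_finite {n : ℕ} (Q : QuadraticForm ℤ (Fin n → ℤ)) (m : ℤ) (H : ℝ) (ℓ : ℕ)
    (ξ : Fin n → ZMod ℓ) : (quadricPoints Q m H ℓ ξ).Finite := by
  refine (Set.finite_Icc (fun _ : Fin n => -⌊H⌋) (fun _ => ⌊H⌋)).subset ?_
  rintro x ⟨-, hx, -⟩
  refine ⟨fun i => ?_, fun i => ?_⟩
  · have h : -x i ≤ ⌊H⌋ := Int.le_floor.2 (by
      push_cast
      exact (neg_le_abs _).trans (hx i))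
    show -⌊H⌋ ≤ x i
    omega
  · exact Int.le_floor.2 ((le_abs_self _).trans (hx i))

/-- Non-singular: the matrix of second partial derivatives of `Q` (the Gram matrix of the polar
form) has non-zero determinant. -/
def QuadNonsingular {n : ℕ} (Q : QuadraticForm ℤ (Fin n → ℤ)) : Prop :=
  (Matrix.of fun i j : Fin n =>
    QuadraticMap.polar Q (Pi.single i (1 : ℤ)) (Pi.single j (1 : ℤ))).det ≠ 0

/-- Indefinite: `Q` takes both positive and negative values. (By homogeneity and density of the
rationals, integral vectors suffice.) -/
def QuadIndefinite {n : ℕ} (Q : QuadraticForm ℤ (Fin n → ℤ)) : Prop :=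
  (∃ x, 0 < Q x) ∧ ∃ y, Q y < 0

/-! Put n = N + 3 and R = max(1, H/ℓ). If there is a solution x, every other one is x + ℓy with y in
a box of size O(R). Expanding Q(x + ℓy) = Q(x) gives a·y ≡ 0 mod ℓ, where a is the linear form
`polarVec Q x`; hence c·y ≡ 0 mod ℓ for every c in the lattice L = ℤa + ℓℤⁿ. Since a·x = 2m, the
order of a modulo ℓ is at least ℓ/|2m|, so L has many short vectors: there are independent c_0, ...,
c_{n-1} in L of increasing length with ∏|c_k| ≪ ℓ^{n-1} (`exists_reduced_vectors`).

Let G = 1 + H/ℓ^{n/(n-1)}. If R|c_0|/ℓ ≤ G, the points y lie on O(G) hyperplanes c_0·y = ℓk, and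
each carries O(R^{n-3+ε}) of them (`exists_card_hyperplane_section_le`). Otherwise c_0 is long. In
the integral coordinates c_k·y/ℓ, of size at most U_k ≪ R|c_k|/ℓ, the quadric has O(∏_{k≥2} U_k ·
R^ε) points (`exists_card_reduced_box_le`). The lower bound for |c_0| and |c_1|, the bound for
∏|c_k| and n ≥ 4 turn this into R^{n-3+ε}G.

Both counts rest on `exists_card_quadric_box_le`, uniform in the quadric: cut by parallel planes in
a direction where the quadratic part is nondegenerate. Nondegenerate conics have O(V^ε) points in a
box of size V. The degenerate ones have O(V) each, but they occur only for the zeros of a nonzero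
polynomial, hence for a proportion O(1/V) of the planes. That some plane section is nondegenerate is
where n ≥ 4 and m ≠ 0 enter (`exists_nondegenerate_plane`).

For conics, uniformity comes from `exists_small_kernel_ne_zero`: the equation may be replaced by one
with integer coefficients polynomially bounded in the box that vanishes at the same points and is
still nondegenerate. Completing squares yields X² - DY² = n with data of polynomial size. Its
solutions fall into classes indexed by divisors, and inside a class they differ by solutions of A² -
DB² = 4, which number O(1) for D < 0 and grow geometrically for D > 0. -/

/-! ### Polynomial functions and their zeros on grids. -/

/-- `f` restricts to a polynomial of degree at most `d` on every line. -/
def LinePoly {E : Type*} [AddCommGroup E] [Module ℚ E] (d : ℕ) (f : E → ℚ) : Prop :=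
  ∀ x y : E, ∃ p : Polynomial ℚ, p.natDegree ≤ d ∧ ∀ t : ℚ, f (x + t • y) = p.eval t

namespace LinePoly

variable {E F : Type*} [AddCommGroup E] [Module ℚ E] [AddCommGroup F] [Module ℚ F]

theorem mono {d e : ℕ} {f : E → ℚ} (hf : LinePoly d f) (h : d ≤ e) : LinePoly e f := by
  intro x y
  obtain ⟨p, hp, h'⟩ := hf x y
  exact ⟨p, hp.trans h, h'⟩

theorem const (c : ℚ) : LinePoly 0 (fun _ : E => c) := fun _ _ =>
  ⟨Polynomial.C c, by simp, by simp⟩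

theorem linear (l : E →ₗ[ℚ] ℚ) : LinePoly 1 (fun x => l x) := fun x y =>
  ⟨Polynomial.C (l y) * Polynomial.X + Polynomial.C (l x), Polynomial.natDegree_linear_le,
    fun t => by simp; ring⟩

theorem add {d : ℕ} {f g : E → ℚ} (hf : LinePoly d f) (hg : LinePoly d g) :
    LinePoly d (fun x => f x + g x) := by
  intro x y
  obtain ⟨p, hp, h⟩ := hf x y
  obtain ⟨q, hq, h'⟩ := hg x y
  exact ⟨p + q, (Polynomial.natDegree_add_le _ _).trans (max_le hp hq), fun t => by simp [h, h']⟩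

theorem mul {d e : ℕ} {f g : E → ℚ} (hf : LinePoly d f) (hg : LinePoly e g) :
    LinePoly (d + e) (fun x => f x * g x) := by
  intro x y
  obtain ⟨p, hp, h⟩ := hf x y
  obtain ⟨q, hq, h'⟩ := hg x y
  exact ⟨p * q, Polynomial.natDegree_mul_le.trans (add_le_add hp hq), fun t => by simp [h, h']⟩

theorem const_mul {d : ℕ} {f : E → ℚ} (hf : LinePoly d f) (c : ℚ) :
    LinePoly d (fun x => c * f x) := by
  simpa using (LinePoly.const (E := E) c).mul hf

theorem neg {d : ℕ} {f : E → ℚ} (hf : LinePoly d f) : LinePoly d (fun x => -f x) := by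
  simpa using hf.const_mul (-1)

theorem sub {d : ℕ} {f g : E → ℚ} (hf : LinePoly d f) (hg : LinePoly d g) :
    LinePoly d (fun x => f x - g x) := by
  simpa [sub_eq_add_neg] using hf.add hg.neg

theorem comp_affine {d : ℕ} {f : E → ℚ} (hf : LinePoly d f) (A : F →ₗ[ℚ] E) (b : E) :
    LinePoly d (fun x => f (b + A x)) := by
  intro x y
  obtain ⟨p, hp, h⟩ := hf (b + A x) (A y)
  exact ⟨p, hp, fun t => by rw [← h]; simp [add_assoc]⟩

theorem comp_linear {d : ℕ} {f : E → ℚ} (hf : LinePoly d f) (A : F →ₗ[ℚ] E) :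
    LinePoly d (fun x => f (A x)) := by
  simpa using hf.comp_affine A 0

theorem bilin (β : LinearMap.BilinForm ℚ E) (A B : F →ₗ[ℚ] E) :
    LinePoly 2 (fun x => β (A x) (B x)) := by
  intro x y
  refine ⟨Polynomial.C (β (A y) (B y)) * Polynomial.X ^ 2
    + Polynomial.C (β (A x) (B y) + β (A y) (B x)) * Polynomial.X
    + Polynomial.C (β (A x) (B x)), Polynomial.natDegree_quadratic_le, fun t => ?_⟩
  simp
  ring

/-- On the line joining the two points both functions restrict to nonzero polynomials, and ℚ[t] is a
domain. Two open conditions can thus be met at one point. -/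
theorem exists_mul_ne_zero {d e : ℕ} {f g : E → ℚ} (hf : LinePoly d f) (hg : LinePoly e g)
    {x y : E} (hx : f x ≠ 0) (hy : g y ≠ 0) : ∃ z, f z * g z ≠ 0 := by
  obtain ⟨p, -, hp⟩ := hf x (y - x)
  obtain ⟨q, -, hq⟩ := hg x (y - x)
  have hp0 : p ≠ 0 := by
    rintro rfl
    exact hx (by simpa using hp 0)
  have hq0 : q ≠ 0 := by
    rintro rfl
    exact hy (by simpa using hq 1)
  obtain ⟨t, ht⟩ : ∃ t, (p * q).eval t ≠ 0 := by
    by_contra! h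
    exact mul_ne_zero hp0 hq0 (Polynomial.funext (by simpa using h))
  exact ⟨x + t • (y - x), by rw [hp, hq]; simpa using ht⟩

/-- On a line where it does not vanish identically, `f` has at most `d` zeros. -/
theorem card_zeros_le {d : ℕ} {f : E → ℚ} (hf : LinePoly d f) {x y : E} {t₀ : ℚ}
    (h0 : f (x + t₀ • y) ≠ 0) (S : Finset ℚ) (hS : ∀ t ∈ S, f (x + t • y) = 0) :
    S.card ≤ d := by
  obtain ⟨p, hd, hp⟩ := hf x y
  have hp0 : p ≠ 0 := by
    rintro rfl
    exact h0 (by simp [hp])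
  by_contra! h
  exact hp0 (p.eq_zero_of_natDegree_lt_card_of_eval_eq_zero' S
    (fun t ht => by rw [← hp, hS t ht]) (hd.trans_lt h))

end LinePoly

/-- A nonzero polynomial function of degree at most `d` does not vanish identically on a grid
with more than `d` values in each coordinate. -/
theorem LinePoly.exists_ne_zero_grid {ι : Type*} [Fintype ι] [DecidableEq ι] {d : ℕ}
    {f : (ι → ℚ) → ℚ} (hf : LinePoly d f) {x : ι → ℚ} (hx : f x ≠ 0) (S : Finset ℚ)
    (hS : d < S.card) : ∃ z : ι → ℚ, (∀ i, z i ∈ S) ∧ f z ≠ 0 := by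
  suffices h : ∀ I : Finset ι, ∃ z : ι → ℚ, (∀ i ∈ I, z i ∈ S) ∧ f z ≠ 0 by
    obtain ⟨z, hz, h⟩ := h Finset.univ
    exact ⟨z, fun i => hz i (Finset.mem_univ i), h⟩
  intro I
  induction I using Finset.induction_on with
  | empty => exact ⟨x, by simp, hx⟩
  | insert j I hj ih =>
    obtain ⟨z, hz, h⟩ := ih
    -- Coordinates are moved into `S` one at a time: on the line in direction j, `f` is nonzero at
    -- the present value z j, so at most d values are zeros.
    by_contra! hcon
    have key : ∀ t : ℚ, z + (t - z j) • Pi.single j (1 : ℚ) = Function.update z j t := by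
      intro t
      ext i
      by_cases hi : i = j
      · subst hi; simp
      · simp [hi]
    have key' : ∀ t : ℚ, Function.update z j 0 + t • Pi.single j (1 : ℚ)
        = Function.update z j t := by
      intro t
      ext i
      by_cases hi : i = j
      · subst hi; simp
      · simp [hi]
    have := hf.card_zeros_le (x := Function.update z j 0) (y := Pi.single j (1 : ℚ))
      (t₀ := z j) (by rw [key']; simpa using h) S (fun t ht => by
        rw [key']
        by_contra hne
        refine hne (hcon _ (fun i hi => ?_))
        by_cases hij : i = j
        · subst hij; simpa using ht
        · rw [Function.update_of_ne hij]
          exact hz i (Finset.mem_of_mem_insert_of_ne hi hij))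
    omega

/-- Zeros in a box of a nonzero polynomial function of degree at most `d`. -/
theorem LinePoly.card_zeros_box {d : ℕ} {V : ℕ} : ∀ {N : ℕ} {f : (Fin N → ℚ) → ℚ},
    LinePoly d f → ∀ {x : Fin N → ℚ}, f x ≠ 0 → ∀ (S : Fin N → Finset ℤ),
    (∀ i, V ≤ (S i).card) →
    ((Fintype.piFinset S).filter (fun u => f (fun i => (u i : ℚ)) = 0)).card * V
      ≤ d * N * ∏ i, (S i).card
  | 0, f, _, x, hx, S, _ => by
    have : ∀ u : Fin 0 → ℤ, f (fun i => (u i : ℚ)) ≠ 0 := fun u => by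
      rwa [Subsingleton.elim (fun i => (u i : ℚ)) x]
    simp [this]
  | N + 1, f, hf, x, hx, S, hS => by
    classical
    set T := (Fintype.piFinset S).filter (fun u => f (fun i => (u i : ℚ)) = 0) with hT
    let S' : Fin N → Finset ℤ := fun i => S i.succ
    let g : ℤ → (Fin N → ℚ) → ℚ := fun a y => f (Fin.cons (a : ℚ) y)
    have hg : ∀ a, LinePoly d (g a) := fun a => by
      have h := hf.comp_affine (LinearMap.pi (fun i : Fin (N + 1) =>
        (Fin.cons 0 (fun j => LinearMap.proj j) : Fin (N + 1) → ((Fin N → ℚ) →ₗ[ℚ] ℚ)) i))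
        (Fin.cons (a : ℚ) 0)
      have e : g a = fun y => f (Fin.cons (a : ℚ) 0 + LinearMap.pi (fun i : Fin (N + 1) =>
          (Fin.cons 0 (fun j => LinearMap.proj j) : Fin (N + 1) → ((Fin N → ℚ) →ₗ[ℚ] ℚ)) i) y) := by
        funext y
        refine congrArg f (funext fun i => ?_)
        refine Fin.cases ?_ (fun j => ?_) i <;> simp
      rw [e]
      exact h
    -- Slice by the first coordinate. At most d slices vanish identically, as seen on the line
    -- through x in that direction; such a slice is counted trivially, the others by induction on
    -- the dimension.
    let bad : Finset ℤ := (S 0).filter (fun a => g a = 0)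
    have hbad : bad.card ≤ d := by
      have := hf.card_zeros_le (x := Fin.cons 0 (Fin.tail x)) (y := Pi.single 0 (1 : ℚ))
        (t₀ := x 0) (by
          convert hx using 2
          ext i
          refine Fin.cases ?_ (fun j => ?_) i <;> simp [Fin.tail])
        (bad.map ⟨fun a : ℤ => (a : ℚ), Int.cast_injective⟩) (fun t ht => by
          simp only [Finset.mem_map, Function.Embedding.coeFn_mk] at ht
          obtain ⟨a, ha, rfl⟩ := ht
          have h0 : g a = 0 := (Finset.mem_filter.1 ha).2
          have := congrFun h0 (Fin.tail x)
          simp only [g, Pi.zero_apply] at this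
          refine (congrArg f (funext fun i => ?_)).trans this
          refine Fin.cases ?_ (fun j => ?_) i <;> simp)
      simpa using this
    have hfib : ∀ a ∈ S 0, (T.filter (fun u => u 0 = a)).card ≤
        ((Fintype.piFinset S').filter (fun u => g a (fun i => (u i : ℚ)) = 0)).card := by
      intro a ha
      refine Finset.card_le_card_of_injOn Fin.tail (fun u hu => ?_) (fun u hu v hv huv => ?_)
      · simp only [hT, Finset.coe_filter, Finset.mem_filter, Fintype.mem_piFinset,
          Set.mem_ofPred_eq] at hu ⊢
        refine ⟨fun i => hu.1.1 i.succ, ?_⟩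
        rw [← hu.1.2]
        refine congrArg f (funext fun i => ?_)
        refine Fin.cases ?_ (fun j => ?_) i <;> simp [hu.2, Fin.tail]
      · simp only [Finset.coe_filter, Set.mem_ofPred_eq] at hu hv
        rw [← Fin.cons_self_tail u, ← Fin.cons_self_tail v, huv, hu.2, hv.2]
    have hsum : T.card = ∑ a ∈ S 0, (T.filter (fun u => u 0 = a)).card :=
      Finset.card_eq_sum_card_fiberwise (fun u hu => by
        simp only [hT, Finset.coe_filter, Set.mem_ofPred_eq, Fintype.mem_piFinset] at hu
        exact hu.1 0)
    set P := ∏ i, (S' i).card with hP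
    have hprod : ∏ i, (S i).card = (S 0).card * P := Fin.prod_univ_succ _
    have hgood : ∀ a ∈ S 0, (T.filter (fun u => u 0 = a)).card * V ≤
        d * N * P + if a ∈ bad then P * (S 0).card else 0 := by
      intro a ha
      by_cases hb : a ∈ bad
      · rw [if_pos hb]
        have h1 : (T.filter (fun u => u 0 = a)).card ≤ P :=
          (hfib a ha).trans ((Finset.card_filter_le _ _).trans (by rw [Fintype.card_piFinset]))
        exact (Nat.mul_le_mul h1 (hS 0)).trans (Nat.le_add_left _ _)
      · rw [if_neg hb, add_zero]
        obtain ⟨y, hy⟩ : ∃ y, g a y ≠ 0 := by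
          by_contra! h
          exact hb (Finset.mem_filter.2 ⟨ha, funext h⟩)
        exact (Nat.mul_le_mul_right _ (hfib a ha)).trans
          (LinePoly.card_zeros_box (hg a) hy S' (fun i => hS i.succ))
    calc T.card * V = ∑ a ∈ S 0, (T.filter (fun u => u 0 = a)).card * V := by
          rw [hsum, Finset.sum_mul]
      _ ≤ ∑ a ∈ S 0, (d * N * P + if a ∈ bad then P * (S 0).card else 0) :=
          Finset.sum_le_sum hgood
      _ = (S 0).card * (d * N * P) + bad.card * (P * (S 0).card) := by
          rw [Finset.sum_add_distrib, Finset.sum_const, smul_eq_mul, ← Finset.sum_filter,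
            Finset.sum_const, smul_eq_mul]
          congr 3
          ext a
          simp [bad]
      _ ≤ (S 0).card * (d * N * P) + d * (P * (S 0).card) := by gcongr
      _ = d * (N + 1) * ∏ i, (S i).card := by rw [hprod]; ring

/-! ### Small integer vectors in kernels. -/

/-- The common kernel of a family of integer vectors with small entries is contained in the
rational span of small integer vectors of that kernel. -/
theorem exists_small_kernel_span {N : ℕ} {σ : Type*} (e : σ → Fin N → ℤ) {B : ℤ} (hB : 1 ≤ B)
    (he : ∀ s i, |e s i| ≤ B) :
    ∃ g : Fin N → Fin N → ℤ, (∀ j i, |g j i| ≤ (2 * N * B) ^ 2 ^ N) ∧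
      (∀ j s, e s ⬝ᵥ g j = 0) ∧
      ∀ q : Fin N → ℚ, (∀ s, (fun i => (e s i : ℚ)) ⬝ᵥ q = 0) →
        ∃ v : Fin N → ℚ, q = ∑ j, v j • fun i => (g j i : ℚ) := by
  rcases Nat.eq_zero_or_pos N with rfl | hN
  · exact ⟨fun _ => 0, by simp, by simp, fun q _ => ⟨0, Subsingleton.elim _ _⟩⟩
  set c : ℤ := 2 * N * B with hc
  have hN1 : (1 : ℤ) ≤ N := by exact_mod_cast hN
  have hc1 : 1 ≤ c := by nlinarith
  let K : Submodule ℚ (Fin N → ℚ) :=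
    ⨅ s, LinearMap.ker (dotProductBilin ℚ ℚ (fun i => (e s i : ℚ)))
  let sp : (Fin N → Fin N → ℤ) → Submodule ℚ (Fin N → ℚ) := fun g =>
    Submodule.span ℚ (Set.range fun j => (fun i => (g j i : ℚ)))
  have hK : ∀ q, q ∈ K ↔ ∀ s, (fun i => (e s i : ℚ)) ⬝ᵥ q = 0 := fun q => by
    simp [K, Submodule.mem_iInf]
  have hcast : ∀ s (g : Fin N → ℤ),
      (fun i => (e s i : ℚ)) ⬝ᵥ (fun i => (g i : ℚ)) = ((e s ⬝ᵥ g : ℤ) : ℚ) := fun s g => by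
    simp [dotProduct]
  -- Fraction-free Gaussian elimination starting from the unit vectors. The span of `g` always
  -- contains K. As long as some g j₀ is not orthogonal to some e s, using it as pivot lowers the
  -- dimension of the span. A step turns height h into at most 2NB·h², whence the exponent 2^k - 1.
  have main : ∀ k ≤ N, (∃ g : Fin N → Fin N → ℤ, (∀ j i, |g j i| ≤ c ^ (2 ^ k - 1)) ∧
      K ≤ sp g ∧ Module.finrank ℚ (sp g) + k ≤ N) ∨
      (∃ g : Fin N → Fin N → ℤ, (∀ j i, |g j i| ≤ c ^ (2 ^ k - 1)) ∧
        K ≤ sp g ∧ ∀ j s, e s ⬝ᵥ g j = 0) := by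
    intro k
    induction k with
    | zero =>
      intro _
      left
      refine ⟨fun j i => if i = j then 1 else 0, fun j i => ?_, ?_, ?_⟩
      · by_cases h : i = j <;> simp [h]
      · intro q _
        have : q = ∑ j, q j • (fun i => (((if i = j then 1 else 0 : ℤ)) : ℚ)) := by
          ext i
          simp [Finset.sum_apply]
        rw [this]
        exact Submodule.sum_mem _ fun j _ => Submodule.smul_mem _ _
          (Submodule.subset_span ⟨j, rfl⟩)
      · simpa using Submodule.finrank_le (sp fun j i => if i = j then 1 else 0)
    | succ k ih =>
      intro hk
      have hmono : c ^ (2 ^ k - 1) ≤ c ^ (2 ^ (k + 1) - 1) :=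
        pow_le_pow_right₀ hc1 (Nat.sub_le_sub_right (Nat.pow_le_pow_right (by norm_num) (by omega)) 1)
      rcases ih (by omega) with ⟨g, hg, hKg, hr⟩ | ⟨g, hg, hKg, h0⟩
      · by_cases hall : ∀ j s, e s ⬝ᵥ g j = 0
        · exact Or.inr ⟨g, fun j i => (hg j i).trans hmono, hKg, hall⟩
        push Not at hall
        obtain ⟨j₀, s, hne⟩ := hall
        left
        let g' : Fin N → Fin N → ℤ := fun j i => (e s ⬝ᵥ g j₀) * g j i - (e s ⬝ᵥ g j) * g j₀ i
        have hdot : ∀ j, |e s ⬝ᵥ g j| ≤ N * (B * c ^ (2 ^ k - 1)) := by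
          intro j
          calc |e s ⬝ᵥ g j| ≤ ∑ i, |e s i * g j i| := Finset.abs_sum_le_sum_abs _ _
            _ ≤ ∑ i : Fin N, B * c ^ (2 ^ k - 1) := Finset.sum_le_sum fun i _ => by
                rw [abs_mul]
                exact mul_le_mul (he s i) (hg j i) (abs_nonneg _) (by omega)
            _ = _ := by simp
        have hexp : 2 ^ (k + 1) - 1 = 1 + (2 ^ k - 1) + (2 ^ k - 1) := by
          have := Nat.one_le_two_pow (n := k)
          rw [pow_succ]
          omega
        -- The correction along g j₀ has total coefficient proportional to e s · q = 0, so q is the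
        -- same combination of the `g'`, up to the pivot factor.
        have hin : ∀ q ∈ sp g, (fun i => (e s i : ℚ)) ⬝ᵥ q = 0 → q ∈ sp g' := by
          intro q hq hq0
          obtain ⟨v, rfl⟩ := (Submodule.mem_span_range_iff_exists_fun ℚ).1 hq
          have hne' : ((e s ⬝ᵥ g j₀ : ℤ) : ℚ) ≠ 0 := by exact_mod_cast hne
          have h1 : ∑ j, v j * ((e s ⬝ᵥ g j : ℤ) : ℚ) = 0 := by
            rw [← hq0, dotProduct_sum]
            refine Finset.sum_congr rfl fun j _ => ?_
            rw [dotProduct_smul, hcast, smul_eq_mul]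
          have h2 : (∑ j, v j • fun i => (g j i : ℚ)) =
              ∑ j, (v j / ((e s ⬝ᵥ g j₀ : ℤ) : ℚ)) • fun i => (g' j i : ℚ) := by
            ext i
            simp only [Finset.sum_apply, Pi.smul_apply, smul_eq_mul, g', Int.cast_sub, Int.cast_mul]
            have : ∑ j, v j / ((e s ⬝ᵥ g j₀ : ℤ) : ℚ) * (((e s ⬝ᵥ g j₀ : ℤ) : ℚ) * (g j i : ℚ)
                - ((e s ⬝ᵥ g j : ℤ) : ℚ) * (g j₀ i : ℚ)) = ∑ j, (v j * (g j i : ℚ)) -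
                (∑ j, v j * ((e s ⬝ᵥ g j : ℤ) : ℚ)) * ((g j₀ i : ℚ) / ((e s ⬝ᵥ g j₀ : ℤ) : ℚ)) := by
              rw [Finset.sum_mul, ← Finset.sum_sub_distrib]
              refine Finset.sum_congr rfl fun j _ => ?_
              field_simp
            rw [this, h1]
            ring
          rw [h2]
          exact Submodule.sum_mem _ fun j _ => Submodule.smul_mem _ _
            (Submodule.subset_span ⟨j, rfl⟩)
        refine ⟨g', fun j i => ?_, fun q hq => hin q (hKg hq) ((hK q).1 hq s), ?_⟩
        · have hp : 0 ≤ c ^ (2 ^ k - 1) := by positivity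
          calc |g' j i| ≤ |(e s ⬝ᵥ g j₀) * g j i| + |(e s ⬝ᵥ g j) * g j₀ i| := abs_sub _ _
            _ ≤ N * (B * c ^ (2 ^ k - 1)) * c ^ (2 ^ k - 1)
                + N * (B * c ^ (2 ^ k - 1)) * c ^ (2 ^ k - 1) := by
                rw [abs_mul, abs_mul]
                exact add_le_add
                  (mul_le_mul (hdot _) (hg _ _) (abs_nonneg _) (by positivity))
                  (mul_le_mul (hdot _) (hg _ _) (abs_nonneg _) (by positivity))
            _ = c ^ (2 ^ (k + 1) - 1) := by rw [hexp, pow_add, pow_add, pow_one, hc]; ring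
        · have hle : sp g' ≤ sp g ⊓ LinearMap.ker (dotProductBilin ℚ ℚ (fun i => (e s i : ℚ))) := by
            refine Submodule.span_le.2 ?_
            rintro _ ⟨j, rfl⟩
            constructor
            · have : (fun i => (g' j i : ℚ)) = ((e s ⬝ᵥ g j₀ : ℤ) : ℚ) • (fun i => (g j i : ℚ))
                  - ((e s ⬝ᵥ g j : ℤ) : ℚ) • (fun i => (g j₀ i : ℚ)) := by
                ext i
                simp [g']
              simp only [this]
              exact Submodule.sub_mem _
                (Submodule.smul_mem _ _ (Submodule.subset_span ⟨j, rfl⟩))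
                (Submodule.smul_mem _ _ (Submodule.subset_span ⟨j₀, rfl⟩))
            · have : e s ⬝ᵥ g' j = 0 := by
                have : g' j = (e s ⬝ᵥ g j₀) • g j - (e s ⬝ᵥ g j) • g j₀ := by
                  ext i
                  simp [g']
                rw [this, dotProduct_sub, dotProduct_smul, dotProduct_smul]
                simp only [smul_eq_mul]
                ring
              show (fun i => (e s i : ℚ)) ⬝ᵥ (fun i => (g' j i : ℚ)) = 0
              rw [hcast, this, Int.cast_zero]
          have hlt : sp g' < sp g := by
            refine lt_of_le_of_ne (hle.trans inf_le_left) fun heq => ?_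
            have h1 : (fun i => (g j₀ i : ℚ)) ∈ sp g' :=
              heq ▸ Submodule.subset_span ⟨j₀, rfl⟩
            have h2 : (fun i => (e s i : ℚ)) ⬝ᵥ (fun i => (g j₀ i : ℚ)) = 0 := (hle h1).2
            rw [hcast] at h2
            exact hne (by exact_mod_cast h2)
          have := Submodule.finrank_lt_finrank_of_lt hlt
          omega
      · exact Or.inr ⟨g, fun j i => (hg j i).trans hmono, hKg, h0⟩
  have hfin : ∃ g : Fin N → Fin N → ℤ, (∀ j i, |g j i| ≤ c ^ (2 ^ N - 1)) ∧
      K ≤ sp g ∧ ∀ j s, e s ⬝ᵥ g j = 0 := by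
    rcases main N le_rfl with ⟨g, hg, hKg, hr⟩ | h
    · refine ⟨g, hg, hKg, fun j s => ?_⟩
      have h0 : sp g = ⊥ := Submodule.finrank_eq_zero.1 (by omega)
      have h1 : (fun i => (g j i : ℚ)) ∈ sp g := Submodule.subset_span ⟨j, rfl⟩
      rw [h0, Submodule.mem_bot] at h1
      have : g j = 0 := by
        ext i
        have := congrFun h1 i
        simpa using this
      rw [this, dotProduct_zero]
    · exact h
  obtain ⟨g, hg, hKg, h0⟩ := hfin
  refine ⟨g, fun j i => (hg j i).trans (pow_le_pow_right₀ hc1 (Nat.sub_le _ _)), h0,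
    fun q hq => ?_⟩
  obtain ⟨v, hv⟩ := (Submodule.mem_span_range_iff_exists_fun ℚ).1 (hKg ((hK q).2 hq))
  exact ⟨v, hv.symm⟩

/-- If a polynomial function is nonzero at some point of the common kernel of integer vectors with
small entries, then it is nonzero at a small integer point of that kernel. -/
theorem exists_small_kernel_ne_zero {N d : ℕ} {σ : Type*} (e : σ → Fin N → ℤ) {B : ℤ} (hB : 1 ≤ B)
    (he : ∀ s i, |e s i| ≤ B) {f : (Fin N → ℚ) → ℚ} (hf : LinePoly d f) {q : Fin N → ℚ}
    (hq : ∀ s, (fun i => (e s i : ℚ)) ⬝ᵥ q = 0) (hfq : f q ≠ 0) :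
    ∃ z : Fin N → ℤ, (∀ i, |z i| ≤ N * d * (2 * N * B) ^ 2 ^ N) ∧ (∀ s, e s ⬝ᵥ z = 0) ∧
      f (fun i => (z i : ℚ)) ≠ 0 := by
  obtain ⟨g, hg, hg0, hspan⟩ := exists_small_kernel_span e hB he
  obtain ⟨v, rfl⟩ := hspan q hq
  -- The generators of the kernel parametrize it linearly, so f ∘ A is a nonzero polynomial function
  -- of degree at most d on ℚ^N and is nonzero somewhere on {0, ..., d}^N.
  let A : (Fin N → ℚ) →ₗ[ℚ] (Fin N → ℚ) := Fintype.linearCombination ℚ (fun j i => (g j i : ℚ))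
  have hA : ∀ w, A w = ∑ j, w j • fun i => (g j i : ℚ) := fun w =>
    Fintype.linearCombination_apply ..
  obtain ⟨w, hw, hfw⟩ := (hf.comp_linear A).exists_ne_zero_grid (x := v) (by rwa [hA])
    ((Finset.range (d + 1)).map ⟨fun k : ℕ => (k : ℚ), Nat.cast_injective⟩) (by simp)
  simp only [Finset.mem_map, Finset.mem_range, Function.Embedding.coeFn_mk] at hw
  choose k hk hkw using hw
  have hcast : A w = fun i => (((∑ j, (k j : ℤ) * g j i) : ℤ) : ℚ) := by
    rw [hA]
    ext i
    simp [← hkw, Finset.sum_apply]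
  refine ⟨fun i => ∑ j, (k j : ℤ) * g j i, fun i => ?_, fun s => ?_, hcast ▸ hfw⟩
  · calc |∑ j, (k j : ℤ) * g j i| ≤ ∑ j, |(k j : ℤ) * g j i| := Finset.abs_sum_le_sum_abs _ _
      _ ≤ ∑ j : Fin N, (d : ℤ) * (2 * N * B) ^ 2 ^ N := Finset.sum_le_sum fun j _ => by
          rw [abs_mul, Nat.abs_cast]
          have := hk j
          exact mul_le_mul (by exact_mod_cast (by omega : k j ≤ d)) (hg j i) (abs_nonneg _)
            (by positivity)
      _ = _ := by simp [mul_assoc]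
  · have : (fun i => ∑ j, (k j : ℤ) * g j i) = ∑ j, (k j : ℤ) • g j := by
      ext i
      simp [Finset.sum_apply]
    rw [this, dotProduct_sum]
    exact Finset.sum_eq_zero fun j _ => by rw [dotProduct_smul, hg0, smul_zero]

/-! ### The divisor bound. -/

/-- The divisor bound. -/
theorem exists_card_divisors_le (ε : ℝ) (hε : 0 < ε) :
    ∃ C : ℝ, 0 < C ∧ ∀ n : ℕ, n ≠ 0 → (n.divisors.card : ℝ) ≤ C * (n : ℝ) ^ ε := by
  -- The ratio of the divisor function to n^ε is a product of factors (k + 1)/p^{εk}. A factor is at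
  -- most 1 once p^ε ≥ 2, hence for p ≥ P. The remaining primes contribute at most 1/δ each, because
  -- δ(k + 1) ≤ 1 + kε log 2 ≤ 2^{εk}.
  set δ : ℝ := min 1 (ε * Real.log 2) with hδ
  have hl2 : 0 < Real.log 2 := Real.log_pos (by norm_num)
  have hδ0 : 0 < δ := lt_min one_pos (by positivity)
  have hδ1 : δ ≤ 1 := min_le_left _ _
  set A : ℝ := δ⁻¹ with hA
  have hA1 : 1 ≤ A := (one_le_inv₀ hδ0).2 hδ1
  obtain ⟨P, hP⟩ := exists_nat_gt ((2 : ℝ) ^ (1 / ε))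
  refine ⟨A ^ P, by positivity, fun n hn => ?_⟩
  have hbase : ∀ (k : ℕ) (p : ℕ), 2 ≤ p → ((k : ℝ) + 1) ≤ A * ((p : ℝ) ^ ε) ^ k := by
    intro k p hp
    have hp' : (2 : ℝ) ≤ p := by exact_mod_cast hp
    have h1 : (1 : ℝ) + k * (ε * Real.log 2) ≤ ((p : ℝ) ^ ε) ^ k := by
      calc (1 : ℝ) + k * (ε * Real.log 2) ≤ Real.exp (k * (ε * Real.log 2)) := by
            linarith [Real.add_one_le_exp (k * (ε * Real.log 2))]
        _ = ((2 : ℝ) ^ ε) ^ k := by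
            rw [Real.rpow_def_of_pos (by norm_num), ← Real.exp_nat_mul]
            ring_nf
        _ ≤ _ := by gcongr
    have h2 : δ * (k + 1) ≤ 1 + k * (ε * Real.log 2) := by
      have : δ ≤ ε * Real.log 2 := min_le_right _ _
      have hk : (0 : ℝ) ≤ k := by positivity
      nlinarith
    rw [hA, inv_mul_eq_div, le_div_iff₀ hδ0]
    linarith
  have hbig : ∀ (k : ℕ) (p : ℕ), P ≤ p → ((k : ℝ) + 1) ≤ ((p : ℝ) ^ ε) ^ k := by
    intro k p hp
    have h1 : (2 : ℝ) ≤ (p : ℝ) ^ ε := by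
      have hp' : (2 : ℝ) ^ (1 / ε) ≤ p := hP.le.trans (by exact_mod_cast hp)
      calc (2 : ℝ) = ((2 : ℝ) ^ (1 / ε)) ^ ε := by
            rw [← Real.rpow_mul (by norm_num), one_div_mul_cancel hε.ne', Real.rpow_one]
        _ ≤ _ := Real.rpow_le_rpow (by positivity) hp' hε.le
    have h2 : (k : ℝ) + 1 ≤ 2 ^ k := by
      exact_mod_cast Nat.lt_two_pow_self
    exact h2.trans (by gcongr)
  have hstep : ∀ p ∈ n.primeFactors, ((n.factorization p : ℝ) + 1) ≤
      (if p < P then A else 1) * ((p : ℝ) ^ ε) ^ n.factorization p := by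
    intro p hp
    split_ifs with h
    · exact hbase _ _ (Nat.prime_of_mem_primeFactors hp).two_le
    · rw [one_mul]
      exact hbig _ _ (not_lt.1 h)
  have hn' : ∏ p ∈ n.primeFactors, ((p : ℝ) ^ ε) ^ n.factorization p = (n : ℝ) ^ ε := by
    conv_rhs => rw [← Nat.prod_factorization_pow_eq_self hn]
    rw [Finsupp.prod, Nat.support_factorization, Nat.cast_prod,
      ← Real.finsetProd_rpow _ _ (fun i _ => by positivity)]
    refine Finset.prod_congr rfl fun p _ => ?_
    rw [Nat.cast_pow, ← Real.rpow_natCast, ← Real.rpow_natCast, ← Real.rpow_mul (by positivity),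
      ← Real.rpow_mul (by positivity), mul_comm]
  rw [Nat.card_divisors hn]
  push_cast
  refine (Finset.prod_le_prod (fun p _ => by positivity) hstep).trans ?_
  rw [Finset.prod_mul_distrib, hn']
  gcongr
  rw [Finset.prod_ite, Finset.prod_const, Finset.prod_const_one, mul_one]
  refine pow_le_pow_right₀ hA1 ?_
  calc _ ≤ (Finset.range P).card := Finset.card_le_card fun p hp =>
        Finset.mem_range.2 (Finset.mem_filter.1 hp).2
    _ = P := Finset.card_range P

/-! ### Pell equations. -/

/-- A set of positive integers whose elements grow by a factor at least `3/2` is small. -/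
theorem card_le_of_growth (T : Finset ℕ) {P : ℕ} (h1 : ∀ a ∈ T, 1 ≤ a) (hP : ∀ a ∈ T, a ≤ P)
    (hg : ∀ a ∈ T, ∀ b ∈ T, a < b → 3 * a ≤ 2 * b) : T.card ≤ Nat.log 2 (P ^ 2) + 1 := by
  -- Squaring turns the ratio 3/2 into 9/4 > 2, so the binary logarithms of the squares are
  -- distinct.
  have key : ∀ a ∈ T, ∀ b ∈ T, a < b → Nat.log 2 (a ^ 2) < Nat.log 2 (b ^ 2) := by
    intro a ha b hb hab
    have h := hg a ha b hb hab
    have ha1 := h1 a ha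
    have : a ^ 2 * 2 ≤ b ^ 2 := by nlinarith
    calc Nat.log 2 (a ^ 2) < Nat.log 2 (a ^ 2 * 2) := by
          rw [Nat.log_mul_base (by norm_num) (by positivity)]
          omega
      _ ≤ _ := Nat.log_mono_right this
  calc T.card ≤ (Finset.range (Nat.log 2 (P ^ 2) + 1)).card := by
        refine Finset.card_le_card_of_injOn (fun a => Nat.log 2 (a ^ 2)) (fun a ha => ?_) ?_
        · simp only [Finset.coe_range, Set.mem_Iio]
          have := Nat.log_mono_right (b := 2) (Nat.pow_le_pow_left (hP a ha) 2)
          omega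
        · intro a ha b hb hab
          by_contra hne
          rcases lt_or_gt_of_ne hne with h | h
          · exact (key a ha b hb h).ne hab
          · exact (key b hb a ha h).ne' hab
    _ = _ := Finset.card_range _

/-- Two nonnegative solutions of `A² - D B² = 4` differ by a unit, so that the solutions grow. -/
theorem pell_four_growth {D A B A' B' : ℤ} (hD : 0 < D) (hA : 0 ≤ A) (hB : 0 ≤ B)
    (hB' : 0 ≤ B') (h : A ^ 2 - D * B ^ 2 = 4) (h' : A' ^ 2 - D * B' ^ 2 = 4)
    (hlt : A < A') : 3 * A ≤ 2 * A' := by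
  -- The parity X ≡ DY mod 2 makes the formal quotient (A' + B'√D)/(A + B√D) equal to (a + b√D)/2
  -- with integers a, b, again of norm one.
  have par : ∀ {X Y : ℤ}, X ^ 2 - D * Y ^ 2 = 4 → (2 : ℤ) ∣ X - D * Y := by
    intro X Y hXY
    have h2 : (2 : ℤ) ∣ X ^ 2 - D * Y ^ 2 := ⟨2, by rw [hXY]; norm_num⟩
    rcases Int.even_or_odd' X with ⟨x, rfl | rfl⟩ <;> rcases Int.even_or_odd' Y with ⟨y, rfl | rfl⟩
      <;> rcases Int.even_or_odd' D with ⟨d, rfl | rfl⟩ <;> ring_nf at h2 ⊢ <;> omega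
  obtain ⟨s, hs⟩ := par h
  obtain ⟨s', hs'⟩ := par h'
  obtain ⟨a, ha⟩ : (2 : ℤ) ∣ A * A' - D * B * B' := by
    have e1 : A = D * B + 2 * s := by linarith
    have e2 : A' = D * B' + 2 * s' := by linarith
    have : (2 : ℤ) ∣ D * D - D := by
      rcases Int.even_or_odd' D with ⟨d, rfl | rfl⟩
      · exact ⟨d * (2 * d) - d, by ring⟩
      · exact ⟨d * (2 * d + 1), by ring⟩
    obtain ⟨r, hr⟩ := this
    exact ⟨r * B * B' + s * (D * B') + s' * (D * B) + 2 * s * s', by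
      rw [e1, e2]
      linear_combination B * B' * hr⟩
  obtain ⟨b, hb⟩ : (2 : ℤ) ∣ A * B' - A' * B := by
    have e1 : A = D * B + 2 * s := by linarith
    have e2 : A' = D * B' + 2 * s' := by linarith
    exact ⟨s * B' - s' * B, by rw [e1, e2]; ring⟩
  have hab : a ^ 2 - D * b ^ 2 = 4 := by
    have : (2 * a) ^ 2 - D * (2 * b) ^ 2 = 16 := by
      rw [← ha, ← hb]
      linear_combination (A' ^ 2 - D * B' ^ 2) * h + 4 * h'
    linarith
  have hA2 : 2 * A' = a * A + D * b * B := by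
    have : 4 * A' = 2 * (a * A + D * b * B) := by
      linear_combination A * ha + D * B * hb - A' * h
    linarith
  have hBB : B < B' := by
    by_contra! hle
    have : B' ^ 2 ≤ B ^ 2 := by nlinarith
    nlinarith
  have hb0 : 0 < b := by
    have h1 : (A * B') ^ 2 - (A' * B) ^ 2 = 4 * (B' ^ 2 - B ^ 2) := by
      linear_combination B' ^ 2 * h - B ^ 2 * h'
    have h2 : B ^ 2 < B' ^ 2 := by nlinarith
    have h3 : (A' * B) ^ 2 < (A * B') ^ 2 := by linarith
    have h4 : A' * B < A * B' := lt_of_pow_lt_pow_left₀ 2 (by positivity) h3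
    linarith
  -- Here a > 0 and a² = 4 + Db² ≥ 5, so a ≥ 3; then 2A' = aA + DbB ≥ 3A.
  have ha0 : 3 ≤ a := by
    have h1 : (D * B * B') ^ 2 < (A * A') ^ 2 := by
      have e : (A * A') ^ 2 = (4 + D * B ^ 2) * (4 + D * B' ^ 2) := by
        have e1 : A ^ 2 = 4 + D * B ^ 2 := by linarith
        have e2 : A' ^ 2 = 4 + D * B' ^ 2 := by linarith
        rw [mul_pow, e1, e2]
      rw [e]
      nlinarith [mul_nonneg hD.le (sq_nonneg B), mul_nonneg hD.le (sq_nonneg B')]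
    have h2 : D * B * B' < A * A' :=
      lt_of_pow_lt_pow_left₀ 2 (mul_nonneg hA (by linarith)) h1
    have ha' : 0 < a := by linarith
    by_contra! hlt3
    have : 1 ≤ D * b ^ 2 := by
      have := mul_pos hD (pow_pos hb0 2)
      linarith
    nlinarith
  have : 0 ≤ D * b * B := by positivity
  nlinarith

/-- Solutions of `A² - D B² = 4` of bounded size. -/
theorem card_pell_four_le {D : ℤ} (hD : D ≠ 0) {P : ℕ} (S : Finset (ℤ × ℤ))
    (hS : ∀ z ∈ S, z.1 ^ 2 - D * z.2 ^ 2 = 4 ∧ |z.1| ≤ P) :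
    S.card ≤ 25 * (Nat.log 2 (P ^ 2) + 1) := by
  classical
  rcases lt_or_gt_of_ne hD with hneg | hpos
  · have hsub : S ⊆ Finset.Icc (-2 : ℤ) 2 ×ˢ Finset.Icc (-2 : ℤ) 2 := by
      intro z hz
      obtain ⟨h, -⟩ := hS z hz
      have h1 : z.1 ^ 2 ≤ 4 := by nlinarith [sq_nonneg z.2]
      have h2 : z.2 ^ 2 ≤ 4 := by nlinarith [sq_nonneg z.2, sq_nonneg z.1]
      simp only [Finset.mem_product, Finset.mem_Icc]
      refine ⟨⟨?_, ?_⟩, ?_, ?_⟩ <;> nlinarith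
    have := Finset.card_le_card hsub
    simp at this
    omega
  · let T := S.image (fun z => z.1.natAbs)
    have hT : T.card ≤ Nat.log 2 (P ^ 2) + 1 := by
      refine card_le_of_growth T ?_ ?_ ?_
      · intro a ha
        obtain ⟨z, hz, rfl⟩ := Finset.mem_image.1 ha
        obtain ⟨h, -⟩ := hS z hz
        rcases Nat.eq_zero_or_pos z.1.natAbs with h0 | h0
        · rw [Int.natAbs_eq_zero] at h0
          rw [h0] at h
          nlinarith [sq_nonneg z.2]
        · exact h0
      · intro a ha
        obtain ⟨z, hz, rfl⟩ := Finset.mem_image.1 ha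
        have := (hS z hz).2
        rw [Int.abs_eq_natAbs] at this
        exact_mod_cast this
      · intro a ha b hb hab
        obtain ⟨z, hz, rfl⟩ := Finset.mem_image.1 ha
        obtain ⟨w, hw, rfl⟩ := Finset.mem_image.1 hb
        have := pell_four_growth (D := D) (A := |z.1|) (B := |z.2|) (A' := |w.1|) (B' := |w.2|) hpos
          (abs_nonneg _) (abs_nonneg _) (abs_nonneg _)
          (by simpa only [sq_abs] using (hS z hz).1) (by simpa only [sq_abs] using (hS w hw).1)
          (by rw [Int.abs_eq_natAbs, Int.abs_eq_natAbs]; exact_mod_cast hab)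
        rw [Int.abs_eq_natAbs, Int.abs_eq_natAbs] at this
        exact_mod_cast this
    -- Given |A| there are at most 4 choices of signs. The value 25 is the one needed for D < 0,
    -- where |A|, |B| ≤ 2.
    have hfib : ∀ a ∈ T, (S.filter (fun z => z.1.natAbs = a)).card ≤ 25 := by
      intro a _
      by_cases hne : (S.filter (fun z => z.1.natAbs = a)).Nonempty
      · obtain ⟨z, hz⟩ := hne
        obtain ⟨hzS, hza⟩ := Finset.mem_filter.1 hz
        have hsub : S.filter (fun z => z.1.natAbs = a) ⊆
            ({z.1, -z.1} : Finset ℤ) ×ˢ ({z.2, -z.2} : Finset ℤ) := by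
          intro w hw
          obtain ⟨hwS, hwa⟩ := Finset.mem_filter.1 hw
          have h1 : w.1 = z.1 ∨ w.1 = -z.1 := Int.natAbs_eq_natAbs_iff.1 (hwa.trans hza.symm)
          have h2 : w.2 = z.2 ∨ w.2 = -z.2 := by
            have e : w.1 ^ 2 = z.1 ^ 2 := by rcases h1 with h | h <;> rw [h]; ring
            have := (hS z hzS).1
            have := (hS w hwS).1
            have : D * w.2 ^ 2 = D * z.2 ^ 2 := by linarith
            exact sq_eq_sq_iff_eq_or_eq_neg.1 (mul_left_cancel₀ hD this)
          simp [h1, h2]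
        refine (Finset.card_le_card hsub).trans ?_
        rw [Finset.card_product]
        have h1 := Finset.card_le_two (a := z.1) (b := -z.1)
        have h2 := Finset.card_le_two (a := z.2) (b := -z.2)
        nlinarith
      · rw [Finset.not_nonempty_iff_eq_empty.1 hne]
        simp
    calc S.card ≤ 25 * T.card :=
          Finset.card_le_mul_card_image S 25 hfib
      _ ≤ _ := by gcongr

/-- The divisibility behind the comparison of two coprime solutions of `X² - D Y² = n`. -/
theorem dvd_two_mul_cross {D n : ℤ} (hD : Squarefree D) (hn : n ≠ 0)
    {X₀ Y₀ X Y X' Y' : ℤ} (h₀ : X₀ ^ 2 - D * Y₀ ^ 2 = n) (c₀ : IsCoprime X₀ Y₀)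
    (h : X ^ 2 - D * Y ^ 2 = n) (c : IsCoprime X Y)
    (h' : X' ^ 2 - D * Y' ^ 2 = n)
    (hg : Int.gcd (X * Y₀ - X₀ * Y) n = Int.gcd (X' * Y₀ - X₀ * Y') n) :
    n ∣ 2 * (X * Y' - X' * Y) := by
  have cop : ∀ {x y : ℤ}, x ^ 2 - D * y ^ 2 = n → IsCoprime x y → IsCoprime y n := by
    intro x y hxy hc
    have h1 : IsCoprime y (x ^ 2) := hc.symm.pow_right
    have : n = x ^ 2 + y * (-(D * y)) := by rw [← hxy]; ring
    rw [this]
    exact h1.add_mul_left_right _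
  set g : ℤ := ((Int.gcd (X * Y₀ - X₀ * Y) n : ℕ) : ℤ) with hgdef
  have hg0 : g ≠ 0 := by
    rw [hgdef]
    exact_mod_cast (Int.gcd_pos_of_ne_zero_right _ hn).ne'
  obtain ⟨k, hk⟩ : g ∣ n := Int.gcd_dvd_right ..
  have hgA : g ∣ X * Y₀ - X₀ * Y := Int.gcd_dvd_left ..
  have hgA' : g ∣ X' * Y₀ - X₀ * Y' := by
    rw [hgdef, hg]
    exact Int.gcd_dvd_left ..
  -- Since (xY₀ - X₀y)(xY₀ + X₀y) = n(Y₀² - y²), the part k = n/g of n left over by the gcd with the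
  -- first factor must divide the second.
  have cofactor : ∀ {x y : ℤ}, x ^ 2 - D * y ^ 2 = n →
      ((Int.gcd (x * Y₀ - X₀ * y) n : ℕ) : ℤ) = g → k ∣ x * Y₀ + X₀ * y := by
    intro x y hxy hgg
    have e : (x * Y₀ - X₀ * y) * (x * Y₀ + X₀ * y) = n * (Y₀ ^ 2 - y ^ 2) := by
      linear_combination Y₀ ^ 2 * hxy - y ^ 2 * h₀
    obtain ⟨a, ha⟩ : g ∣ x * Y₀ - X₀ * y := hgg ▸ Int.gcd_dvd_left ..
    have hak : IsCoprime k a := by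
      have hb := Int.gcd_eq_gcd_ab (x * Y₀ - X₀ * y) n
      rw [hgg, ha, hk] at hb
      refine ⟨Int.gcdB (g * a) (g * k), Int.gcdA (g * a) (g * k), ?_⟩
      refine mul_left_cancel₀ hg0 ?_
      linear_combination -hb
    rw [ha, hk, mul_assoc, mul_assoc] at e
    have e' := mul_left_cancel₀ hg0 e
    exact hak.dvd_of_dvd_mul_left ⟨_, e'⟩
  have hkB := cofactor h rfl
  have hkB' := cofactor h' (by rw [hgdef, hg])
  have cY₀ := cop h₀ c₀
  have cY := cop h c
  have hgn : g ∣ n := ⟨k, hk⟩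
  have hkn : k ∣ n := ⟨g, by rw [hk]; ring⟩
  have hgw : g ∣ X * Y' - X' * Y := by
    refine (cY₀.of_isCoprime_of_dvd_right hgn).symm.dvd_of_dvd_mul_left (y := Y₀) ?_
    have : Y₀ * (X * Y' - X' * Y) = Y' * (X * Y₀ - X₀ * Y) - Y * (X' * Y₀ - X₀ * Y') := by ring
    rw [this]
    exact dvd_sub (hgA.mul_left _) (hgA'.mul_left _)
  have hkw : k ∣ X * Y' - X' * Y := by
    refine (cY₀.of_isCoprime_of_dvd_right hkn).symm.dvd_of_dvd_mul_left (y := Y₀) ?_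
    have : Y₀ * (X * Y' - X' * Y) = Y' * (X * Y₀ + X₀ * Y) - Y * (X' * Y₀ + X₀ * Y') := by ring
    rw [this]
    exact dvd_sub (hkB.mul_left _) (hkB'.mul_left _)
  -- the common part of `g` and `k` divides `2`
  set r : ℤ := GCDMonoid.gcd g k with hr
  have hrg : r ∣ g := gcd_dvd_left g k
  have hrk : r ∣ k := gcd_dvd_right g k
  have hr2n : r ^ 2 ∣ n := by
    rw [hk, pow_two]
    exact mul_dvd_mul hrg hrk
  have hr2X : r ∣ 2 * X := by
    have h1 : r ∣ Y₀ * (2 * X) := by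
      have : Y₀ * (2 * X) = (X * Y₀ - X₀ * Y) + (X * Y₀ + X₀ * Y) := by ring
      rw [this]
      exact dvd_add (hrg.trans hgA) (hrk.trans hkB)
    exact (cY₀.of_isCoprime_of_dvd_right (hrg.trans hgn)).symm.dvd_of_dvd_mul_left h1
  -- Squarefreeness of D: if s ∣ X and s² ∣ n, then s² ∣ DY² with s prime to Y, so s² ∣ D.
  have sq_dvd : ∀ s : ℤ, s ∣ X → s ^ 2 ∣ n → IsUnit s := by
    intro s hsX hsn
    have h1 : s ^ 2 ∣ D * Y ^ 2 := by
      have : D * Y ^ 2 = X ^ 2 - n := by rw [← h]; ring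
      rw [this]
      exact dvd_sub (pow_dvd_pow_of_dvd hsX 2) hsn
    have h2 : IsCoprime (s ^ 2) (Y ^ 2) := by
      refine (IsCoprime.pow_left (IsCoprime.pow_right ?_))
      exact (cY.of_isCoprime_of_dvd_right ((dvd_pow_self s two_ne_zero).trans hsn)).symm
    have h3 : s ^ 2 ∣ D := h2.dvd_of_dvd_mul_right h1
    exact hD s (by rwa [← pow_two])
  have hr2 : r ∣ 2 := by
    rcases Int.even_or_odd' r with ⟨s, hs | hs⟩
    · have : IsUnit s := by
        refine sq_dvd s ?_ (dvd_trans ⟨4, by rw [hs]; ring⟩ hr2n)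
        rw [hs] at hr2X
        exact (mul_dvd_mul_iff_left (by norm_num)).1 hr2X
      rw [hs]
      exact this.mul_right_dvd.2 dvd_rfl
    · have c2 : IsCoprime r 2 := ⟨1, -s, by rw [hs]; ring⟩
      exact ((sq_dvd r (c2.dvd_of_dvd_mul_left hr2X) hr2n).dvd)
  -- Writing r = ga + kb, both terms of r(XY' - X'Y) are divisible by gk = n, and r ∣ 2.
  obtain ⟨a, b, hab⟩ : ∃ a b : ℤ, r = g * a + k * b := exists_gcd_eq_mul_add_mul g k
  obtain ⟨t, ht⟩ := hr2
  obtain ⟨u, hu⟩ := hgw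
  obtain ⟨v, hv⟩ := hkw
  refine ⟨t * (a * v + b * u), ?_⟩
  rw [ht, hab, hk]
  linear_combination t * g * a * hv + t * k * b * hu

/-- Coprime solutions of `X² - D Y² = n` with `D` squarefree. -/
theorem card_pell_coprime_le {D n : ℤ} (hD : Squarefree D) (hn : n ≠ 0) {P : ℕ}
    (S : Finset (ℤ × ℤ)) (hS : ∀ z ∈ S, z.1 ^ 2 - D * z.2 ^ 2 = n ∧ IsCoprime z.1 z.2 ∧
      |z.1| ≤ P ∧ |z.2| ≤ P) :
    S.card ≤ n.natAbs.divisors.card *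
      (25 * (Nat.log 2 ((2 * (1 + D.natAbs) * P ^ 2) ^ 2) + 1)) := by
  classical
  rcases S.eq_empty_or_nonempty with rfl | ⟨z₀, hz₀⟩
  · simp
  obtain ⟨h₀, c₀, -, -⟩ := hS z₀ hz₀
  have hmaps : ∀ z ∈ S, Int.gcd (z.1 * z₀.2 - z₀.1 * z.2) n ∈ n.natAbs.divisors := fun z _ => by
    rw [Nat.mem_divisors]
    exact ⟨Int.gcd_dvd_natAbs_right .., Int.natAbs_ne_zero.2 hn⟩
  rw [mul_comm]
  refine Finset.card_le_mul_card_image_of_maps_to hmaps _ fun g _ => ?_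
  set Sg := S.filter (fun z => Int.gcd (z.1 * z₀.2 - z₀.1 * z.2) n = g) with hSg
  rcases Sg.eq_empty_or_nonempty with he | ⟨w, hw⟩
  · rw [he]; simp
  obtain ⟨hwS, hwg⟩ := Finset.mem_filter.1 hw
  obtain ⟨hw1, cw, hwP, hwP'⟩ := hS w hwS
  -- Within a class of equal gcd, (A + B√D)/2 is the formal quotient of z by the fixed member w; the
  -- pair (A, B) determines z and satisfies A² - DB² = 4.
  have key : ∀ z ∈ Sg, ∃ A B : ℤ, 2 * (z.1 * w.1 - D * z.2 * w.2) = n * A ∧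
      2 * (w.1 * z.2 - z.1 * w.2) = n * B := by
    intro z hz
    obtain ⟨hzS, hzg⟩ := Finset.mem_filter.1 hz
    obtain ⟨hz1, cz, -, -⟩ := hS z hzS
    obtain ⟨B, hB⟩ := dvd_two_mul_cross hD hn h₀ c₀ hw1 cw hz1 (hwg.trans hzg.symm)
    have cY : IsCoprime w.2 n := by
      have h1 : IsCoprime w.2 (w.1 ^ 2) := cw.symm.pow_right
      have : n = w.1 ^ 2 + w.2 * (-(D * w.2)) := by rw [← hw1]; ring
      rw [this]
      exact h1.add_mul_left_right _
    have hdvd : n ∣ w.2 * (2 * (z.1 * w.1 - D * z.2 * w.2)) := by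
      refine ⟨2 * z.2 - w.1 * B, ?_⟩
      linear_combination 2 * z.2 * hw1 - w.1 * hB
    obtain ⟨A, hA⟩ := cY.symm.dvd_of_dvd_mul_left hdvd
    exact ⟨A, B, hA, hB⟩
  choose! A B hA hB using key
  have hinj : Set.InjOn (fun z => (A z, B z)) Sg := by
    intro z hz z' hz' hzz
    simp only [Prod.mk.injEq] at hzz
    have a1 := hA z hz
    have a2 := hA z' hz'
    have b1 := hB z hz
    have b2 := hB z' hz'
    rw [hzz.1] at a1
    rw [hzz.2] at b1
    refine Prod.ext (mul_left_cancel₀ (mul_ne_zero two_ne_zero hn) ?_)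
      (mul_left_cancel₀ (mul_ne_zero two_ne_zero hn) ?_)
    · linear_combination w.1 * (a1 - a2) + D * w.2 * (b1 - b2) - 2 * (z.1 - z'.1) * hw1
    · linear_combination w.2 * (a1 - a2) + w.1 * (b1 - b2) - 2 * (z.2 - z'.2) * hw1
  rw [← Finset.card_image_of_injOn hinj]
  refine card_pell_four_le hD.ne_zero _ fun q hq => ?_
  obtain ⟨z, hz, rfl⟩ := Finset.mem_image.1 hq
  obtain ⟨hzS, -⟩ := Finset.mem_filter.1 hz
  obtain ⟨hz1, -, hzP, hzP'⟩ := hS z hzS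
  have a1 := hA z hz
  have b1 := hB z hz
  constructor
  · have : (n * A z) ^ 2 - D * (n * B z) ^ 2 = n ^ 2 * 4 := by
      rw [← a1, ← b1]
      linear_combination 4 * (w.1 ^ 2 - D * w.2 ^ 2) * hz1 + 4 * n * hw1
    refine mul_left_cancel₀ (pow_ne_zero 2 hn) ?_
    rw [← this]
    ring
  · have hA' : |A z| ≤ |n * A z| := by
      rw [abs_mul]
      exact le_mul_of_one_le_left (abs_nonneg _) (Int.one_le_abs hn)
    refine hA'.trans ?_
    rw [← a1]
    push_cast
    calc |2 * (z.1 * w.1 - D * z.2 * w.2)| = 2 * |z.1 * w.1 - D * z.2 * w.2| := by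
          rw [abs_mul]; norm_num
      _ ≤ 2 * (|z.1 * w.1| + |D * z.2 * w.2|) := by gcongr; exact abs_sub _ _
      _ = 2 * (|z.1| * |w.1| + |D| * |z.2| * |w.2|) := by simp only [abs_mul]
      _ ≤ 2 * (P * P + |D| * P * P) := by gcongr
      _ = _ := by ring

/-- The left side is the number of divisors of the largest power of 2 not exceeding m, so the
divisor bound also controls logarithms. -/
theorem log_two_succ_le {δ C : ℝ}
    (hC : ∀ n : ℕ, n ≠ 0 → (n.divisors.card : ℝ) ≤ C * (n : ℝ) ^ δ) (hC0 : 0 < C) (hδ : 0 < δ)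
    {m : ℕ} (hm : m ≠ 0) : ((Nat.log 2 m + 1 : ℕ) : ℝ) ≤ C * (m : ℝ) ^ δ := by
  have h := hC (2 ^ Nat.log 2 m) (by positivity)
  rw [Nat.divisors_prime_pow Nat.prime_two, Finset.card_map, Finset.card_range] at h
  refine h.trans ?_
  gcongr
  exact Nat.pow_log_le_self 2 hm

/-- The equation `X² - D Y² = n` has few solutions of bounded size. -/
theorem exists_card_pell_le (ε : ℝ) (hε : 0 < ε) : ∃ C : ℝ, 0 < C ∧ ∀ (P : ℕ) (D n : ℤ),
    D ≠ 0 → n ≠ 0 → |D| ≤ P → |n| ≤ P → ∀ S : Finset (ℤ × ℤ),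
    (∀ z ∈ S, z.1 ^ 2 - D * z.2 ^ 2 = n ∧ |z.1| ≤ P ∧ |z.2| ≤ P) →
    (S.card : ℝ) ≤ C * (P : ℝ) ^ ε := by
  classical
  -- Twelfths are spent as 1 + 10 + 1: two divisor counts for n, and a logarithm of a number at most
  -- 16P^10.
  obtain ⟨C, hC0, hC⟩ := exists_card_divisors_le (ε / 12) (by positivity)
  refine ⟨C * C * (25 * (C * (16 : ℝ) ^ (ε / 12))), by positivity, fun P D n hD hn hDP hnP S hS => ?_⟩
  have hP1 : 1 ≤ P := by
    have := Int.one_le_abs hn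
    exact_mod_cast this.trans hnP
  -- The square part f² of D is absorbed into the second unknown, which becomes f·z.2 ≤ P². Dividing
  -- the pair by its gcd h, for which h² ∣ n, leaves a coprime solution with squarefree D₀.
  obtain ⟨D₁, f, hfD, hsq⟩ := Nat.sq_mul_squarefree D.natAbs
  set D₀ : ℤ := D.sign * D₁ with hD₀
  have hDf : D = f ^ 2 * D₀ := by
    have h1 : D = D.sign * D.natAbs := (Int.sign_mul_natAbs D).symm
    have h2 : (D.natAbs : ℤ) = f ^ 2 * D₁ := by exact_mod_cast hfD.symm
    rw [h2] at h1
    rw [hD₀]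
    linarith
  have hD₁ : D₀.natAbs = D₁ := by
    rw [hD₀, Int.natAbs_mul, Int.natAbs_sign_of_ne_zero hD]
    simp
  have hD₀sq : Squarefree D₀ := by rwa [← Int.squarefree_natAbs, hD₁]
  have hDP' : f ^ 2 * D₁ ≤ P := by
    rw [hfD]
    rw [Int.abs_eq_natAbs] at hDP
    exact_mod_cast hDP
  have hD₁0 : 0 < D₁ := Nat.pos_of_ne_zero hsq.ne_zero
  have hf0 : 0 < f := by
    rcases Nat.eq_zero_or_pos f with rfl | h
    · exact absurd (by simpa using hfD.symm : D = 0) hD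
    · exact h
  have hfP : f ≤ P := by nlinarith
  have hD₁P : D₁ ≤ P := by nlinarith [Nat.one_le_pow 2 f hf0]
  have hn0 : n.natAbs ≠ 0 := Int.natAbs_ne_zero.2 hn
  set L : ℕ := 25 * (Nat.log 2 ((2 * (1 + D₁) * (P ^ 2) ^ 2) ^ 2) + 1) with hL
  have hmaps : ∀ z ∈ S, Int.gcd z.1 (f * z.2) ∈ n.natAbs.divisors := fun z hz => by
    rw [Nat.mem_divisors]
    refine ⟨?_, hn0⟩
    rw [← Int.natCast_dvd, ← (hS z hz).1, hDf]
    have h1 : ((Int.gcd z.1 (f * z.2) : ℕ) : ℤ) ∣ z.1 := Int.gcd_dvd_left ..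
    have h2 : ((Int.gcd z.1 (f * z.2) : ℕ) : ℤ) ∣ f * z.2 := Int.gcd_dvd_right ..
    have e : z.1 ^ 2 - f ^ 2 * D₀ * z.2 ^ 2 = z.1 * z.1 - (f * z.2) * (D₀ * f * z.2) := by ring
    rw [e]
    exact dvd_sub (h1.mul_right _) (h2.mul_right _)
  have hfib : ∀ h ∈ n.natAbs.divisors,
      (S.filter (fun z => Int.gcd z.1 (f * z.2) = h)).card ≤ n.natAbs.divisors.card * L := by
    intro h hh
    set Sh := S.filter (fun z => Int.gcd z.1 (f * z.2) = h) with hSh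
    have hh0 : (h : ℤ) ≠ 0 := by exact_mod_cast (Nat.pos_of_mem_divisors hh).ne'
    rcases Sh.eq_empty_or_nonempty with he | ⟨w, hw⟩
    · rw [he]; simp
    have key : ∀ z ∈ Sh, ∃ X Y : ℤ, z.1 = h * X ∧ f * z.2 = h * Y ∧ IsCoprime X Y := by
      intro z hz
      obtain ⟨hzS, hzg⟩ := Finset.mem_filter.1 hz
      obtain ⟨X, hX⟩ : (h : ℤ) ∣ z.1 := hzg ▸ Int.gcd_dvd_left ..
      obtain ⟨Y, hY⟩ : (h : ℤ) ∣ f * z.2 := hzg ▸ Int.gcd_dvd_right ..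
      refine ⟨X, Y, hX, hY, ?_⟩
      have hb := Int.gcd_eq_gcd_ab z.1 (f * z.2)
      rw [hzg] at hb
      refine ⟨Int.gcdA z.1 (f * z.2), Int.gcdB z.1 (f * z.2), mul_left_cancel₀ hh0 ?_⟩
      linear_combination -hb - Int.gcdA z.1 (f * z.2) * hX - Int.gcdB z.1 (f * z.2) * hY
    choose! X Y hX hY hXY using key
    have heq : ∀ z ∈ Sh, (h : ℤ) ^ 2 * (X z ^ 2 - D₀ * Y z ^ 2) = n := by
      intro z hz
      rw [← (hS z (Finset.mem_filter.1 hz).1).1, hDf]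
      linear_combination -(z.1 + h * X z) * hX z hz + D₀ * (f * z.2 + h * Y z) * hY z hz
    have hn' : X w ^ 2 - D₀ * Y w ^ 2 ≠ 0 := fun h0 => hn (by rw [← heq w hw, h0, mul_zero])
    have hinj : Set.InjOn (fun z => (X z, Y z)) Sh := by
      intro z hz z' hz' hzz
      simp only [Prod.mk.injEq] at hzz
      refine Prod.ext ?_ ?_
      · rw [hX z hz, hX z' hz', hzz.1]
      · refine mul_left_cancel₀ (a := (f : ℤ)) (by exact_mod_cast hf0.ne') ?_
        rw [hY z hz, hY z' hz', hzz.2]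
    have hle1 : ∀ x : ℤ, |x| ≤ |h * x| := fun x => by
      rw [abs_mul]
      exact le_mul_of_one_le_left (abs_nonneg _) (Int.one_le_abs hh0)
    have := card_pell_coprime_le (P := P ^ 2) hD₀sq hn' (Sh.image fun z => (X z, Y z)) (by
      intro q hq
      obtain ⟨z, hz, rfl⟩ := Finset.mem_image.1 hq
      obtain ⟨-, hz1, hz2⟩ := hS z (Finset.mem_filter.1 hz).1
      refine ⟨mul_left_cancel₀ (pow_ne_zero 2 hh0) ((heq z hz).trans (heq w hw).symm),
        hXY z hz, (hle1 _).trans ?_, (hle1 _).trans ?_⟩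
      · rw [← hX z hz]
        refine hz1.trans ?_
        exact_mod_cast Nat.le_self_pow two_ne_zero P
      · rw [← hY z hz, abs_mul, Nat.abs_cast]
        push_cast
        rw [pow_two]
        exact mul_le_mul (by exact_mod_cast hfP) hz2 (abs_nonneg _) (by positivity))
    rw [Finset.card_image_of_injOn hinj, hD₁] at this
    refine this.trans (Nat.mul_le_mul_right _ (Finset.card_le_card (Nat.divisors_subset_of_dvd hn0 ?_)))
    rw [Int.natAbs_dvd_natAbs]
    exact ⟨(h : ℤ) ^ 2, by rw [← heq w hw]; ring⟩
  have hcard : S.card ≤ n.natAbs.divisors.card * L * n.natAbs.divisors.card :=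
    Finset.card_le_mul_card_image_of_maps_to hmaps _ hfib
  have hPpos : (0 : ℝ) < P := by exact_mod_cast hP1
  have hτ : (n.natAbs.divisors.card : ℝ) ≤ C * (P : ℝ) ^ (ε / 12) := by
    refine (hC _ hn0).trans ?_
    gcongr
    rw [Int.abs_eq_natAbs] at hnP
    exact_mod_cast hnP
  have hLb : (L : ℝ) ≤ 25 * (C * (16 : ℝ) ^ (ε / 12)) * (P : ℝ) ^ (10 * (ε / 12)) := by
    rw [hL, Nat.cast_mul, Nat.cast_ofNat, mul_assoc (25 : ℝ), mul_assoc C]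
    refine mul_le_mul_of_nonneg_left ?_ (by norm_num)
    refine (log_two_succ_le hC hC0 (by positivity) (by positivity)).trans ?_
    refine mul_le_mul_of_nonneg_left ?_ hC0.le
    calc (((2 * (1 + D₁) * (P ^ 2) ^ 2) ^ 2 : ℕ) : ℝ) ^ (ε / 12)
        ≤ ((16 * P ^ 10 : ℕ) : ℝ) ^ (ε / 12) := by
          refine Real.rpow_le_rpow (by positivity) (Nat.cast_le.2 ?_) (by positivity)
          calc (2 * (1 + D₁) * (P ^ 2) ^ 2) ^ 2 ≤ (2 * (P + P) * (P ^ 2) ^ 2) ^ 2 := by gcongr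
            _ = 16 * P ^ 10 := by ring
      _ = _ := by
          push_cast
          rw [Real.mul_rpow (by norm_num) (by positivity), ← Real.rpow_natCast,
            ← Real.rpow_mul hPpos.le, Nat.cast_ofNat]
  calc (S.card : ℝ) ≤ n.natAbs.divisors.card * L * n.natAbs.divisors.card := by exact_mod_cast hcard
    _ ≤ (C * (P : ℝ) ^ (ε / 12)) * (25 * (C * (16 : ℝ) ^ (ε / 12)) * (P : ℝ) ^ (10 * (ε / 12))) *
        (C * (P : ℝ) ^ (ε / 12)) :=
        mul_le_mul (mul_le_mul hτ hLb (Nat.cast_nonneg _)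
          (mul_nonneg hC0.le (Real.rpow_nonneg hPpos.le _))) hτ (Nat.cast_nonneg _)
          (mul_nonneg (mul_nonneg hC0.le (Real.rpow_nonneg hPpos.le _))
            (mul_nonneg (by positivity) (Real.rpow_nonneg hPpos.le _)))
    _ = C * C * (25 * (C * (16 : ℝ) ^ (ε / 12))) *
        ((P : ℝ) ^ (ε / 12) * (P : ℝ) ^ (10 * (ε / 12)) * (P : ℝ) ^ (ε / 12)) := by
        generalize (P : ℝ) ^ (ε / 12) = a, (P : ℝ) ^ (10 * (ε / 12)) = b, (16 : ℝ) ^ (ε / 12) = c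
        ring
    _ = _ := by
        rw [← Real.rpow_add hPpos, ← Real.rpow_add hPpos]
        congr 2
        ring

/-! ### Integral points on conics. -/

theorem mul_pow_rpow_div {K U ε : ℝ} (hK : 0 ≤ K) (hU : 0 ≤ U) {k : ℕ} (hk : k ≠ 0) :
    (K * U ^ k) ^ (ε / k) = K ^ (ε / k) * U ^ ε := by
  rw [Real.mul_rpow hK (by positivity), ← Real.rpow_natCast, ← Real.rpow_mul hU,
    mul_div_cancel₀ _ (by exact_mod_cast hk)]

theorem abs_mul_le_mul {x y A B : ℤ} (hx : |x| ≤ A) (hy : |y| ≤ B) : |x * y| ≤ A * B := by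
  rw [abs_mul]
  exact mul_le_mul hx hy (abs_nonneg _) ((abs_nonneg _).trans hx)

theorem abs_add_le_add {x y A B : ℤ} (hx : |x| ≤ A) (hy : |y| ≤ B) : |x + y| ≤ A + B :=
  (abs_add_le _ _).trans (add_le_add hx hy)

theorem abs_sub_le_add {x y A B : ℤ} (hx : |x| ≤ A) (hy : |y| ≤ B) : |x - y| ≤ A + B :=
  (abs_sub _ _).trans (add_le_add hx hy)

/-- Integral points on a conic with bounded integer coefficients. -/
theorem exists_card_conic_int_le (ε : ℝ) (hε : 0 < ε) :
    ∃ C : ℝ, 0 < C ∧ ∀ (P : ℕ) (a b c d e f : ℤ), 1 ≤ P →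
    |a| ≤ P → |b| ≤ P → |c| ≤ P → |d| ≤ P → |e| ≤ P → |f| ≤ P →
    b ^ 2 - 4 * a * c ≠ 0 →
    4 * a * c * f + b * d * e - a * e ^ 2 - c * d ^ 2 - f * b ^ 2 ≠ 0 →
    ∀ S : Finset (ℤ × ℤ), (∀ z ∈ S, a * z.1 ^ 2 + b * z.1 * z.2 + c * z.2 ^ 2 + d * z.1 + e * z.2 + f
      = 0 ∧ |z.1| ≤ P ∧ |z.2| ≤ P) → (S.card : ℝ) ≤ C * (P : ℝ) ^ ε := by
  classical
  obtain ⟨C, hC0, hC⟩ := exists_card_pell_le (ε / (4 : ℕ)) (by positivity)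
  -- 224 = 4·7·8 comes from the right-hand side -4a'Δ, with |a'| ≤ 7P and |Δ| ≤ 8P³; it dominates
  -- the other data too.
  refine ⟨C * (224 : ℝ) ^ (ε / (4 : ℕ)), by positivity, ?_⟩
  intro P a b c d e f hP ha hb hc hd he hf hD hΔ S hS
  -- A shear makes the first leading coefficient nonzero: a quadratic in τ vanishing at 0, 1, 2 is
  -- zero, which would force a = b = 0 and zero discriminant.
  obtain ⟨τ, hτ0, hτ2, hτ⟩ : ∃ τ : ℤ, 0 ≤ τ ∧ τ ≤ 2 ∧ a + b * τ + c * τ ^ 2 ≠ 0 := by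
    by_contra! h
    have h0 := h 0 (by norm_num) (by norm_num)
    have h1 := h 1 (by norm_num) (by norm_num)
    have h2 := h 2 (by norm_num) (by norm_num)
    have ha0 : a = 0 := by linarith
    have hb0 : b = 0 := by linarith
    exact hD (by rw [ha0, hb0]; ring)
  set a' := a + b * τ + c * τ ^ 2 with ha'
  set b' := b + 2 * c * τ with hb'
  set d' := d + e * τ with hd'
  set D := b ^ 2 - 4 * a * c with hDdef
  set Δ := 4 * a * c * f + b * d * e - a * e ^ 2 - c * d ^ 2 - f * b ^ 2 with hΔdef
  -- Completing the square twice in the sheared coordinates gives W² - DZ² = -4a'Δ.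
  let W : ℤ × ℤ → ℤ := fun z => D * (z.2 - τ * z.1) + (b' * d' - 2 * a' * e)
  let Z : ℤ × ℤ → ℤ := fun z => 2 * a' * z.1 + b' * (z.2 - τ * z.1) + d'
  have hP1 : (1 : ℤ) ≤ P := by exact_mod_cast hP
  have hPP : (P : ℤ) ≤ P ^ 2 := by nlinarith
  have hPP3 : (P : ℤ) ^ 2 ≤ P ^ 3 := by nlinarith [sq_nonneg (P : ℤ)]
  have hPP4 : (P : ℤ) ^ 3 ≤ P ^ 4 := by nlinarith [pow_nonneg (by omega : (0 : ℤ) ≤ P) 3]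
  have hτa : |τ| ≤ 2 := by rw [abs_of_nonneg hτ0]; exact hτ2
  have h4 : |(4 : ℤ)| ≤ 4 := by norm_num
  have h2 : |(2 : ℤ)| ≤ 2 := by norm_num
  have hτsq : |τ ^ 2| ≤ 2 * 2 := by rw [pow_two]; exact abs_mul_le_mul hτa hτa
  have hsq : ∀ {x A : ℤ}, |x| ≤ A → |x ^ 2| ≤ A * A := fun h => by
    rw [pow_two]; exact abs_mul_le_mul h h
  have ba' : |a'| ≤ 7 * P := by
    have := abs_add_le_add (abs_add_le_add ha (abs_mul_le_mul hb hτa)) (abs_mul_le_mul hc hτsq)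
    linarith
  have bb' : |b'| ≤ 5 * P := by
    have := abs_add_le_add hb (abs_mul_le_mul (abs_mul_le_mul h2 hc) hτa)
    linarith
  have bd' : |d'| ≤ 3 * P := by
    have := abs_add_le_add hd (abs_mul_le_mul he hτa)
    linarith
  have bD : |D| ≤ 5 * P ^ 2 := by
    have := abs_sub_le_add (hsq hb) (abs_mul_le_mul (abs_mul_le_mul h4 ha) hc)
    linarith
  have bΔ : |Δ| ≤ 8 * P ^ 3 := by
    have := abs_sub_le_add (abs_sub_le_add (abs_sub_le_add (abs_add_le_add
      (abs_mul_le_mul (abs_mul_le_mul (abs_mul_le_mul h4 ha) hc) hf)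
      (abs_mul_le_mul (abs_mul_le_mul hb hd) he)) (abs_mul_le_mul ha (hsq he)))
      (abs_mul_le_mul hc (hsq hd))) (abs_mul_le_mul hf (hsq hb))
    linarith
  have hinj : Set.InjOn (fun z => (W z, Z z)) S := by
    intro z hz z' hz' hzz
    simp only [Prod.mk.injEq, W, Z] at hzz
    have e1 : z.2 - τ * z.1 = z'.2 - τ * z'.1 := mul_left_cancel₀ hD (by linarith [hzz.1])
    have e2 : z.1 = z'.1 := by
      refine mul_left_cancel₀ (mul_ne_zero two_ne_zero hτ) ?_
      have := hzz.2
      rw [e1] at this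
      linarith
    exact Prod.ext e2 (by rw [e2] at e1; linarith)
  have hn : -4 * a' * Δ ≠ 0 := mul_ne_zero (mul_ne_zero (by norm_num) hτ) hΔ
  have := hC (224 * P ^ 4) D (-4 * a' * Δ) hD hn (by push_cast; linarith [pow_nonneg (by omega : (0 : ℤ) ≤ P) 4])
    (by
      have := abs_mul_le_mul (abs_mul_le_mul (show |(-4 : ℤ)| ≤ 4 by norm_num) ba') bΔ
      push_cast
      linarith) (S.image fun z => (W z, Z z)) (by
      intro q hq
      obtain ⟨z, hz, rfl⟩ := Finset.mem_image.1 hq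
      obtain ⟨hz0, hz1, hz2⟩ := hS z hz
      have by' : |z.2 - τ * z.1| ≤ 3 * P := by
        have := abs_sub_le_add hz2 (abs_mul_le_mul hτa hz1)
        linarith
      refine ⟨?_, ?_, ?_⟩
      · simp only [W, Z]
        rw [ha', hb', hd', hDdef, hΔdef]
        linear_combination -4 * (a + b * τ + c * τ ^ 2) * (b ^ 2 - 4 * a * c) * hz0
      · have := abs_add_le_add (abs_mul_le_mul bD by') (abs_sub_le_add (abs_mul_le_mul bb' bd')
          (abs_mul_le_mul (abs_mul_le_mul h2 ba') he))
        push_cast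
        simp only [W]
        linarith
      · have := abs_add_le_add (abs_add_le_add (abs_mul_le_mul (abs_mul_le_mul h2 ba') hz1)
          (abs_mul_le_mul bb' by')) bd'
        push_cast
        simp only [Z]
        linarith)
  rw [Finset.card_image_of_injOn hinj] at this
  refine this.trans (le_of_eq ?_)
  push_cast
  have h := mul_pow_rpow_div (K := 224) (U := P) (ε := ε) (by norm_num) (by positivity) (k := 4)
    (by norm_num)
  push_cast at h
  rw [h, mul_assoc]

/-- Uniform bound for integral points in a box on a non-degenerate rational conic. -/
theorem exists_card_conic_le (ε : ℝ) (hε : 0 < ε) :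
    ∃ C : ℝ, 0 < C ∧ ∀ (U : ℕ) (a b c d e f : ℚ), 1 ≤ U →
    b ^ 2 - 4 * a * c ≠ 0 →
    4 * a * c * f + b * d * e - a * e ^ 2 - c * d ^ 2 - f * b ^ 2 ≠ 0 →
    ∀ S : Finset (ℤ × ℤ), (∀ z ∈ S, a * (z.1 : ℚ) ^ 2 + b * z.1 * z.2 + c * (z.2 : ℚ) ^ 2 + d * z.1
      + e * z.2 + f = 0 ∧ |z.1| ≤ U ∧ |z.2| ≤ U) → (S.card : ℝ) ≤ C * (U : ℝ) ^ ε := by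
  classical
  obtain ⟨C, hC0, hC⟩ := exists_card_conic_int_le (ε / (128 : ℕ)) (by positivity)
  -- With 6 coefficients, a degree 5 condition and evaluation vectors of size U², the kernel bound
  -- is 30·(12U²)^64 = K·U^128.
  obtain ⟨K, hK⟩ : ∃ K : ℕ, K = 30 * 12 ^ 64 := ⟨_, rfl⟩
  have hK1 : 1 ≤ K := by rw [hK]; exact Nat.one_le_iff_ne_zero.2 (by positivity)
  refine ⟨C * (K : ℝ) ^ (ε / (128 : ℕ)), by positivity, ?_⟩
  intro U a b c d e f hU hD hΔ S hS
  have hU1 : (1 : ℤ) ≤ U := by exact_mod_cast hU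
  -- Passing through a point is a linear condition on the six coefficients. A small integral
  -- solution of these conditions at which `F`, discriminant times determinant, is nonzero can
  -- replace the given conic.
  let ev : S → Fin 6 → ℤ := fun s =>
    ![s.1.1 ^ 2, s.1.1 * s.1.2, s.1.2 ^ 2, s.1.1, s.1.2, 1]
  have hev : ∀ s i, |ev s i| ≤ (U : ℤ) ^ 2 := by
    intro s i
    obtain ⟨-, h1, h2⟩ := hS s.1 s.2
    have hUU : (U : ℤ) ≤ U ^ 2 := by nlinarith
    have e11 := abs_mul_le_mul h1 h1
    have e12 := abs_mul_le_mul h1 h2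
    have e22 := abs_mul_le_mul h2 h2
    rw [← pow_two, ← pow_two] at e11 e22
    rw [← pow_two] at e12
    fin_cases i
    · exact e11
    · exact e12
    · exact e22
    · exact h1.trans hUU
    · exact h2.trans hUU
    · simpa [ev] using hU1.trans hUU
  let F : (Fin 6 → ℚ) → ℚ := fun q => (q 1 * q 1 - 4 * (q 0 * q 2)) *
    (4 * (q 0 * q 2 * q 5) + q 1 * q 3 * q 4 - q 0 * q 4 * q 4 - q 2 * q 3 * q 3 - q 5 * q 1 * q 1)
  have hX : ∀ i, LinePoly 1 (fun q : Fin 6 → ℚ => q i) := fun i =>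
    LinePoly.linear (LinearMap.proj i : (Fin 6 → ℚ) →ₗ[ℚ] ℚ)
  have h3 : ∀ i j k, LinePoly 3 (fun q : Fin 6 → ℚ => q i * q j * q k) := fun i j k =>
    ((hX i).mul (hX j)).mul (hX k)
  have hF : LinePoly 5 F :=
    (((hX 1).mul (hX 1)).sub (((hX 0).mul (hX 2)).const_mul 4)).mul
      (((((h3 0 2 5).const_mul 4).add (h3 1 3 4)).sub (h3 0 4 4)).sub (h3 2 3 3) |>.sub (h3 5 1 1))
  obtain ⟨z, hz, hz0, hFz⟩ := exists_small_kernel_ne_zero ev (B := (U : ℤ) ^ 2) (by nlinarith) hev hF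
    (q := ![a, b, c, d, e, f]) (fun s => by
      have := (hS s.1 s.2).1
      simp [ev, dotProduct, Fin.sum_univ_succ]
      linarith) (by
      refine mul_ne_zero (fun h => hD ?_) (fun h => hΔ ?_)
      · simp at h
        linarith
      · simp at h
        linarith)
  have hzP : ∀ i, |z i| ≤ ((K * U ^ 128 : ℕ) : ℤ) := by
    intro i
    refine (hz i).trans (le_of_eq ?_)
    rw [hK]
    push_cast
    ring
  have hUP : (U : ℤ) ≤ ((K * U ^ 128 : ℕ) : ℤ) := by
    have : U ≤ K * U ^ 128 := by
      calc U = 1 * U ^ 1 := by ring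
        _ ≤ K * U ^ 128 := Nat.mul_le_mul hK1 (Nat.pow_le_pow_right hU (by norm_num))
    exact_mod_cast this
  have hF1 := left_ne_zero_of_mul hFz
  have hF2 := right_ne_zero_of_mul hFz
  have := hC (K * U ^ 128) (z 0) (z 1) (z 2) (z 3) (z 4) (z 5) (Nat.one_le_iff_ne_zero.2 (by positivity))
    (hzP 0) (hzP 1) (hzP 2) (hzP 3) (hzP 4) (hzP 5)
    (fun h => hF1 (by
      have : ((z 1 ^ 2 - 4 * z 0 * z 2 : ℤ) : ℚ) = 0 := by rw [h, Int.cast_zero]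
      push_cast at this
      linarith))
    (fun h => hF2 (by
      have : ((4 * z 0 * z 2 * z 5 + z 1 * z 3 * z 4 - z 0 * z 4 ^ 2 - z 2 * z 3 ^ 2
        - z 5 * z 1 ^ 2 : ℤ) : ℚ) = 0 := by rw [h, Int.cast_zero]
      push_cast at this
      linarith)) S (fun w hw => by
      obtain ⟨-, h1, h2⟩ := hS w hw
      refine ⟨?_, h1.trans hUP, h2.trans hUP⟩
      have := hz0 ⟨w, hw⟩
      simp [ev, dotProduct, Fin.sum_univ_succ] at this
      linarith)
  refine this.trans (le_of_eq ?_)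
  have h := mul_pow_rpow_div (K := K) (U := U) (ε := ε) (by positivity) (by positivity) (k := 128)
    (by norm_num)
  rw [mul_assoc, ← h]
  push_cast
  rfl

/-! ### Plane sections of quadrics. -/

section PlaneSections

variable {E : Type*} [AddCommGroup E] [Module ℚ E]

/-- The quadratic polynomial with quadratic part `β / 2`, linear part `l` and constant term `f`. -/
def quadVal (β : LinearMap.BilinForm ℚ E) (l : E →ₗ[ℚ] ℚ) (f : ℚ) (y : E) : ℚ :=
  β y y / 2 + l y + f

/-- Discriminant of the quadratic part of the restriction to the directions `v`, `w`. -/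
def planeDisc (β : LinearMap.BilinForm ℚ E) (v w : E) : ℚ := β v w ^ 2 - β v v * β w w

/-- Determinant of the conic cut out on the plane through `y` with directions `v`, `w`. -/
def planeDet (β : LinearMap.BilinForm ℚ E) (l : E →ₗ[ℚ] ℚ) (f : ℚ) (v w y : E) : ℚ :=
  β v v * β w w * quadVal β l f y + β v w * (β y v + l v) * (β y w + l w)
    - β v v / 2 * (β y w + l w) ^ 2 - β w w / 2 * (β y v + l v) ^ 2
    - quadVal β l f y * β v w ^ 2

/-- Its six coefficients are the ones for which `planeDisc` and `planeDet` are the two quantities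
whose nonvanishing the conic bounds require. -/
theorem quadVal_plane {β : LinearMap.BilinForm ℚ E} (hβ : ∀ x y, β x y = β y x)
    (l : E →ₗ[ℚ] ℚ) (f : ℚ) (v w y : E) (s t : ℚ) :
    quadVal β l f (y + s • v + t • w) = β v v / 2 * s ^ 2 + β v w * s * t + β w w / 2 * t ^ 2
      + (β y v + l v) * s + (β y w + l w) * t + quadVal β l f y := by
  simp only [quadVal, map_add, map_smul, LinearMap.add_apply, LinearMap.smul_apply, smul_eq_mul]
  rw [hβ v y, hβ w y, hβ w v]
  ring

/-- A change of basis acts on the binary quadratic part by congruence, so the nonvanishing depends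
only on the span of the directions. -/
theorem planeDisc_change {β : LinearMap.BilinForm ℚ E} (hβ : ∀ x y, β x y = β y x)
    (v w : E) (a b c d : ℚ) : planeDisc β (a • v + b • w) (c • v + d • w) =
      (a * d - b * c) ^ 2 * planeDisc β v w := by
  simp only [planeDisc, map_add, map_smul, LinearMap.add_apply, LinearMap.smul_apply, smul_eq_mul]
  rw [hβ w v]
  ring

/-- Moving the base point inside the plane is a unimodular change of the conic's 3×3 matrix, and a
change of basis is a congruence. Nondegeneracy is therefore a property of the affine plane. -/
theorem planeDet_change {β : LinearMap.BilinForm ℚ E} (hβ : ∀ x y, β x y = β y x)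
    (l : E →ₗ[ℚ] ℚ) (f : ℚ) (v w y : E) (a b c d s t : ℚ) :
    planeDet β l f (a • v + b • w) (c • v + d • w) (y + s • v + t • w) =
      (a * d - b * c) ^ 2 * planeDet β l f v w y := by
  simp only [planeDet, quadVal, map_add, map_smul, LinearMap.add_apply, LinearMap.smul_apply,
    smul_eq_mul]
  rw [hβ w v, hβ v y, hβ w y]
  ring

theorem linePoly_quadVal (β : LinearMap.BilinForm ℚ E) (l : E →ₗ[ℚ] ℚ) (f : ℚ) :
    LinePoly 2 (quadVal β l f) := by
  have h := (((LinePoly.bilin β LinearMap.id LinearMap.id).const_mul (1 / 2)).add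
    ((LinePoly.linear l).mono one_le_two)).add ((LinePoly.const f).mono (by norm_num : 0 ≤ 2))
  convert h using 2 with y
  simp [quadVal]
  ring

theorem linePoly_planeDisc (β : LinearMap.BilinForm ℚ E) :
    LinePoly 4 (fun z : E × E × E => planeDisc β z.1 z.2.1) := by
  let p₁ : E × E × E →ₗ[ℚ] E := LinearMap.fst ℚ E (E × E)
  let p₂ : E × E × E →ₗ[ℚ] E := LinearMap.fst ℚ E E ∘ₗ LinearMap.snd ℚ E (E × E)
  have h := ((LinePoly.bilin β p₁ p₂).mul (LinePoly.bilin β p₁ p₂)).sub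
    ((LinePoly.bilin β p₁ p₁).mul (LinePoly.bilin β p₂ p₂))
  convert h using 2 with z
  simp [planeDisc, p₁, p₂]
  ring

theorem linePoly_planeDet (β : LinearMap.BilinForm ℚ E) (l : E →ₗ[ℚ] ℚ) (f : ℚ) :
    LinePoly 6 (fun z : E × E × E => planeDet β l f z.1 z.2.1 z.2.2) := by
  let p₁ : E × E × E →ₗ[ℚ] E := LinearMap.fst ℚ E (E × E)
  let p₂ : E × E × E →ₗ[ℚ] E := LinearMap.fst ℚ E E ∘ₗ LinearMap.snd ℚ E (E × E)
  let p₃ : E × E × E →ₗ[ℚ] E := LinearMap.snd ℚ E E ∘ₗ LinearMap.snd ℚ E (E × E)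
  have hq := (linePoly_quadVal β l f).comp_linear p₃
  have h11 := LinePoly.bilin β p₁ p₁
  have h12 := LinePoly.bilin β p₁ p₂
  have h22 := LinePoly.bilin β p₂ p₂
  have hd := (LinePoly.bilin β p₃ p₁).add ((LinePoly.linear (l ∘ₗ p₁)).mono one_le_two)
  have he := (LinePoly.bilin β p₃ p₂).add ((LinePoly.linear (l ∘ₗ p₂)).mono one_le_two)
  have h := (((((h11.mul h22).mul hq).add ((h12.mul hd).mul he)).sub
    (((h11.mul he).mul he).const_mul (1 / 2))).sub (((h22.mul hd).mul hd).const_mul (1 / 2))).sub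
    ((hq.mul h12).mul h12)
  convert h using 2 with z
  simp [planeDet, p₁, p₂, p₃]
  ring

end PlaneSections

/-! ### Counting on a quadric in a box by plane slices. -/

/-- Trivial bound for the integral points in a box of a conic with nondegenerate leading part. -/
theorem card_conic_le {V : ℕ} (hV : 1 ≤ V) {a b c d e f : ℚ} (hD : b ^ 2 - 4 * a * c ≠ 0)
    (S : Finset (ℤ × ℤ)) (hS : ∀ z ∈ S, a * (z.1 : ℚ) ^ 2 + b * z.1 * z.2 + c * (z.2 : ℚ) ^ 2
      + d * z.1 + e * z.2 + f = 0 ∧ |z.1| ≤ V ∧ |z.2| ≤ V) : S.card ≤ 36 * V := by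
  let q : (Fin 2 → ℚ) → ℚ := fun x =>
    a * (x 0 * x 0) + b * (x 0 * x 1) + c * (x 1 * x 1) + d * x 0 + e * x 1 + f
  have hX : ∀ i, LinePoly 1 (fun x : Fin 2 → ℚ => x i) := fun i =>
    LinePoly.linear (LinearMap.proj i : (Fin 2 → ℚ) →ₗ[ℚ] ℚ)
  have hq : LinePoly 2 q :=
    ((((((hX 0).mul (hX 0)).const_mul a).add (((hX 0).mul (hX 1)).const_mul b)).add
      (((hX 1).mul (hX 1)).const_mul c)).add (((hX 0).const_mul d).mono one_le_two)).add
      (((hX 1).const_mul e).mono one_le_two) |>.add ((LinePoly.const f).mono (by norm_num))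
  obtain ⟨x, hx⟩ : ∃ x, q x ≠ 0 := by
    by_contra! h
    have h1 := h ![0, 0]
    have h2 := h ![1, 0]
    have h3 := h ![-1, 0]
    have h4 := h ![0, 1]
    have h5 := h ![0, -1]
    have h6 := h ![1, 1]
    simp [q] at h1 h2 h3 h4 h5 h6
    have ha : a = 0 := by linarith
    have hb : b = 0 := by linarith
    exact hD (by rw [ha, hb]; ring)
  have hcard : (Finset.Icc (-(V : ℤ)) V).card = 2 * V + 1 := by
    rw [Int.card_Icc]
    omega
  have h := hq.card_zeros_box (V := V) hx (fun _ => Finset.Icc (-(V : ℤ)) V)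
    (fun _ => by rw [hcard]; omega)
  have hle : S.card ≤ ((Fintype.piFinset fun _ : Fin 2 => Finset.Icc (-(V : ℤ)) V).filter
      (fun u => q (fun i => (u i : ℚ)) = 0)).card := by
    refine Finset.card_le_card_of_injOn (fun z => ![z.1, z.2]) (fun z hz => ?_) ?_
    · obtain ⟨h0, h1, h2⟩ := hS z hz
      simp only [Finset.coe_filter, Set.mem_ofPred_eq, Fintype.mem_piFinset, Finset.mem_Icc]
      refine ⟨fun i => ?_, ?_⟩
      · fin_cases i
        · exact abs_le.1 h1
        · exact abs_le.1 h2
      · simp [q]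
        linarith
    · intro z _ z' _ hzz
      exact Prod.ext (congrFun hzz 0) (congrFun hzz 1)
  simp only [hcard, Finset.prod_const, Finset.card_univ, Fintype.card_fin] at h
  -- Degree 2 in 2 variables, with 2V + 1 ≤ 3V values per coordinate: 2·2·9 = 36.
  have h' : S.card * V ≤ 36 * V * V :=
    calc S.card * V ≤ 2 * 2 * (2 * V + 1) ^ 2 := (Nat.mul_le_mul_right _ hle).trans h
      _ ≤ 2 * 2 * (2 * V + V) ^ 2 := by gcongr
      _ = 36 * V * V := by ring
  exact Nat.le_of_mul_le_mul_right h' (by omega)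

/-- Existence of a pair of directions `(p, 1, 0)`, `(r, 0, 1)` with small integral `p`, `r` in
general position with respect to a quadratic polynomial. -/
theorem exists_small_directions {N : ℕ} {β : LinearMap.BilinForm ℚ ((Fin N → ℚ) × ℚ × ℚ)}
    (hβ : ∀ x y, β x y = β y x) (l : ((Fin N → ℚ) × ℚ × ℚ) →ₗ[ℚ] ℚ) (f : ℚ)
    {v w y : (Fin N → ℚ) × ℚ × ℚ} (hD : planeDisc β v w ≠ 0) (hΔ : planeDet β l f v w y ≠ 0) :
    ∃ (p r : Fin N → ℤ) (y' : Fin N → ℚ), (∀ i, |p i| ≤ 10) ∧ (∀ i, |r i| ≤ 10) ∧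
      planeDisc β (fun i => (p i : ℚ), 1, 0) (fun i => (r i : ℚ), 0, 1) ≠ 0 ∧
      planeDet β l f (fun i => (p i : ℚ), 1, 0) (fun i => (r i : ℚ), 0, 1) (y', 0, 0) ≠ 0 := by
  let E := (Fin N → ℚ) × ℚ × ℚ
  let G : E × E × E → ℚ := fun z => planeDisc β z.1 z.2.1 * planeDet β l f z.1 z.2.1 z.2.2
  have hG : LinePoly 10 G := (linePoly_planeDisc β).mul (linePoly_planeDet β l f)
  let p₁ : E × E × E →ₗ[ℚ] E := LinearMap.fst ℚ E (E × E)
  let p₂ : E × E × E →ₗ[ℚ] E := LinearMap.fst ℚ E E ∘ₗ LinearMap.snd ℚ E (E × E)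
  let c₁ : E →ₗ[ℚ] ℚ := LinearMap.fst ℚ ℚ ℚ ∘ₗ LinearMap.snd ℚ _ _
  let c₂ : E →ₗ[ℚ] ℚ := LinearMap.snd ℚ ℚ ℚ ∘ₗ LinearMap.snd ℚ _ _
  -- Extra open condition: the minor of v, w in the last two coordinates. When it is nonzero the
  -- plane projects isomorphically onto these coordinates, so it has a basis of the shape (p, 1, 0),
  -- (r, 0, 1).
  have hM := ((LinePoly.linear (c₁ ∘ₗ p₁)).mul (LinePoly.linear (c₂ ∘ₗ p₂))).sub
    ((LinePoly.linear (c₂ ∘ₗ p₁)).mul (LinePoly.linear (c₁ ∘ₗ p₂)))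
  obtain ⟨⟨v, w, y⟩, hz⟩ := hG.exists_mul_ne_zero hM (x := (v, w, y))
    (y := ((0, 1, 0), (0, 0, 1), 0)) (mul_ne_zero hD hΔ)
    (by show (1 : ℚ) * 1 - 0 * 0 ≠ 0; norm_num)
  obtain ⟨hz1, hz2⟩ := mul_ne_zero_iff.1 hz
  obtain ⟨hD, hΔ⟩ := mul_ne_zero_iff.1 hz1
  change v.2.1 * w.2.2 - v.2.2 * w.2.1 ≠ 0 at hz2
  change planeDisc β v w ≠ 0 at hD
  change planeDet β l f v w y ≠ 0 at hΔ
  clear hz hz1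
  obtain ⟨v', v1, v2⟩ := v
  obtain ⟨w', w1, w2⟩ := w
  obtain ⟨y', y1, y2⟩ := y
  simp only at hz2
  set M : ℚ := v1 * w2 - v2 * w1 with hMdef
  let A : (Fin 3 × Fin N → ℚ) →ₗ[ℚ] E × E × E :=
    LinearMap.prod (LinearMap.prod (LinearMap.funLeft ℚ ℚ (fun i => (0, i))) 0)
      (LinearMap.prod (LinearMap.prod (LinearMap.funLeft ℚ ℚ (fun i => (1, i))) 0)
        (LinearMap.prod (LinearMap.funLeft ℚ ℚ (fun i => (2, i))) 0))
  let b : E × E × E := ((0, 1, 0), (0, 0, 1), 0)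
  have hAb : ∀ x, b + A x = (((fun i => x (0, i)), 1, 0), ((fun i => x (1, i)), 0, 1),
      ((fun i => x (2, i)), 0, 0)) := by
    intro x
    refine Prod.ext (Prod.ext ?_ (Prod.ext ?_ ?_)) (Prod.ext (Prod.ext ?_ (Prod.ext ?_ ?_))
      (Prod.ext ?_ (Prod.ext ?_ ?_))) <;> first | exact zero_add _ | exact add_zero _
  have hcomp := hG.comp_affine A b
  -- Cramer's rule: the basis of span(v, w) with last coordinates (1, 0) and (0, 1), and the point
  -- of y + span(v, w) with last coordinates (0, 0).
  let V : Fin 3 → Fin N → ℚ := ![(w2 / M) • v' + (-(v2 / M)) • w',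
    (-(w1 / M)) • v' + (v1 / M) • w',
    y' + (-(w2 * y1 - w1 * y2) / M) • v' + (-(v1 * y2 - v2 * y1) / M) • w']
  have hx0 : G (b + A (fun ij => V ij.1 ij.2)) ≠ 0 := by
    rw [hAb]
    have e1 : (((fun i => V 0 i), 1, 0) : E) =
        (w2 / M) • (v', v1, v2) + (-(v2 / M)) • (w', w1, w2) := by
      refine Prod.ext rfl (Prod.ext ?_ ?_) <;> simp <;> field_simp <;> rw [hMdef] <;> ring
    have e2 : (((fun i => V 1 i), 0, 1) : E) =
        (-(w1 / M)) • (v', v1, v2) + (v1 / M) • (w', w1, w2) := by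
      refine Prod.ext rfl (Prod.ext ?_ ?_) <;> simp <;> field_simp <;> rw [hMdef] <;> ring
    have e3 : (((fun i => V 2 i), 0, 0) : E) = (y', y1, y2) +
        (-(w2 * y1 - w1 * y2) / M) • (v', v1, v2) + (-(v1 * y2 - v2 * y1) / M) • (w', w1, w2) := by
      refine Prod.ext rfl (Prod.ext ?_ ?_) <;> simp <;> field_simp <;> rw [hMdef] <;> ring
    simp only [G]
    rw [e1, e2, e3, planeDisc_change hβ, planeDet_change hβ]
    have hdet : w2 / M * (v1 / M) - -(v2 / M) * -(w1 / M) ≠ 0 := by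
      have : w2 / M * (v1 / M) - -(v2 / M) * -(w1 / M) = 1 / M := by
        field_simp
        rw [hMdef]
        ring
      rw [this]
      exact one_div_ne_zero hz2
    exact mul_ne_zero (mul_ne_zero (pow_ne_zero 2 hdet) hD) (mul_ne_zero (pow_ne_zero 2 hdet) hΔ)
  -- `G` has degree 4 + 6 = 10, so eleven values 0, ..., 10 per coordinate suffice.
  obtain ⟨z, hz, hGz⟩ := hcomp.exists_ne_zero_grid hx0
    ((Finset.range 11).map ⟨fun k : ℕ => (k : ℚ), Nat.cast_injective⟩) (by simp)
  simp only [Finset.mem_map, Finset.mem_range, Function.Embedding.coeFn_mk] at hz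
  choose k hk hkz using hz
  rw [hAb] at hGz
  refine ⟨fun i => k (0, i), fun i => k (1, i), fun i => z (2, i), fun i => ?_, fun i => ?_, ?_, ?_⟩
  · have := hk (0, i)
    rw [Nat.abs_cast]
    omega
  · have := hk (1, i)
    rw [Nat.abs_cast]
    omega
  · simp only [Int.cast_natCast, hkz]
    exact left_ne_zero_of_mul hGz
  · simp only [Int.cast_natCast, hkz]
    exact right_ne_zero_of_mul hGz

/-- Uniform bound for the integral points of a quadric in a box. -/
theorem exists_card_quadric_box_le (N : ℕ) (ε : ℝ) (hε : 0 < ε) :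
    ∃ C : ℝ, 0 < C ∧ ∀ (β : LinearMap.BilinForm ℚ ((Fin N → ℚ) × ℚ × ℚ)),
    (∀ x y, β x y = β y x) → ∀ (l : ((Fin N → ℚ) × ℚ × ℚ) →ₗ[ℚ] ℚ) (f : ℚ),
    (∃ v w y, planeDisc β v w ≠ 0 ∧ planeDet β l f v w y ≠ 0) →
    ∀ (U : Fin N → ℕ) (V T : ℕ), 1 ≤ V → (∀ i, V ≤ U i) → V ≤ T →
    ∀ S : Finset ((Fin N → ℤ) × ℤ × ℤ), (∀ z ∈ S, (∀ i, |z.1 i| ≤ U i) ∧ |z.2.1| ≤ V ∧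
      |z.2.2| ≤ V ∧ quadVal β l f ((fun i => (z.1 i : ℚ)), (z.2.1 : ℚ), (z.2.2 : ℚ)) = 0) →
    (S.card : ℝ) ≤ C * (∏ i, (U i : ℝ)) * (T : ℝ) ^ ε := by
  classical
  obtain ⟨C, hC0, hC⟩ := exists_card_conic_le ε hε
  refine ⟨43 ^ N * C + 36 * (10 * N * 43 ^ N), by positivity, ?_⟩
  rintro β hβ l f ⟨v, w, y, hD, hΔ⟩ U V T hV hVU hVT S hS
  obtain ⟨p, r, y', hp, hr, hD, hΔ⟩ := exists_small_directions hβ l f hD hΔ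
  set v : (Fin N → ℚ) × ℚ × ℚ := (fun i => (p i : ℚ), 1, 0)
  set w : (Fin N → ℚ) × ℚ × ℚ := (fun i => (r i : ℚ), 0, 1)
  -- z lies in the plane through (pr z, 0, 0) with directions v, w, and its plane coordinates are
  -- its last two entries. From U_i + 10V + 10V ≤ 21U_i there are at most 43U_i values of each entry
  -- of pr z.
  let pr : (Fin N → ℤ) × ℤ × ℤ → Fin N → ℤ := fun z i => z.1 i - z.2.1 * p i - z.2.2 * r i
  let Bi : Fin N → Finset ℤ := fun i => Finset.Icc (-(21 * U i : ℤ)) (21 * U i)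
  have hBi : ∀ i, (Bi i).card = 42 * U i + 1 := fun i => by
    rw [Int.card_Icc]
    omega
  have hBi' : ∀ i, (Bi i).card ≤ 43 * U i := fun i => by
    have := hVU i
    rw [hBi]
    omega
  have hprod : ∏ i, (Bi i).card ≤ 43 ^ N * ∏ i, U i := by
    refine (Finset.prod_le_prod' fun i _ => hBi' i).trans (le_of_eq ?_)
    rw [Finset.prod_mul_distrib]
    simp
  let Bx := Fintype.piFinset Bi
  have hmaps : ∀ z ∈ S, pr z ∈ Bx := by
    intro z hz
    obtain ⟨h1, h2, h3, -⟩ := hS z hz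
    simp only [Bx, Bi, Fintype.mem_piFinset, Finset.mem_Icc, ← abs_le]
    intro i
    have := abs_sub_le_add (abs_sub_le_add (h1 i) (abs_mul_le_mul h2 (hp i)))
      (abs_mul_le_mul h3 (hr i))
    have hVi : (V : ℤ) ≤ U i := by exact_mod_cast hVU i
    simp only [pr]
    linarith
  let fib : (Fin N → ℤ) → Finset (ℤ × ℤ) := fun u => (S.filter (fun z => pr z = u)).image Prod.snd
  have hfibcard : ∀ u, (S.filter (fun z => pr z = u)).card = (fib u).card := by
    intro u
    refine (Finset.card_image_of_injOn ?_).symm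
    intro z hz z' hz' hzz
    have h1 := (Finset.mem_filter.1 hz).2
    have h2 := (Finset.mem_filter.1 hz').2
    refine Prod.ext (funext fun i => ?_) hzz
    have e := congrFun (h1.trans h2.symm) i
    simp only [pr, hzz] at e
    linarith
  have hfibmem : ∀ u, ∀ q ∈ fib u,
      β v v / 2 * (q.1 : ℚ) ^ 2 + β v w * q.1 * q.2 + β w w / 2 * (q.2 : ℚ) ^ 2
      + (β ((fun i => (u i : ℚ)), 0, 0) v + l v) * q.1 + (β ((fun i => (u i : ℚ)), 0, 0) w + l w) * q.2
      + quadVal β l f ((fun i => (u i : ℚ)), 0, 0) = 0 ∧ |q.1| ≤ V ∧ |q.2| ≤ V := by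
    intro u q hq
    obtain ⟨z, hz, rfl⟩ := Finset.mem_image.1 hq
    obtain ⟨hzS, hzu⟩ := Finset.mem_filter.1 hz
    obtain ⟨-, h2, h3, h4⟩ := hS z hzS
    refine ⟨?_, h2, h3⟩
    rw [← quadVal_plane hβ]
    refine Eq.trans (congrArg _ ?_) h4
    refine Prod.ext (funext fun i => ?_) (Prod.ext ?_ ?_)
    · simp [← hzu, pr, v, w]
      ring
    · simp [v, w]
    · simp [v, w]
  have hD' : β v w ^ 2 - 4 * (β v v / 2) * (β w w / 2) ≠ 0 := by
    convert hD using 1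
    simp only [planeDisc]
    ring
  -- Planes with a degenerate section. The leading part is the same nondegenerate form in all
  -- planes, so each still has at most 36V points, and by the zero count there are O(∏U_i / V) of
  -- them.
  let bad := Bx.filter (fun u => planeDet β l f v w ((fun i => (u i : ℚ)), 0, 0) = 0)
  have hbad : bad.card * V ≤ 10 * N * (43 ^ N * ∏ i, U i) := by
    have hL : LinePoly 6 (fun u : Fin N → ℚ => planeDet β l f v w (u, 0, 0)) := by
      have h := (linePoly_planeDet β l f).comp_affine (LinearMap.prod 0 (LinearMap.prod 0
        (LinearMap.inl ℚ (Fin N → ℚ) (ℚ × ℚ)))) (v, w, 0)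
      convert h using 2 with u
      simp
      rfl
    exact ((hL.mono (by norm_num : 6 ≤ 10)).card_zeros_box (V := V) hΔ Bi (fun i => by
      have := hVU i
      rw [hBi]; omega)).trans (Nat.mul_le_mul_left _ hprod)
  have hT1 : (1 : ℝ) ≤ (T : ℝ) ^ ε :=
    Real.one_le_rpow (by exact_mod_cast hV.trans hVT) hε.le
  have hterm : ∀ u ∈ Bx, ((fib u).card : ℝ) ≤ C * (T : ℝ) ^ ε + if u ∈ bad then (36 * V : ℝ) else 0 := by
    intro u hu
    by_cases hb : u ∈ bad
    · rw [if_pos hb]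
      have h1 : ((fib u).card : ℝ) ≤ 36 * V := by
        exact_mod_cast card_conic_le hV hD' (fib u) (hfibmem u)
      have : 0 ≤ C * (T : ℝ) ^ ε := by positivity
      linarith
    · rw [if_neg hb, add_zero]
      have hne : planeDet β l f v w ((fun i => (u i : ℚ)), 0, 0) ≠ 0 := fun h =>
        hb (Finset.mem_filter.2 ⟨hu, h⟩)
      refine (hC V _ _ _ _ _ _ hV hD' ?_ (fib u) (hfibmem u)).trans ?_
      · convert hne using 1
        simp only [planeDet]
        ring
      · gcongr
  have hsum : (S.card : ℝ) = ∑ u ∈ Bx, ((fib u).card : ℝ) := by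
    rw [Finset.card_eq_sum_card_fiberwise hmaps]
    push_cast
    exact Finset.sum_congr rfl fun u _ => by rw [hfibcard]
  have hBx : (Bx.card : ℝ) ≤ 43 ^ N * ∏ i, (U i : ℝ) := by
    rw [Fintype.card_piFinset]
    exact_mod_cast hprod
  have hbad' : (bad.card : ℝ) * V ≤ 10 * N * (43 ^ N * ∏ i, (U i : ℝ)) := by exact_mod_cast hbad
  have hU0 : 0 ≤ ∏ i, (U i : ℝ) := by positivity
  calc (S.card : ℝ) ≤ ∑ u ∈ Bx, (C * (T : ℝ) ^ ε + if u ∈ bad then (36 * V : ℝ) else 0) :=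
        hsum.le.trans (Finset.sum_le_sum hterm)
    _ = Bx.card * (C * (T : ℝ) ^ ε) + 36 * (bad.card * V) := by
        rw [Finset.sum_add_distrib, Finset.sum_const, nsmul_eq_mul, ← Finset.sum_filter,
          Finset.sum_const, nsmul_eq_mul]
        have : Bx.filter (fun u => u ∈ bad) = bad := by
          ext u
          simp [bad]
        rw [this]
        ring
    _ ≤ (43 ^ N * ∏ i, (U i : ℝ)) * (C * (T : ℝ) ^ ε)
        + 36 * (10 * N * (43 ^ N * ∏ i, (U i : ℝ))) * (T : ℝ) ^ ε := by
        refine add_le_add (by gcongr) ?_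
        refine (mul_le_mul_of_nonneg_left hbad' (by norm_num)).trans ?_
        exact le_mul_of_one_le_right (by positivity) hT1
    _ = _ := by ring

/-! ### Existence of nondegenerate plane sections. -/

section Sections

variable {V E : Type*} [AddCommGroup V] [Module ℚ V] [FiniteDimensional ℚ V]
  [AddCommGroup E] [Module ℚ E]

theorem finrank_orthogonal_range_le {B : LinearMap.BilinForm ℚ V} (hB : B.Nondegenerate)
    {A : E →ₗ[ℚ] V} (hA : Function.Injective A)
    (hdim : Module.finrank ℚ V ≤ Module.finrank ℚ E + 1) :
    Module.finrank ℚ (LinearMap.BilinForm.orthogonal B (LinearMap.range A)) ≤ 1 := by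
  rw [LinearMap.BilinForm.finrank_orthogonal hB, LinearMap.finrank_range_of_inj hA]
  omega

variable [FiniteDimensional ℚ E]

/-- If every plane were degenerate, the form restricted to E would have rank at most 1, hence a
radical of dimension at least dim E - 1 ≥ 2. Its image is orthogonal to the range of A, and that
orthogonal has dimension at most 1. -/
theorem exists_planeDisc_ne_zero {B : LinearMap.BilinForm ℚ V} (hB : B.Nondegenerate)
    (hs : ∀ x y, B x y = B y x) {A : E →ₗ[ℚ] V} (hA : Function.Injective A)
    (hdim : Module.finrank ℚ V ≤ Module.finrank ℚ E + 1) (h4 : 4 ≤ Module.finrank ℚ V) :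
    ∃ v w, planeDisc (B.compl₁₂ A A) v w ≠ 0 := by
  by_contra! h
  simp only [planeDisc, LinearMap.compl₁₂_apply] at h
  have hR := finrank_orthogonal_range_le hB hA hdim
  obtain ⟨v₀, hv₀⟩ : ∃ v₀ : E, (∀ w w', B (A v₀) (A w) = 0 → B (A v₀) (A w') = 0 →
      B (A w) (A w') = 0) ∧ ∀ w, B (A v₀) (A w) = 0 → ∀ e, B (A w) (A e) = 0 := by
    by_cases hiso : ∀ v, B (A v) (A v) = 0
    · have h0 : ∀ w w', B (A w) (A w') = 0 := fun w w' => by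
        have := hiso (w + w')
        simp only [map_add, LinearMap.add_apply, hiso, hs (A w') (A w)] at this
        linarith
      exact ⟨0, fun w w' _ _ => h0 w w', fun w _ e => h0 w e⟩
    · push Not at hiso
      obtain ⟨v₀, hv₀⟩ := hiso
      have h0 : ∀ w, B (A v₀) (A w) = 0 → B (A w) (A w) = 0 := by
        intro w hw
        have := h v₀ w
        rw [hw] at this
        have h' : B (A v₀) (A v₀) * B (A w) (A w) = 0 := by linarith
        exact (mul_eq_zero.1 h').resolve_left hv₀
      have h1 : ∀ w w', B (A v₀) (A w) = 0 → B (A v₀) (A w') = 0 → B (A w) (A w') = 0 := by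
        intro w w' hw hw'
        have := h0 (w + w') (by rw [map_add, map_add, hw, hw', add_zero])
        simp only [map_add, LinearMap.add_apply, h0 w hw, h0 w' hw', hs (A w') (A w)] at this
        linarith
      refine ⟨v₀, h1, fun w hw e => ?_⟩
      have h2 := h1 w (e - (B (A v₀) (A e) / B (A v₀) (A v₀)) • v₀) hw (by
        rw [map_sub, map_sub, map_smul, map_smul, smul_eq_mul]
        field_simp
        ring)
      rw [map_sub, map_sub, map_smul, map_smul, hs (A w) (A v₀), hw, smul_zero, sub_zero] at h2
      exact h2
  let φ : E →ₗ[ℚ] ℚ := (B (A v₀)) ∘ₗ A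
  have hle : (LinearMap.ker φ).map A ≤ LinearMap.BilinForm.orthogonal B (LinearMap.range A) := by
    rintro _ ⟨w, hw, rfl⟩
    rw [LinearMap.BilinForm.mem_orthogonal_iff]
    rintro _ ⟨e, rfl⟩
    show B (A e) (A w) = 0
    rw [hs]
    exact hv₀.2 w hw e
  have h1 := (Submodule.finrank_mono hle).trans hR
  rw [← (Submodule.equivMapOfInjective A hA _).finrank_eq] at h1
  have h2 := LinearMap.finrank_range_add_finrank_ker φ
  have h3 := Submodule.finrank_le (LinearMap.range φ)
  rw [Module.finrank_self] at h3
  omega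

/-- Hyperplane sections of an affine quadric `B(x,x)/2 = m`, `m ≠ 0`, in at least `4` variables
contain nondegenerate conics. -/
theorem exists_nondegenerate_plane {B : LinearMap.BilinForm ℚ V} (hB : B.Nondegenerate)
    (hs : ∀ x y, B x y = B y x) {A : E →ₗ[ℚ] V} (hA : Function.Injective A)
    (hdim : Module.finrank ℚ V ≤ Module.finrank ℚ E + 1) (h4 : 4 ≤ Module.finrank ℚ V)
    (x : V) {m : ℚ} (hm : m ≠ 0) :
    ∃ v w y, planeDisc (B.compl₁₂ A A) v w ≠ 0 ∧
      planeDet (B.compl₁₂ A A) (B x ∘ₗ A) (B x x / 2 - m) v w y ≠ 0 := by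
  obtain ⟨v, w, hD⟩ := exists_planeDisc_ne_zero hB hs hA hdim h4
  refine ⟨v, w, ?_⟩
  by_contra! hcon
  have hR := finrank_orthogonal_range_le hB hA hdim
  have hD' := hD
  simp only [planeDisc, LinearMap.compl₁₂_apply] at hD'
  set a := B (A v) (A v) with ha
  set b := B (A v) (A w) with hb
  set c := B (A w) (A w) with hc
  set D := b ^ 2 - a * c with hDdef
  -- x₁ = x + A y is the centre of the conic cut on x + A(span(v, w)); it exists because D ≠ 0.
  obtain ⟨y, hy1, hy2⟩ : ∃ y : E, B (x + A y) (A v) = 0 ∧ B (x + A y) (A w) = 0 := by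
    refine ⟨((B x (A v) * c - B x (A w) * b) / D) • v + ((B x (A w) * a - B x (A v) * b) / D) • w,
      ?_, ?_⟩
    · simp only [map_add, map_smul, LinearMap.add_apply, LinearMap.smul_apply, smul_eq_mul]
      rw [hs (A w) (A v), ← ha, ← hb]
      field_simp
      rw [hDdef]
      ring
    · simp only [map_add, map_smul, LinearMap.add_apply, LinearMap.smul_apply, smul_eq_mul]
      rw [← hb, ← hc]
      field_simp
      rw [hDdef]
      ring
  set x₁ := x + A y with hx₁
  -- For u orthogonal to v and w the linear terms of the conic at y + u vanish, so its determinant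
  -- is -D times the value of the quadric there. The assumed vanishing says that the quadric
  -- contains all of x₁ + A u.
  have hq : ∀ u, B (A v) (A u) = 0 → B (A w) (A u) = 0 → B (x₁ + A u) (x₁ + A u) = 2 * m := by
    intro u hv hw
    have h := hcon (y + u) hD
    have e1 : (B.compl₁₂ A A) (y + u) v + (B x ∘ₗ A) v = 0 := by
      rw [LinearMap.compl₁₂_apply, LinearMap.comp_apply, map_add, map_add, LinearMap.add_apply,
        hs (A u), hv]
      rw [hx₁, map_add, LinearMap.add_apply] at hy1
      linarith
    have e2 : (B.compl₁₂ A A) (y + u) w + (B x ∘ₗ A) w = 0 := by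
      rw [LinearMap.compl₁₂_apply, LinearMap.comp_apply, map_add, map_add, LinearMap.add_apply,
        hs (A u), hw]
      rw [hx₁, map_add, LinearMap.add_apply] at hy2
      linarith
    have e3 : quadVal (B.compl₁₂ A A) (B x ∘ₗ A) (B x x / 2 - m) (y + u) =
        B (x₁ + A u) (x₁ + A u) / 2 - m := by
      simp only [quadVal, LinearMap.compl₁₂_apply, LinearMap.comp_apply, hx₁, map_add,
        LinearMap.add_apply]
      rw [hs (A y) x, hs (A u) x]
      ring
    rw [planeDet, e1, e2, e3] at h
    simp only [LinearMap.compl₁₂_apply, ← ha, ← hb, ← hc] at h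
    have h' : (B (x₁ + A u) (x₁ + A u) / 2 - m) * D = 0 := by
      rw [hDdef]
      linarith
    have := (mul_eq_zero.1 h').resolve_right hD'
    linarith
  have hx₁m : B x₁ x₁ = 2 * m := by simpa using hq 0 (by simp) (by simp)
  have hx₁u : ∀ u, B (A v) (A u) = 0 → B (A w) (A u) = 0 → B x₁ (A u) = 0 ∧ B (A u) (A u) = 0 := by
    intro u hv hw
    have h1 := hq u hv hw
    have h2 := hq (-u) (by simp [hv]) (by simp [hw])
    simp only [map_add, map_neg, LinearMap.add_apply, LinearMap.neg_apply, hs (A u) x₁] at h1 h2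
    constructor <;> linarith
  let φ : E →ₗ[ℚ] ℚ × ℚ := LinearMap.prod (B (A v) ∘ₗ A) (B (A w) ∘ₗ A)
  have hφ : 0 < Module.finrank ℚ (LinearMap.ker φ) := by
    have h2 := LinearMap.finrank_range_add_finrank_ker φ
    have h3 := Submodule.finrank_le (LinearMap.range φ)
    rw [Module.finrank_prod, Module.finrank_self] at h3
    omega
  have := Module.nontrivial_of_finrank_pos hφ
  obtain ⟨⟨u, hu⟩, hu0⟩ := exists_ne (0 : LinearMap.ker φ)
  have hu0' : u ≠ 0 := fun h => hu0 (Subtype.ext h)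
  have huv : B (A v) (A u) = 0 := congrArg Prod.fst (LinearMap.mem_ker.1 hu)
  have huw : B (A w) (A u) = 0 := congrArg Prod.snd (LinearMap.mem_ker.1 hu)
  have hdecomp : ∀ e : E, ∃ s t : ℚ, ∃ u' : E, e = s • v + t • w + u' ∧
      B (A v) (A u') = 0 ∧ B (A w) (A u') = 0 := by
    intro e
    refine ⟨(B (A w) (A e) * b - B (A v) (A e) * c) / D, (B (A v) (A e) * b - B (A w) (A e) * a) / D,
      e - (((B (A w) (A e) * b - B (A v) (A e) * c) / D) • v
        + ((B (A v) (A e) * b - B (A w) (A e) * a) / D) • w), by abel, ?_, ?_⟩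
    · simp only [map_sub, map_add, map_smul, smul_eq_mul]
      rw [← ha, ← hb]
      field_simp
      rw [hDdef]
      ring
    · simp only [map_sub, map_add, map_smul, smul_eq_mul]
      rw [hs (A w) (A v), ← hb, ← hc]
      field_simp
      rw [hDdef]
      ring
  have hu_orth : A u ∈ LinearMap.BilinForm.orthogonal B (LinearMap.range A) := by
    rw [LinearMap.BilinForm.mem_orthogonal_iff]
    rintro _ ⟨e, rfl⟩
    obtain ⟨s, t, u', rfl, h1, h2⟩ := hdecomp e
    show B (A (s • v + t • w + u')) (A u) = 0
    simp only [map_add, map_smul, LinearMap.add_apply, LinearMap.smul_apply, smul_eq_mul]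
    have h3 := (hx₁u (u' + u) (by simp [h1, huv]) (by simp [h2, huw])).2
    simp only [map_add, LinearMap.add_apply, (hx₁u u huv huw).2, (hx₁u u' h1 h2).2,
      hs (A u) (A u')] at h3
    rw [huv, huw]
    linarith
  have hx₁_orth : x₁ ∈ LinearMap.BilinForm.orthogonal B (LinearMap.range A) := by
    rw [LinearMap.BilinForm.mem_orthogonal_iff]
    rintro _ ⟨e, rfl⟩
    obtain ⟨s, t, u', rfl, h1, h2⟩ := hdecomp e
    show B (A (s • v + t • w + u')) x₁ = 0
    rw [hs]
    simp only [map_add, map_smul, smul_eq_mul]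
    rw [hy1, hy2, (hx₁u u' h1 h2).1]
    ring
  -- A u ≠ 0 and x₁ lie in a space of dimension at most 1, so x₁ is a multiple of the isotropic
  -- vector A u. This contradicts B(x₁, x₁) = 2m ≠ 0.
  obtain ⟨g, hg⟩ := finrank_le_one_iff.1 hR
  obtain ⟨r, hr⟩ := hg ⟨A u, hu_orth⟩
  obtain ⟨s, hs'⟩ := hg ⟨x₁, hx₁_orth⟩
  have hr' : r • (g : V) = A u := congrArg Subtype.val hr
  have hs'' : s • (g : V) = x₁ := congrArg Subtype.val hs'
  have hr0 : r ≠ 0 := by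
    rintro rfl
    rw [zero_smul] at hr'
    exact hu0' (hA (by rw [← hr', map_zero]))
  have hx : x₁ = (s / r) • A u := by
    rw [← hr', ← hs'', smul_smul, div_mul_cancel₀ _ hr0]
  have : B x₁ x₁ = 0 := by
    conv_lhs => rw [hx]
    rw [map_smul, map_smul, LinearMap.smul_apply, (hx₁u u huv huw).2, smul_zero, smul_zero]
  rw [hx₁m] at this
  exact hm (by linarith)

end Sections

/-! ### Lattices and successive minima. -/

/-- The maximum of the absolute values of the coordinates of an integer vector. -/
def supAbs {n : ℕ} (z : Fin n → ℤ) : ℕ := Finset.univ.sup fun i => (z i).natAbs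

theorem supAbs_le {n : ℕ} {z : Fin n → ℤ} {k : ℕ} : supAbs z ≤ k ↔ ∀ i, |z i| ≤ k := by
  simp only [supAbs, Finset.sup_le_iff, Finset.mem_univ, true_imp_iff, Int.abs_eq_natAbs,
    Nat.cast_le]

theorem abs_le_supAbs {n : ℕ} (z : Fin n → ℤ) (i : Fin n) : |z i| ≤ supAbs z :=
  supAbs_le.1 le_rfl i

theorem supAbs_pos {n : ℕ} {z : Fin n → ℤ} (hz : z ≠ 0) : 0 < supAbs z := by
  by_contra! h
  refine hz (funext fun i => ?_)
  have := supAbs_le.1 h i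
  simpa using this

/-- An integer vector viewed over `ℚ`. -/
def ratVec {n : ℕ} (z : Fin n → ℤ) : Fin n → ℚ := fun i => (z i : ℚ)

theorem ratVec_sub {n : ℕ} (y z : Fin n → ℤ) : ratVec (y - z) = ratVec y - ratVec z := by
  ext i
  simp [ratVec]

/-- The coordinates of the vectors of a subspace are controlled by as many of them as its
dimension. -/
theorem exists_controlling_coords {n : ℕ} (W : Submodule ℚ (Fin n → ℚ)) :
    ∃ J : Finset (Fin n), J.card = Module.finrank ℚ W ∧
      ∀ x ∈ W, ∀ X : ℚ, (∀ i ∈ J, |x i| ≤ X) → 0 ≤ X → ∀ i, |x i| ≤ n ^ n * X := by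
  classical
  have hWn : Module.finrank ℚ W ≤ n := by simpa using Submodule.finrank_le W
  -- Coordinates are discarded one at a time. While more than dim W remain, they satisfy a
  -- nontrivial linear relation g on W; the coordinate with the largest coefficient is then at most
  -- n times the maximum of the others.
  have main : ∀ k, Module.finrank ℚ W + k ≤ n → ∃ J : Finset (Fin n), J.card = n - k ∧
      ∀ x ∈ W, ∀ X : ℚ, (∀ i ∈ J, |x i| ≤ X) → 0 ≤ X → ∀ i, |x i| ≤ n ^ k * X := by
    intro k
    induction k with
    | zero =>
      intro _
      exact ⟨Finset.univ, by simp, fun x _ X h _ i => by simpa using h i (Finset.mem_univ i)⟩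
    | succ k ih =>
      intro hk
      obtain ⟨J, hJ, hb⟩ := ih (by omega)
      have hn1 : (1 : ℚ) ≤ n := by exact_mod_cast (by omega : 1 ≤ n)
      let ρ : W →ₗ[ℚ] (J → ℚ) := (LinearMap.funLeft ℚ ℚ (fun j : J => (j : Fin n))) ∘ₗ W.subtype
      have hlt : LinearMap.range ρ < ⊤ := by
        refine lt_top_iff_ne_top.2 fun h => ?_
        have h1 := LinearMap.finrank_range_le ρ
        rw [h, finrank_top, Module.finrank_fintype_fun_eq_card, Fintype.card_coe] at h1
        omega
      obtain ⟨g, hg0, hg⟩ := Submodule.exists_le_ker_of_lt_top _ hlt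
      have hJne : (Finset.univ : Finset J).Nonempty := by
        rw [Finset.univ_nonempty_iff]
        by_contra hemp
        rw [not_nonempty_iff] at hemp
        exact hg0 (LinearMap.ext fun x => by rw [Subsingleton.elim x 0, map_zero, map_zero])
      obtain ⟨i₀, -, hi₀⟩ := Finset.exists_max_image (Finset.univ : Finset J)
        (fun j => |g (Pi.single j 1)|) hJne
      have hgsum : ∀ y : J → ℚ, g y = ∑ j, y j * g (Pi.single j 1) := by
        intro y
        conv_lhs => rw [pi_eq_sum_univ' y]
        simp [map_sum]
      have hgi₀ : g (Pi.single i₀ 1) ≠ 0 := by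
        intro h0
        refine hg0 (LinearMap.ext fun y => ?_)
        rw [hgsum, LinearMap.zero_apply]
        refine Finset.sum_eq_zero fun j _ => ?_
        have := hi₀ j (Finset.mem_univ j)
        rw [h0, abs_zero] at this
        rw [abs_nonpos_iff.1 this, mul_zero]
      refine ⟨J.erase i₀, by rw [Finset.card_erase_of_mem i₀.2, hJ]; omega, ?_⟩
      intro x hx X hX hX0 i
      have h0 : g (ρ ⟨x, hx⟩) = 0 := hg ⟨⟨x, hx⟩, rfl⟩
      have hxi₀ : |x i₀| ≤ n * X := by
        rw [hgsum, ← Finset.add_sum_erase _ _ (Finset.mem_univ i₀)] at h0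
        have h1 : |x i₀| * |g (Pi.single i₀ 1)| ≤ (n * X) * |g (Pi.single i₀ 1)| := by
          calc |x i₀| * |g (Pi.single i₀ 1)| = |ρ ⟨x, hx⟩ i₀ * g (Pi.single i₀ 1)| := by
                rw [abs_mul]; rfl
            _ = |∑ j ∈ Finset.univ.erase i₀, ρ ⟨x, hx⟩ j * g (Pi.single j 1)| := by
                rw [eq_neg_of_add_eq_zero_left h0, abs_neg]
            _ ≤ ∑ j ∈ Finset.univ.erase i₀, |ρ ⟨x, hx⟩ j * g (Pi.single j 1)| :=
                Finset.abs_sum_le_sum_abs _ _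
            _ ≤ ∑ j ∈ Finset.univ.erase i₀, X * |g (Pi.single i₀ 1)| := by
                refine Finset.sum_le_sum fun j hj => ?_
                rw [abs_mul]
                refine mul_le_mul (hX j (Finset.mem_erase.2 ⟨?_, j.2⟩)) (hi₀ j (Finset.mem_univ j))
                  (abs_nonneg _) hX0
                exact fun h => (Finset.mem_erase.1 hj).1 (Subtype.ext h)
            _ = ((Finset.univ.erase i₀).card : ℚ) * (X * |g (Pi.single i₀ 1)|) := by
                rw [Finset.sum_const, nsmul_eq_mul]
            _ ≤ n * (X * |g (Pi.single i₀ 1)|) := by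
                gcongr
                refine (Finset.card_erase_le).trans ?_
                rw [Finset.card_univ, Fintype.card_coe, hJ]
                omega
            _ = _ := by ring
        exact le_of_mul_le_mul_right h1 (abs_pos.2 hgi₀)
      have hXn : X ≤ n * X := le_mul_of_one_le_left hX0 hn1
      have := hb x hx (n * X) (fun j hj => by
        by_cases hji : j = i₀
        · rw [hji]; exact hxi₀
        · exact (hX j (Finset.mem_erase.2 ⟨hji, hj⟩)).trans hXn) (by positivity) i
      refine this.trans (le_of_eq ?_)
      ring
  obtain ⟨J, hJ, hb⟩ := main (n - Module.finrank ℚ W) (by omega)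
  refine ⟨J, by omega, fun x hx X hX hX0 i => (hb x hx X hX hX0 i).trans ?_⟩
  rcases Nat.eq_zero_or_pos n with rfl | hn
  · exact i.elim0
  have hn1 : (1 : ℚ) ≤ n := by exact_mod_cast hn
  have := pow_le_pow_right₀ hn1 (Nat.sub_le n (Module.finrank ℚ W))
  gcongr

/-- Linearly independent vectors realizing the successive minima of a lattice containing `ℓ ℤⁿ`,
together with a bound for the number of lattice vectors in their span. -/
theorem exists_successive_minima (n : ℕ) : ∀ j ≤ n, ∃ K : ℕ, ∀ (ℓ : ℕ) (L : AddSubgroup (Fin n → ℤ)),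
    1 ≤ ℓ → (∀ z : Fin n → ℤ, (ℓ : ℤ) • z ∈ L) →
    ∃ c : Fin j → Fin n → ℤ, (∀ i, c i ∈ L) ∧ LinearIndependent ℚ (fun i => ratVec (c i)) ∧
      Monotone (fun i => supAbs (c i)) ∧ (∀ i, supAbs (c i) ≤ ℓ) ∧
      (∀ y ∈ L, ratVec y ∉ Submodule.span ℚ (Set.range fun i => ratVec (c i)) →
        ∀ i, supAbs (c i) ≤ supAbs y) ∧
      ∀ X : ℕ, (∀ i, supAbs (c i) ≤ X) → ∀ S : Finset (Fin n → ℤ),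
        (∀ y ∈ S, y ∈ L ∧ ratVec y ∈ Submodule.span ℚ (Set.range fun i => ratVec (c i)) ∧
          supAbs y ≤ X) → S.card * ∏ i, supAbs (c i) ≤ K * X ^ j := by
  classical
  intro j
  induction j with
  | zero =>
    intro _
    refine ⟨1, fun ℓ L _ _ => ⟨Fin.elim0, fun i => i.elim0, linearIndependent_empty_type,
      fun i => i.elim0, fun i => i.elim0, fun _ _ _ i => i.elim0, fun X _ S hS => ?_⟩⟩
    have : S ⊆ {0} := by
      intro y hy
      obtain ⟨-, h, -⟩ := hS y hy
      rw [Set.range_eq_empty, Submodule.span_empty, Submodule.mem_bot] at h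
      rw [Finset.mem_singleton]
      ext i
      simpa [ratVec] using congrFun h i
    have := Finset.card_le_card this
    simpa using this
  | succ j ih =>
    intro hj
    obtain ⟨K, hK⟩ := ih (by omega)
    obtain ⟨κ, hκ⟩ : ∃ κ : ℕ, κ = n ^ n := ⟨_, rfl⟩
    have hκ1 : 1 ≤ κ := by
      rw [hκ]
      exact Nat.one_le_pow _ _ (by omega)
    refine ⟨K * (7 * κ) ^ (j + 1), fun ℓ L hℓ hL => ?_⟩
    obtain ⟨c, hcL, hli, hmono, hcℓ, hmin, hcount⟩ := hK ℓ L hℓ hL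
    set Wj := Submodule.span ℚ (Set.range fun i => ratVec (c i)) with hWj
    -- The vectors ℓe_i lie in L and span, so one of them lies outside the current span.
    have hexℓ : ∃ y ∈ L, ratVec y ∉ Wj ∧ supAbs y ≤ ℓ := by
      by_contra! hcon
      have htop : Wj = ⊤ := by
        rw [eq_top_iff, ← (Pi.basisFun ℚ (Fin n)).span_eq, Submodule.span_le]
        rintro _ ⟨i, rfl⟩
        have h1 : ratVec ((ℓ : ℤ) • Pi.single i (1 : ℤ)) ∈ Wj := by
          by_contra h
          refine (hcon _ (hL _) h).not_ge (supAbs_le.2 fun k => ?_)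
          by_cases hk : k = i
          · subst hk; simp
          · simp [hk]
        have h2 : ratVec ((ℓ : ℤ) • Pi.single i (1 : ℤ)) = (ℓ : ℚ) • Pi.single i (1 : ℚ) := by
          ext k
          by_cases hk : k = i
          · subst hk; simp [ratVec]
          · simp [ratVec, hk]
        rw [h2] at h1
        have hℓ0 : (ℓ : ℚ) ≠ 0 := by exact_mod_cast (by omega : ℓ ≠ 0)
        simpa using (Submodule.smul_mem_iff _ hℓ0).1 h1
      have h1 := finrank_span_eq_card hli
      rw [← hWj, htop, finrank_top, Module.finrank_fintype_fun_eq_card, Fintype.card_fin,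
        Fintype.card_fin] at h1
      omega
    have hex : ∃ k : ℕ, ∃ y ∈ L, ratVec y ∉ Wj ∧ supAbs y = k :=
      let ⟨y, h1, h2, _⟩ := hexℓ
      ⟨_, y, h1, h2, rfl⟩
    obtain ⟨y, hyL, hyW, hμ⟩ := Nat.find_spec hex
    set μ := Nat.find hex with hμdef
    have hμmin : ∀ z ∈ L, ratVec z ∉ Wj → μ ≤ supAbs z := fun z hz hzW =>
      Nat.find_min' hex ⟨z, hz, hzW, rfl⟩
    have hμℓ : μ ≤ ℓ := by
      obtain ⟨z, hz, hzW, hzℓ⟩ := hexℓ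
      exact (hμmin z hz hzW).trans hzℓ
    have hcμ : ∀ i, supAbs (c i) ≤ μ := fun i => hμ ▸ hmin y hyL hyW i
    have hμ0 : 0 < μ := by
      rw [← hμ]
      refine supAbs_pos ?_
      rintro rfl
      refine hyW ?_
      have : ratVec (0 : Fin n → ℤ) = 0 := by ext; simp [ratVec]
      rw [this]
      exact Submodule.zero_mem _
    let c' : Fin (j + 1) → Fin n → ℤ := Fin.snoc c y
    have hc'r : (fun i => ratVec (c' i)) = Fin.snoc (fun i => ratVec (c i)) (ratVec y) := by
      funext i
      refine Fin.lastCases ?_ (fun i => ?_) i <;> simp [c']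
    have hli' : LinearIndependent ℚ (fun i => ratVec (c' i)) := by
      rw [hc'r, linearIndependent_finSnoc]
      exact ⟨hli, hyW⟩
    set W' := Submodule.span ℚ (Set.range fun i => ratVec (c' i)) with hW'
    have hWW' : Wj ≤ W' := by
      refine Submodule.span_le.2 ?_
      rintro _ ⟨i, rfl⟩
      exact Submodule.subset_span ⟨i.castSucc, by simp [c']⟩
    have hc'X : ∀ X : ℕ, (∀ i, supAbs (c' i) ≤ X) → μ ≤ X := fun X h => by
      have := h (Fin.last j)
      simpa [c', hμ] using this
    have hforall : ∀ {p : ℕ → Prop}, (∀ i, p (supAbs (c i))) → p μ → ∀ i, p (supAbs (c' i)) := by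
      intro p h1 h2 i
      refine Fin.lastCases ?_ (fun i => ?_) i
      · simpa [c', hμ] using h2
      · simpa [c'] using h1 i
    refine ⟨c', ?_, hli', ?_, hforall (p := fun k => k ≤ ℓ) hcℓ hμℓ, ?_, ?_⟩
    · intro i
      refine Fin.lastCases ?_ (fun i => ?_) i
      · simpa [c'] using hyL
      · simpa [c'] using hcL i
    · intro i k hik
      revert hik
      refine Fin.lastCases (fun _ => ?_) (fun k hik => ?_) k
      · have := hforall (p := fun r => r ≤ μ) hcμ le_rfl i
        simpa [c', hμ] using this
      · obtain ⟨i, rfl⟩ : ∃ i' : Fin j, i = i'.castSucc :=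
          ⟨⟨i, lt_of_le_of_lt hik k.2⟩, rfl⟩
        simpa [c'] using hmono (by simpa using hik)
    · intro z hz hzW i
      have hzW' : ratVec z ∉ Wj := fun h => hzW (hWW' h)
      exact hforall (p := fun k => k ≤ supAbs z) (hmin z hz hzW') (hμmin z hz hzW') i
    · intro X hX S hS
      have hμX := hc'X X hX
      have hprod : ∏ i, supAbs (c' i) = (∏ i, supAbs (c i)) * μ := by
        rw [Fin.prod_univ_castSucc]
        simp [c', hμ]
      set Pj := ∏ i, supAbs (c i) with hPj
      have hPj0 : 0 < Pj := Finset.prod_pos fun i _ => supAbs_pos fun h0 => by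
        refine hli.ne_zero i ?_
        ext k
        simp [h0, ratVec]
      obtain ⟨J, hJ, hJc⟩ := exists_controlling_coords W'
      rw [finrank_span_eq_card hli', Fintype.card_fin] at hJ
      -- Cells of side μ/(2κ) in the controlling coordinates: two vectors in one cell differ by at
      -- most μ/2 < μ, so by minimality of μ the difference lies in the previous span, where the
      -- induction hypothesis with X = μ counts it. The indices are at most 2κX/μ in size; the
      -- factor 3 leaves room for rounding.
      set B : ℕ := 3 * κ * X / μ with hB
      have hBμ : B * μ ≤ 3 * κ * X := Nat.div_mul_le_self _ _
      let cell : (Fin n → ℤ) → J → ℤ := fun z i => (2 * κ * z i) / μ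
      have hcell : ∀ z ∈ S, cell z ∈ Fintype.piFinset fun _ : J => Finset.Icc (-(B : ℤ)) B := by
        intro z hz
        rw [Fintype.mem_piFinset]
        intro i
        obtain ⟨-, -, hzX⟩ := hS z hz
        have h1 := abs_le.1 (supAbs_le.1 hzX i)
        have hμ0' : (0 : ℤ) < μ := by exact_mod_cast hμ0
        have hμX' : (μ : ℤ) ≤ X := by exact_mod_cast hμX
        have hκ1' : (1 : ℤ) ≤ κ := by exact_mod_cast hκ1
        have hlt : (3 * κ * X : ℤ) < (B + 1) * μ := by
          have := Nat.lt_mul_div_succ (3 * κ * X) hμ0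
          rw [← hB, mul_comm μ] at this
          exact_mod_cast this
        simp only [cell, Finset.mem_Icc]
        constructor
        · rw [Int.le_ediv_iff_mul_le hμ0']
          have hXX : (X : ℤ) ≤ κ * X := by nlinarith
          nlinarith
        · have : (2 * κ * z i) / (μ : ℤ) < B + 1 := by
            rw [Int.ediv_lt_iff_lt_mul hμ0']
            nlinarith
          omega
      have hfib : ∀ q ∈ Fintype.piFinset fun _ : J => Finset.Icc (-(B : ℤ)) B,
          (S.filter (fun z => cell z = q)).card ≤ K * μ ^ j / Pj := by
        intro q _
        rw [Nat.le_div_iff_mul_le hPj0]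
        rcases (S.filter (fun z => cell z = q)).eq_empty_or_nonempty with he | ⟨z₀, hz₀⟩
        · rw [he]; simp
        obtain ⟨hz₀S, hz₀q⟩ := Finset.mem_filter.1 hz₀
        have := hcount μ hcμ ((S.filter (fun z => cell z = q)).image fun z => z - z₀) (by
          intro w hw
          obtain ⟨z, hz, rfl⟩ := Finset.mem_image.1 hw
          obtain ⟨hzS, hzq⟩ := Finset.mem_filter.1 hz
          have hwL : z - z₀ ∈ L := L.sub_mem (hS z hzS).1 (hS z₀ hz₀S).1
          have hwW : ratVec (z - z₀) ∈ W' := by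
            rw [ratVec_sub]
            exact Submodule.sub_mem _ (hS z hzS).2.1 (hS z₀ hz₀S).2.1
          have hκ0 : (0 : ℚ) < κ := by exact_mod_cast hκ1
          have hμ0' : (0 : ℚ) < μ := by exact_mod_cast hμ0
          have hd := hJc _ hwW ((μ : ℚ) / (2 * κ)) (fun i hi => by
            have e := congrFun (hzq.trans hz₀q.symm) ⟨i, hi⟩
            simp only [cell] at e
            have hμz : (μ : ℤ) ≠ 0 := by exact_mod_cast hμ0.ne'
            have hμz' : (0 : ℤ) < μ := by exact_mod_cast hμ0
            have e1 := Int.mul_ediv_add_emod (2 * κ * z i) μ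
            have e2 := Int.mul_ediv_add_emod (2 * κ * z₀ i) μ
            have r1 := Int.emod_nonneg (2 * κ * z i) hμz
            have r2 := Int.emod_nonneg (2 * κ * z₀ i) hμz
            have s1 := Int.emod_lt_of_pos (2 * κ * z i) hμz'
            have s2 := Int.emod_lt_of_pos (2 * κ * z₀ i) hμz'
            rw [e] at e1
            have hb : |2 * κ * (z i - z₀ i)| ≤ (μ : ℤ) := by
              rw [abs_le]
              constructor <;> linarith
            have hb' : |(2 * κ * ((z i : ℚ) - z₀ i))| ≤ μ := by exact_mod_cast hb
            rw [abs_mul, abs_of_pos (by positivity)] at hb'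
            rw [le_div_iff₀ (by positivity), mul_comm]
            simpa [ratVec] using hb') (by positivity)
          have hlt : supAbs (z - z₀) < μ := by
            have : supAbs (z - z₀) ≤ μ - 1 := by
              refine supAbs_le.2 fun i => ?_
              have h1 := hd i
              have hκn : (n : ℚ) ^ n = κ := by rw [hκ]; push_cast; rfl
              rw [hκn] at h1
              have h2 : (κ : ℚ) * (μ / (2 * κ)) = μ / 2 := by field_simp
              rw [h2] at h1
              have h3 : |(ratVec (z - z₀)) i| < (μ : ℚ) := h1.trans_lt (by linarith)
              have h4 : |(z - z₀) i| < (μ : ℤ) := by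
                simp only [ratVec] at h3
                exact_mod_cast h3
              omega
            omega
          refine ⟨hwL, ?_, hlt.le⟩
          by_contra hnot
          exact absurd (hμmin _ hwL hnot) (by omega))
        rwa [Finset.card_image_of_injective _ (sub_left_injective)] at this
      have hcard := Finset.card_le_mul_card_image_of_maps_to hcell _ hfib
      have hpi : (Fintype.piFinset fun _ : J => Finset.Icc (-(B : ℤ)) B).card =
          (2 * B + 1) ^ (j + 1) := by
        rw [Fintype.card_piFinset, Finset.prod_const, Finset.card_univ, Fintype.card_coe, hJ,
          Int.card_Icc]
        congr 1
        omega
      rw [hpi] at hcard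
      have hBX : (2 * B + 1) * μ ≤ 7 * κ * X := by nlinarith
      rw [hprod]
      calc S.card * (Pj * μ) ≤ (K * μ ^ j / Pj) * (2 * B + 1) ^ (j + 1) * (Pj * μ) :=
            Nat.mul_le_mul_right _ hcard
        _ = (K * μ ^ j / Pj * Pj) * ((2 * B + 1) ^ (j + 1) * μ) := by ring
        _ ≤ (K * μ ^ j) * ((2 * B + 1) ^ (j + 1) * μ) :=
            Nat.mul_le_mul_right _ (Nat.div_mul_le_self _ _)
        _ = K * ((2 * B + 1) * μ) ^ (j + 1) := by rw [mul_pow]; ring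
        _ ≤ K * (7 * κ * X) ^ (j + 1) := by gcongr
        _ = _ := by rw [mul_pow]; ring

/-- Reduced vectors in the lattice of multiples of `a` modulo `ℓ`. -/
theorem exists_reduced_vectors (n : ℕ) : ∃ K : ℕ, ∀ (ℓ M : ℕ) (a : Fin n → ℤ), 1 ≤ ℓ →
    (∀ t : ℤ, (∀ i, (ℓ : ℤ) ∣ t * a i) → (ℓ : ℤ) ∣ M * t) → 1 ≤ M →
    ∃ c : Fin n → Fin n → ℤ, (∀ k, ∃ t : ℤ, ∀ i, (ℓ : ℤ) ∣ c k i - t * a i) ∧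
      LinearIndependent ℚ (fun k => ratVec (c k)) ∧ Monotone (fun k => supAbs (c k)) ∧
      (∀ k, supAbs (c k) ≤ ℓ) ∧ ℓ * ∏ k, supAbs (c k) ≤ K * M * ℓ ^ n := by
  classical
  obtain ⟨K, hK⟩ := exists_successive_minima n n le_rfl
  refine ⟨K, fun ℓ M a hℓ hM hM1 => ?_⟩
  let L : AddSubgroup (Fin n → ℤ) :=
    { carrier := {z | ∃ t : ℤ, ∀ i, (ℓ : ℤ) ∣ z i - t * a i}
      zero_mem' := ⟨0, by simp⟩
      add_mem' := by
        rintro x y ⟨s, hs⟩ ⟨t, ht⟩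
        refine ⟨s + t, fun i => ?_⟩
        have e : (x + y) i - (s + t) * a i = (x i - s * a i) + (y i - t * a i) := by
          rw [Pi.add_apply]
          ring
        rw [e]
        exact dvd_add (hs i) (ht i)
      neg_mem' := by
        rintro x ⟨s, hs⟩
        refine ⟨-s, fun i => ?_⟩
        have e : (-x) i - (-s) * a i = -(x i - s * a i) := by
          rw [Pi.neg_apply]
          ring
        rw [e]
        exact (hs i).neg_right }
  obtain ⟨c, hcL, hli, hmono, hcℓ, -, hcount⟩ := hK ℓ L hℓ (fun z => ⟨0, fun i => by simp⟩)
  refine ⟨c, hcL, hli, hmono, hcℓ, ?_⟩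
  have hspan : Submodule.span ℚ (Set.range fun i => ratVec (c i)) = ⊤ :=
    hli.span_eq_top_of_card_eq_finrank' (by simp)
  have hℓ0 : (ℓ : ℤ) ≠ 0 := by exact_mod_cast (by omega : ℓ ≠ 0)
  have hℓpos : (0 : ℤ) < ℓ := by exact_mod_cast hℓ
  let r : ℕ → Fin n → ℤ := fun t i => ((t : ℤ) * a i) % ℓ
  -- T = ⌈ℓ/M⌉. The multiples ta with 0 ≤ t < T are distinct mod ℓ, since a coincidence gives ℓ ∣
  -- M(s - t) with |M(s - t)| < ℓ. Counting these T lattice points with X = ℓ bounds the product of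
  -- the minima.
  set T := (ℓ - 1) / M + 1 with hT
  have hT1 : ℓ ≤ T * M := by
    have := Nat.lt_mul_div_succ (ℓ - 1) (show 0 < M by omega)
    rw [← hT, mul_comm] at this
    omega
  have hT2 : ∀ t < T, M * t < ℓ := by
    intro t ht
    have h1 : M * t ≤ M * ((ℓ - 1) / M) := Nat.mul_le_mul_left _ (by omega)
    have h2 := Nat.mul_div_le (ℓ - 1) M
    omega
  have hinj : Set.InjOn r (Finset.range T) := by
    intro s hs t ht hst
    rw [Finset.coe_range, Set.mem_Iio] at hs ht
    have h1 := hM ((s : ℤ) - t) (fun i => by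
      have e : ((s : ℤ) * a i) % ℓ = ((t : ℤ) * a i) % ℓ := congrFun hst i
      rw [sub_mul]
      exact Int.ModEq.dvd e.symm)
    have h2 := hT2 s hs
    have h3 := hT2 t ht
    have h4 : (M : ℤ) * ((s : ℤ) - t) = 0 := by
      refine Int.eq_zero_of_abs_lt_dvd h1 ?_
      rw [mul_sub, abs_lt]
      have h2' : (M : ℤ) * s < ℓ := by exact_mod_cast h2
      have h3' : (M : ℤ) * t < ℓ := by exact_mod_cast h3
      have h6 : (0 : ℤ) ≤ M * s := by positivity
      have h7 : (0 : ℤ) ≤ M * t := by positivity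
      constructor <;> linarith
    have h5 := (mul_eq_zero.1 h4).resolve_left (by exact_mod_cast (by omega : M ≠ 0))
    omega
  have := hcount ℓ hcℓ ((Finset.range T).image r) (by
    intro y hy
    obtain ⟨t, -, rfl⟩ := Finset.mem_image.1 hy
    refine ⟨⟨t, fun i => ?_⟩, by rw [hspan]; exact Submodule.mem_top, supAbs_le.2 fun i => ?_⟩
    · exact (Int.mod_modEq ((t : ℤ) * a i) ℓ).symm.dvd
    · have h1 := Int.emod_nonneg ((t : ℤ) * a i) hℓ0
      have h2 := Int.emod_lt_of_pos ((t : ℤ) * a i) hℓpos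
      rw [abs_of_nonneg h1]
      exact h2.le)
  rw [Finset.card_image_of_injOn hinj, Finset.card_range] at this
  calc ℓ * ∏ k, supAbs (c k) ≤ T * M * ∏ k, supAbs (c k) := Nat.mul_le_mul_right _ hT1
    _ = M * (T * ∏ k, supAbs (c k)) := by ring
    _ ≤ M * (K * ℓ ^ n) := Nat.mul_le_mul_left _ this
    _ = _ := by ring

/-! ### Counting on sections in adapted coordinates. -/

/-- Quadric sections parametrized by `N + 2` coordinates; the first two coordinates have the
smallest ranges. -/
theorem exists_card_section_le (N : ℕ) (ε : ℝ) (hε : 0 < ε) : ∃ C : ℝ, 0 < C ∧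
    ∀ (n : ℕ) (B : LinearMap.BilinForm ℚ (Fin n → ℚ)), B.Nondegenerate → (∀ x y, B x y = B y x) →
    4 ≤ n → n ≤ N + 3 → ∀ (J : (Fin (N + 2) → ℚ) →ₗ[ℚ] (Fin n → ℚ)), Function.Injective J →
    ∀ (x : Fin n → ℚ) (m : ℚ), m ≠ 0 → ∀ (U : Fin (N + 2) → ℕ) (T : ℕ), 1 ≤ U 0 → Monotone U →
    U 1 ≤ T → ∀ S : Finset (Fin (N + 2) → ℤ), (∀ z ∈ S, (∀ i, |z i| ≤ U i) ∧
      B (x + J (ratVec z)) (x + J (ratVec z)) = 2 * m) →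
    (S.card : ℝ) ≤ C * (∏ i : Fin N, (U i.succ.succ : ℝ)) * (T : ℝ) ^ ε := by
  classical
  obtain ⟨C, hC0, hC⟩ := exists_card_quadric_box_le N ε hε
  refine ⟨C, hC0, ?_⟩
  intro n B hB hs h4 hn J hJ x m hm U T hU0 hU hUT S hS
  let E := (Fin N → ℚ) × ℚ × ℚ
  -- The two shortest coordinates become the plane coordinates, with V = U 1. The hypothesis n ≤ N +
  -- 3 admits both the whole space (n = N + 2) and a hyperplane (n = N + 3).
  let κ : E →ₗ[ℚ] (Fin (N + 2) → ℚ) := LinearMap.pi (Fin.cons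
    (LinearMap.fst ℚ ℚ ℚ ∘ₗ LinearMap.snd ℚ (Fin N → ℚ) (ℚ × ℚ))
    (Fin.cons (LinearMap.snd ℚ ℚ ℚ ∘ₗ LinearMap.snd ℚ (Fin N → ℚ) (ℚ × ℚ))
      (fun i => LinearMap.proj i ∘ₗ LinearMap.fst ℚ (Fin N → ℚ) (ℚ × ℚ))))
  have hκ : Function.Injective κ := by
    intro u u' h
    refine Prod.ext (funext fun i => ?_) (Prod.ext ?_ ?_)
    · exact congrFun h i.succ.succ
    · exact congrFun h 0
    · exact congrFun h 1
  let sp : (Fin (N + 2) → ℤ) → (Fin N → ℤ) × ℤ × ℤ := fun z => (fun i => z i.succ.succ, z 0, z 1)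
  have hsp : Function.Injective sp := by
    intro z z' h
    simp only [sp, Prod.mk.injEq] at h
    funext i
    refine Fin.cases h.2.1 (fun i => Fin.cases h.2.2 (fun i => congrFun h.1 i) i) i
  have hκsp : ∀ z, κ ((fun i => ((sp z).1 i : ℚ)), ((sp z).2.1 : ℚ), ((sp z).2.2 : ℚ)) = ratVec z := by
    intro z
    funext i
    refine Fin.cases rfl (fun i => Fin.cases rfl (fun i => rfl) i) i
  have hgood := exists_nondegenerate_plane hB hs (A := J ∘ₗ κ) (hJ.comp hκ)
    (by simp [E]; omega) (by simpa using h4) x hm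
  have := hC (B.compl₁₂ (J ∘ₗ κ) (J ∘ₗ κ)) (fun u v => hs _ _) (B x ∘ₗ (J ∘ₗ κ)) (B x x / 2 - m) hgood
    (fun i => U i.succ.succ) (U 1) T (hU0.trans (hU (Fin.zero_le _)))
    (fun i => hU (by rw [Fin.le_def]; simp [Fin.val_succ])) hUT (S.image sp) (by
      intro q hq
      obtain ⟨z, hz, rfl⟩ := Finset.mem_image.1 hq
      obtain ⟨h1, h2⟩ := hS z hz
      refine ⟨fun i => h1 i.succ.succ, (h1 0).trans ?_, h1 1, ?_⟩
      · exact_mod_cast hU (Fin.zero_le _)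
      · simp only [quadVal, LinearMap.compl₁₂_apply, LinearMap.comp_apply]
        rw [hκsp]
        simp only [map_add, LinearMap.add_apply] at h2
        rw [hs (J (ratVec z)) x] at h2
        linarith)
  rwa [Finset.card_image_of_injective _ hsp] at this

theorem ratVec_add_smul {n : ℕ} (x y : Fin n → ℤ) (k : ℤ) :
    ratVec (x + k • y) = ratVec x + (k : ℚ) • ratVec y := by
  ext i
  simp [ratVec]

/-- Points of a quadric on a hyperplane. -/
theorem exists_card_hyperplane_section_le (N : ℕ) (hN : 1 ≤ N) (ε : ℝ) (hε : 0 < ε) :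
    ∃ C : ℝ, 0 < C ∧
    ∀ (B : LinearMap.BilinForm ℚ (Fin (N + 3) → ℚ)), B.Nondegenerate → (∀ x y, B x y = B y x) →
    ∀ (x : Fin (N + 3) → ℤ) (m : ℚ), m ≠ 0 → ∀ (ℓ R : ℕ), 1 ≤ ℓ → 1 ≤ R →
    ∀ (c : Fin (N + 3) → ℤ) (k : ℤ), c ≠ 0 → ∀ S : Finset (Fin (N + 3) → ℤ),
    (∀ y ∈ S, (∀ i, |y i| ≤ R) ∧ c ⬝ᵥ y = k ∧
      B (ratVec (x + (ℓ : ℤ) • y)) (ratVec (x + (ℓ : ℤ) • y)) = 2 * m) →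
    (S.card : ℝ) ≤ C * (R : ℝ) ^ ((N : ℝ) + ε) := by
  classical
  obtain ⟨C, hC0, hC⟩ := exists_card_section_le N ε hε
  refine ⟨C * 2 ^ N * 2 ^ ε, by positivity, ?_⟩
  intro B hB hs x m hm ℓ R hℓ hR c k hc S hS
  rcases S.eq_empty_or_nonempty with rfl | ⟨y₀, hy₀⟩
  · simp only [Finset.card_empty, Nat.cast_zero]
    positivity
  obtain ⟨i₀, hi₀⟩ : ∃ i, c i ≠ 0 := by
    by_contra! h
    exact hc (funext h)
  obtain ⟨hy₀R, hy₀k, -⟩ := hS y₀ hy₀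
  have hi₀' : (c i₀ : ℚ) ≠ 0 := by exact_mod_cast hi₀
  -- The equation c · w = 0 is solved for coordinate i₀. It applies to differences with a base point
  -- y₀, which is why the box doubles to 2R.
  let F : (Fin (N + 2) → ℚ) →ₗ[ℚ] ℚ :=
    ∑ j, (-(c (i₀.succAbove j) : ℚ) / c i₀) • LinearMap.proj j
  have hF : ∀ w, F w = ∑ j, (-(c (i₀.succAbove j) : ℚ) / c i₀) * w j := fun w => by
    simp [F, LinearMap.sum_apply]
  let I : (Fin (N + 2) → ℚ) →ₗ[ℚ] (Fin (N + 3) → ℚ) :=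
    LinearMap.pi (i₀.insertNth (α := fun _ => (Fin (N + 2) → ℚ) →ₗ[ℚ] ℚ) F
      (fun j => LinearMap.proj j))
  have hI0 : ∀ w, I w i₀ = F w := fun w => by simp [I]
  have hIj : ∀ w j, I w (i₀.succAbove j) = w j := fun w j => by simp [I]
  have hℓ0 : (ℓ : ℚ) ≠ 0 := by exact_mod_cast (by omega : ℓ ≠ 0)
  have hJ : Function.Injective ((ℓ : ℚ) • I) := by
    intro w w' h
    funext j
    have h1 : (ℓ : ℚ) * I w (i₀.succAbove j) = ℓ * I w' (i₀.succAbove j) :=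
      congrFun h (i₀.succAbove j)
    rw [hIj, hIj] at h1
    exact mul_left_cancel₀ hℓ0 h1
  let pr : (Fin (N + 3) → ℤ) → (Fin (N + 2) → ℤ) := fun y j => (y - y₀) (i₀.succAbove j)
  have hpr : ∀ y ∈ S, I (ratVec (pr y)) = ratVec (y - y₀) := by
    intro y hy
    have h0 : c ⬝ᵥ (y - y₀) = 0 := by rw [dotProduct_sub, (hS y hy).2.1, hy₀k, sub_self]
    rw [dotProduct, Fin.sum_univ_succAbove _ i₀] at h0
    have h0' : (c i₀ : ℚ) * ((y - y₀) i₀ : ℤ) +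
        ∑ j, (c (i₀.succAbove j) : ℚ) * ((y - y₀) (i₀.succAbove j) : ℤ) = 0 := by exact_mod_cast h0
    funext i
    refine Fin.succAboveCases i₀ ?_ (fun j => ?_) i
    · rw [hI0, hF]
      simp only [ratVec, pr]
      have e : ∑ j, (-(c (i₀.succAbove j) : ℚ) / c i₀) * ((y - y₀) (i₀.succAbove j) : ℤ) =
          -(∑ j, (c (i₀.succAbove j) : ℚ) * ((y - y₀) (i₀.succAbove j) : ℤ)) / c i₀ := by
        rw [← Finset.sum_neg_distrib, Finset.sum_div]
        exact Finset.sum_congr rfl fun j _ => by ring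
      rw [e, div_eq_iff hi₀']
      linarith
    · rw [hIj]
      rfl
  have hinj : Set.InjOn pr S := by
    intro y hy y' hy' h
    have h1 := hpr y hy
    rw [h, hpr y' hy'] at h1
    funext i
    have h2 := congrFun h1 i
    simp only [ratVec, Pi.sub_apply] at h2
    have h3 : y' i - y₀ i = y i - y₀ i := by exact_mod_cast h2
    linarith
  have := hC (N + 3) B hB hs (by omega) le_rfl ((ℓ : ℚ) • I) hJ (ratVec (x + (ℓ : ℤ) • y₀)) m hm
    (fun _ => 2 * R) (2 * R) (by omega) monotone_const le_rfl (S.image pr) (by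
      intro q hq
      obtain ⟨y, hy, rfl⟩ := Finset.mem_image.1 hq
      obtain ⟨h1, -, h2⟩ := hS y hy
      refine ⟨fun i => ?_, ?_⟩
      · have := abs_sub_le_add (h1 (i₀.succAbove i)) (hy₀R (i₀.succAbove i))
        simp only [pr, Pi.sub_apply]
        push_cast
        linarith
      · rw [← h2, LinearMap.smul_apply, hpr y hy]
        have : ratVec (x + (ℓ : ℤ) • y₀) + (ℓ : ℚ) • ratVec (y - y₀) = ratVec (x + (ℓ : ℤ) • y) := by
          rw [ratVec_sub, ratVec_add_smul, ratVec_add_smul, smul_sub]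
          push_cast
          abel
        rw [this])
  rw [Finset.card_image_of_injOn hinj] at this
  refine this.trans (le_of_eq ?_)
  have hR0 : (0 : ℝ) < R := by exact_mod_cast hR
  rw [Finset.prod_const, Finset.card_univ, Fintype.card_fin]
  push_cast
  rw [Real.rpow_add hR0, Real.rpow_natCast, Real.mul_rpow (by norm_num) hR0.le]
  ring

/-- Points of a quadric whose images under independent linear forms are integral and bounded. -/
theorem exists_card_reduced_box_le (N : ℕ) (hN : 1 ≤ N) (ε : ℝ) (hε : 0 < ε) :
    ∃ C : ℝ, 0 < C ∧
    ∀ (B : LinearMap.BilinForm ℚ (Fin (N + 3) → ℚ)), B.Nondegenerate → (∀ x y, B x y = B y x) →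
    ∀ (x : Fin (N + 3) → ℤ) (m : ℚ), m ≠ 0 → ∀ (ℓ : ℕ), 1 ≤ ℓ →
    ∀ (c : Fin (N + 3) → Fin (N + 3) → ℤ), LinearIndependent ℚ (fun k => ratVec (c k)) →
    ∀ (U : Fin (N + 3) → ℕ) (T : ℕ), 1 ≤ U 0 → Monotone U → U 1 ≤ T →
    ∀ S : Finset (Fin (N + 3) → ℤ),
    (∀ y ∈ S, (∀ k, (ℓ : ℤ) ∣ c k ⬝ᵥ y ∧ |c k ⬝ᵥ y| ≤ ℓ * U k) ∧
      B (ratVec (x + (ℓ : ℤ) • y)) (ratVec (x + (ℓ : ℤ) • y)) = 2 * m) →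
    (S.card : ℝ) ≤ C * (∏ i : Fin (N + 1), (U i.succ.succ : ℝ)) * (T : ℝ) ^ ε := by
  classical
  obtain ⟨C, hC0, hC⟩ := exists_card_section_le (N + 1) ε hε
  refine ⟨C, hC0, ?_⟩
  intro B hB hs x m hm ℓ hℓ c hc U T hU0 hU hUT S hS
  have hℓ0 : (ℓ : ℚ) ≠ 0 := by exact_mod_cast (by omega : ℓ ≠ 0)
  have hℓz : (ℓ : ℤ) ≠ 0 := by exact_mod_cast (by omega : ℓ ≠ 0)
  let Mc : Matrix (Fin (N + 3)) (Fin (N + 3)) ℚ := Matrix.of fun k => ratVec (c k)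
  have hMc : IsUnit Mc := Matrix.linearIndependent_rows_iff_isUnit.1 hc
  -- The new coordinates are c_k·y/ℓ, integral on `S`; its inverse, scaled by ℓ, parametrizes the
  -- quadric.
  let Ψ : (Fin (N + 3) → ℚ) →ₗ[ℚ] (Fin (N + 3) → ℚ) := (ℓ : ℚ)⁻¹ • Mc.mulVecLin
  have hΨ : Function.Injective Ψ := by
    intro v w h
    have h1 : (ℓ : ℚ)⁻¹ • Mc.mulVec v = (ℓ : ℚ)⁻¹ • Mc.mulVec w := h
    exact Matrix.mulVec_injective_of_isUnit hMc (smul_right_injective _ (inv_ne_zero hℓ0) h1)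
  let Φ := LinearEquiv.ofInjectiveEndo Ψ hΨ
  let pr : (Fin (N + 3) → ℤ) → (Fin (N + 3) → ℤ) := fun y k => (c k ⬝ᵥ y) / ℓ
  have hpr : ∀ y ∈ S, Φ.symm (ratVec (pr y)) = ratVec y := by
    intro y hy
    rw [LinearEquiv.symm_apply_eq]
    funext k
    obtain ⟨r, hr⟩ := ((hS y hy).1 k).1
    show ((pr y k : ℤ) : ℚ) = (ℓ : ℚ)⁻¹ * (Mc.mulVec (ratVec y) k)
    have h1 : Mc.mulVec (ratVec y) k = ((c k ⬝ᵥ y : ℤ) : ℚ) := by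
      simp [Mc, Matrix.mulVec, dotProduct, ratVec]
    rw [h1]
    simp only [pr]
    rw [hr, Int.mul_ediv_cancel_left _ hℓz]
    push_cast
    rw [inv_mul_cancel_left₀ hℓ0]
  have hinj : Set.InjOn pr S := by
    intro y hy y' hy' h
    have h1 := hpr y hy
    rw [h, hpr y' hy'] at h1
    funext i
    have h2 := congrFun h1 i
    simp only [ratVec] at h2
    exact_mod_cast h2.symm
  have hJ : Function.Injective ((ℓ : ℚ) • Φ.symm.toLinearMap) := by
    intro w w' h
    have h1 : (ℓ : ℚ) • Φ.symm w = (ℓ : ℚ) • Φ.symm w' := h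
    exact Φ.symm.injective (smul_right_injective _ hℓ0 h1)
  have := hC (N + 3) B hB hs (by omega) (by omega) ((ℓ : ℚ) • Φ.symm.toLinearMap) hJ (ratVec x) m hm
    U T hU0 hU hUT (S.image pr) (by
      intro q hq
      obtain ⟨y, hy, rfl⟩ := Finset.mem_image.1 hq
      obtain ⟨h1, h2⟩ := hS y hy
      refine ⟨fun k => ?_, ?_⟩
      · obtain ⟨⟨r, hr⟩, hle⟩ := h1 k
        simp only [pr]
        rw [hr, Int.mul_ediv_cancel_left _ hℓz]
        rw [hr, abs_mul, Nat.abs_cast] at hle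
        exact le_of_mul_le_mul_left hle (by exact_mod_cast hℓ)
      · rw [← h2, ratVec_add_smul]
        have : ((ℓ : ℚ) • Φ.symm.toLinearMap) (ratVec (pr y)) = ((ℓ : ℤ) : ℚ) • ratVec y := by
          rw [LinearMap.smul_apply, LinearEquiv.coe_coe, hpr y hy, Int.cast_natCast]
        rw [this])
  rwa [Finset.card_image_of_injOn hinj] at this

/-! ### The polar form and the congruence it imposes. -/

/-- The Gram matrix of the polar form. -/
def polarMatrix {n : ℕ} (Q : QuadraticForm ℤ (Fin n → ℤ)) : Matrix (Fin n) (Fin n) ℤ :=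
  Matrix.of fun i j => QuadraticMap.polar Q (Pi.single i (1 : ℤ)) (Pi.single j (1 : ℤ))

/-- The polar form over `ℚ`. -/
noncomputable def ratPolar {n : ℕ} (Q : QuadraticForm ℤ (Fin n → ℤ)) :
    LinearMap.BilinForm ℚ (Fin n → ℚ) := Matrix.toBilin' ((polarMatrix Q).map (Int.cast : ℤ → ℚ))

theorem ratPolar_nondegenerate {n : ℕ} {Q : QuadraticForm ℤ (Fin n → ℤ)} (hQ : QuadNonsingular Q) :
    (ratPolar Q).Nondegenerate := by
  refine LinearMap.BilinForm.nondegenerate_toBilin'_iff_det_ne_zero.2 ?_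
  have h : ((polarMatrix Q).map (Int.cast : ℤ → ℚ)).det = (((polarMatrix Q).det : ℤ) : ℚ) :=
    ((Int.castRingHom ℚ).map_det (polarMatrix Q)).symm
  rw [h]
  exact_mod_cast hQ

theorem ratPolar_symm {n : ℕ} (Q : QuadraticForm ℤ (Fin n → ℤ)) (x y : Fin n → ℚ) :
    ratPolar Q x y = ratPolar Q y x := by
  simp only [ratPolar, Matrix.toBilin'_apply]
  rw [Finset.sum_comm]
  refine Finset.sum_congr rfl fun i _ => Finset.sum_congr rfl fun j _ => ?_
  simp only [Matrix.map_apply, polarMatrix, Matrix.of_apply]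
  rw [QuadraticMap.polar_comm]
  ring

theorem polar_eq_sum {n : ℕ} (Q : QuadraticForm ℤ (Fin n → ℤ)) (x y : Fin n → ℤ) :
    QuadraticMap.polar Q x y = ∑ i, ∑ j, x i * polarMatrix Q i j * y j := by
  have h : Matrix.toBilin' (LinearMap.BilinForm.toMatrix' (QuadraticMap.polarBilin Q)) =
      QuadraticMap.polarBilin Q := Matrix.toBilin'_toMatrix' _
  calc QuadraticMap.polar Q x y = QuadraticMap.polarBilin Q x y := rfl
    _ = Matrix.toBilin' (LinearMap.BilinForm.toMatrix' (QuadraticMap.polarBilin Q)) x y := by rw [h]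
    _ = _ := by
        rw [Matrix.toBilin'_apply]
        rfl

theorem ratPolar_ratVec {n : ℕ} (Q : QuadraticForm ℤ (Fin n → ℤ)) (x y : Fin n → ℤ) :
    ratPolar Q (ratVec x) (ratVec y) = (QuadraticMap.polar Q x y : ℤ) := by
  rw [polar_eq_sum, ratPolar, Matrix.toBilin'_apply]
  push_cast
  rfl

theorem ratPolar_self {n : ℕ} (Q : QuadraticForm ℤ (Fin n → ℤ)) (x : Fin n → ℤ) :
    ratPolar Q (ratVec x) (ratVec x) = 2 * (Q x : ℚ) := by
  rw [ratPolar_ratVec, QuadraticMap.polar_self]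
  rw [two_smul]
  push_cast
  ring

/-- The linear form `polar Q x`. -/
def polarVec {n : ℕ} (Q : QuadraticForm ℤ (Fin n → ℤ)) (x : Fin n → ℤ) : Fin n → ℤ :=
  fun j => ∑ i, x i * polarMatrix Q i j

theorem polarVec_dotProduct {n : ℕ} (Q : QuadraticForm ℤ (Fin n → ℤ)) (x y : Fin n → ℤ) :
    polarVec Q x ⬝ᵥ y = QuadraticMap.polar Q x y := by
  rw [polar_eq_sum, Finset.sum_comm]
  simp only [polarVec, dotProduct, Finset.sum_mul]

/-- The term linear in y of Q(x + ℓy) - Q(x) has a factor ℓ and the quadratic one ℓ²; dividing by ℓ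
leaves a congruence mod ℓ. -/
theorem dvd_polarVec_dotProduct {n : ℕ} {Q : QuadraticForm ℤ (Fin n → ℤ)} {x y : Fin n → ℤ}
    {ℓ : ℤ} (hℓ : ℓ ≠ 0) (h : Q (x + ℓ • y) = Q x) : ℓ ∣ polarVec Q x ⬝ᵥ y := by
  have h1 : Q (x + ℓ • y) = Q x + ℓ * ℓ * Q y + ℓ * QuadraticMap.polar Q x y := by
    have := QuadraticMap.polar_smul_right Q ℓ x y
    rw [QuadraticMap.polar, QuadraticMap.map_smul] at this
    simp only [smul_eq_mul] at this
    linarith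
  rw [h] at h1
  refine ⟨-Q y, mul_left_cancel₀ hℓ ?_⟩
  rw [polarVec_dotProduct]
  linarith

/-- Spreads the single congruence a·y ≡ 0 to the whole lattice ℤa + ℓℤⁿ, from which short forms can
be chosen. -/
theorem dvd_dotProduct_of_dvd_sub {n : ℕ} {ℓ t : ℤ} {a c y : Fin n → ℤ}
    (h : ∀ i, ℓ ∣ c i - t * a i) (ha : ℓ ∣ a ⬝ᵥ y) : ℓ ∣ c ⬝ᵥ y := by
  have e : c ⬝ᵥ y = ∑ i, (c i - t * a i) * y i + t * (a ⬝ᵥ y) := by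
    rw [dotProduct, dotProduct, Finset.mul_sum, ← Finset.sum_add_distrib]
    exact Finset.sum_congr rfl fun i _ => by ring
  rw [e]
  exact dvd_add (Finset.dvd_sum fun i _ => (h i).mul_right _) (ha.mul_left _)

theorem abs_dotProduct_le {n : ℕ} (c y : Fin n → ℤ) {R : ℕ} (hy : ∀ i, |y i| ≤ R) :
    |c ⬝ᵥ y| ≤ n * supAbs c * R := by
  calc |c ⬝ᵥ y| ≤ ∑ i, |c i * y i| := Finset.abs_sum_le_sum_abs _ _
    _ ≤ ∑ i : Fin n, (supAbs c * R : ℤ) :=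
        Finset.sum_le_sum fun i _ => abs_mul_le_mul (abs_le_supAbs c i) (hy i)
    _ = _ := by simp [mul_assoc]

/-! ### Reduction to a box and the final estimate. -/

/-- Translation of the problem: the points in a residue class correspond to the points `x + ℓ y`
with `y` in a box. -/
theorem exists_translates {n : ℕ} {Q : QuadraticForm ℤ (Fin n → ℤ)} {m : ℤ} {H : ℝ} {ℓ : ℕ}
    {ξ : Fin n → ZMod ℓ} (hℓ : 1 ≤ ℓ) {x : Fin n → ℤ} (hx : x ∈ quadricPoints Q m H ℓ ξ) :
    ∃ S : Finset (Fin n → ℤ), S.card = (quadricPoints Q m H ℓ ξ).ncard ∧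
      ∀ y ∈ S, Q (x + (ℓ : ℤ) • y) = m ∧ ∀ i, |(y i : ℝ)| ≤ 2 * (H / ℓ) := by
  classical
  have hfin := quadricPoints_finite Q m H ℓ ξ
  have hℓ0 : (ℓ : ℤ) ≠ 0 := by exact_mod_cast (by omega : ℓ ≠ 0)
  have hℓR : (0 : ℝ) < ℓ := by exact_mod_cast hℓ
  have hy : ∀ z ∈ quadricPoints Q m H ℓ ξ, ∃ y : Fin n → ℤ, z = x + (ℓ : ℤ) • y := by
    rintro z ⟨-, -, hz⟩
    have : ∀ i, (ℓ : ℤ) ∣ z i - x i := fun i =>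
      (ZMod.intCast_eq_intCast_iff_dvd_sub _ _ ℓ).1 ((hx.2.2 i).trans (hz i).symm)
    choose y hy using this
    exact ⟨y, funext fun i => by simp only [Pi.add_apply, Pi.smul_apply, smul_eq_mul, ← hy]; ring⟩
  choose! f hf using hy
  refine ⟨hfin.toFinset.image f, ?_, ?_⟩
  · rw [Finset.card_image_of_injOn, Set.ncard_eq_toFinset_card _ hfin]
    intro z hz z' hz' h
    rw [hf z (by simpa using hz), hf z' (by simpa using hz'), h]
  · intro y hy
    obtain ⟨z, hz, rfl⟩ := Finset.mem_image.1 hy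
    have hz' : z ∈ quadricPoints Q m H ℓ ξ := by simpa using hz
    have e := hf z hz'
    refine ⟨e ▸ hz'.1, fun i => ?_⟩
    have h1 := hz'.2.1 i
    have h2 := hx.2.1 i
    have h3 : (z i : ℝ) = x i + ℓ * f z i := by
      have := congrFun e i
      simp only [Pi.add_apply, Pi.smul_apply, smul_eq_mul] at this
      exact_mod_cast this
    have h4 : |(ℓ : ℝ) * f z i| ≤ 2 * H := by
      have : (ℓ : ℝ) * f z i = z i - x i := by rw [h3]; ring
      rw [this]
      exact (abs_sub _ _).trans (by linarith)
    rw [abs_mul, abs_of_pos hℓR] at h4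
    rw [← mul_div_assoc, le_div_iff₀ hℓR]
    linarith

set_option maxHeartbeats 1000000 in
theorem proposition5p3 (n : ℕ) (hn : 4 ≤ n) (Q : QuadraticForm ℤ (Fin n → ℤ))
    (hQ : QuadNonsingular Q) (hQ' : QuadIndefinite Q) (m : ℤ) (hm : m ≠ 0)
    (ε : ℝ) (hε : 0 < ε) :
    ∃ C : ℝ, 0 < C ∧ ∀ (H : ℝ) (ℓ : ℕ) (ξ : Fin n → ZMod ℓ), 0 < H → 1 ≤ ℓ →
      ((quadricPoints Q m H ℓ ξ).ncard : ℝ) ≤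
        C * (max 1 (H / (ℓ : ℝ))) ^ ((n : ℝ) - 3 + ε) *
          (1 + H / (ℓ : ℝ) ^ ((n : ℝ) / ((n : ℝ) - 1))) := by
  classical
  obtain ⟨N, rfl⟩ : ∃ N, n = N + 3 := ⟨n - 3, by omega⟩
  have hN : 1 ≤ N := by omega
  obtain ⟨C₁, hC₁0, hC₁⟩ := exists_card_hyperplane_section_le N hN ε hε
  obtain ⟨C₂, hC₂0, hC₂⟩ := exists_card_reduced_box_le N hN ε hε
  obtain ⟨K, hK⟩ := exists_reduced_vectors (N + 3)
  have hB := ratPolar_nondegenerate hQ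
  have hs := ratPolar_symm Q
  have hmQ : (m : ℚ) ≠ 0 := by exact_mod_cast hm
  set M : ℕ := (2 * m).natAbs with hM
  have hM1 : 1 ≤ M := Nat.one_le_iff_ne_zero.2 (Int.natAbs_ne_zero.2 (by omega))
  -- A form c is at most n·|c|·2R on the box of y, whence b = 2n.
  set b : ℝ := 2 * ((N + 3 : ℕ) : ℝ) with hb
  have hb1 : 1 ≤ b := by
    rw [hb]
    push_cast
    linarith [(Nat.cast_nonneg N : (0 : ℝ) ≤ N)]
  refine ⟨(2 * b + 1) * (C₁ * 2 ^ ((N : ℝ) + ε)) + C₂ * b ^ (N + 1) * b ^ ε * (K * M), by positivity, ?_⟩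
  intro H ℓ ξ hH hℓ
  have hℓR : (1 : ℝ) ≤ ℓ := by exact_mod_cast hℓ
  have hℓpos : (0 : ℝ) < ℓ := by linarith
  have hexp : ((N + 3 : ℕ) : ℝ) - 3 + ε = N + ε := by push_cast; ring
  rw [hexp]
  set R : ℝ := max 1 (H / ℓ) with hR
  have hR1 : 1 ≤ R := le_max_left _ _
  have hR0 : 0 < R := by linarith
  -- g = ℓ^{-1/(n-1)}, the saving in H/ℓ^{n/(n-1)} = (H/ℓ)·g.
  set g : ℝ := (ℓ : ℝ) ^ (-(1 / ((N : ℝ) + 2))) with hg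
  have hg0 : 0 < g := Real.rpow_pos_of_pos hℓpos _
  have hg1 : g ≤ 1 := Real.rpow_le_one_of_one_le_of_nonpos hℓR (by
    rw [neg_nonpos]; positivity)
  have hHg : H / (ℓ : ℝ) ^ (((N + 3 : ℕ) : ℝ) / (((N + 3 : ℕ) : ℝ) - 1)) = H / ℓ * g := by
    have e : (((N + 3 : ℕ) : ℝ) / (((N + 3 : ℕ) : ℝ) - 1)) = 1 + 1 / ((N : ℝ) + 2) := by
      push_cast
      have : (N : ℝ) + 3 - 1 = N + 2 := by ring
      rw [this]
      field_simp
      ring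
    rw [e, Real.rpow_add hℓpos, Real.rpow_one, hg, Real.rpow_neg hℓpos.le]
    field_simp
  rw [hHg]
  set G : ℝ := 1 + H / ℓ * g with hG
  have hHl : 0 < H / ℓ := by positivity
  have hG1 : 1 ≤ G := by
    rw [hG]
    linarith [mul_pos hHl hg0]
  have hRg : R * g ≤ G := by
    have : R ≤ 1 + H / ℓ := max_le (by linarith) (by linarith)
    calc R * g ≤ (1 + H / ℓ) * g := by gcongr
      _ = g + H / ℓ * g := by ring
      _ ≤ G := by linarith
  -- ℓg³ = ℓ^{1 - 3/(n-1)}, and the exponent is nonnegative because n ≥ 4.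
  have hℓg : 1 ≤ ℓ * g ^ 3 := by
    have e : (ℓ : ℝ) * g ^ 3 = (ℓ : ℝ) ^ (1 - 3 / ((N : ℝ) + 2)) := by
      rw [hg, ← Real.rpow_natCast, ← Real.rpow_mul hℓpos.le]
      nth_rewrite 1 [← Real.rpow_one (ℓ : ℝ)]
      rw [← Real.rpow_add hℓpos]
      congr 1
      push_cast
      ring
    rw [e]
    refine Real.one_le_rpow hℓR ?_
    rw [sub_nonneg, div_le_one (by positivity)]
    have : (1 : ℝ) ≤ N := by exact_mod_cast hN
    linarith
  rcases (quadricPoints Q m H ℓ ξ).eq_empty_or_nonempty with hemp | ⟨x, hx⟩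
  · rw [hemp, Set.ncard_empty, Nat.cast_zero]
    positivity
  obtain ⟨S, hScard, hS⟩ := exists_translates hℓ hx
  rw [← hScard]
  set R' : ℕ := ⌊2 * R⌋₊ with hR'
  have hR'le : (R' : ℝ) ≤ 2 * R := Nat.floor_le (by positivity)
  have hRR' : R ≤ R' := by
    have := Nat.lt_floor_add_one (2 * R)
    rw [← hR'] at this
    linarith
  have hR'1 : 1 ≤ R' := by
    have : (1 : ℝ) ≤ R' := hR1.trans hRR'
    exact_mod_cast this
  have hSR : ∀ y ∈ S, ∀ i, |y i| ≤ (R' : ℤ) := by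
    intro y hy i
    have h1 := (hS y hy).2 i
    have h2 : ((y i).natAbs : ℝ) ≤ 2 * R := by
      rw [Nat.cast_natAbs, Int.cast_abs]
      exact h1.trans (by gcongr; exact le_max_right _ _)
    rw [Int.abs_eq_natAbs]
    exact_mod_cast Nat.le_floor h2
  have hSB : ∀ y ∈ S, ratPolar Q (ratVec (x + (ℓ : ℤ) • y)) (ratVec (x + (ℓ : ℤ) • y)) = 2 * (m : ℚ) :=
    fun y hy => by rw [ratPolar_self, (hS y hy).1]
  have hℓz : (ℓ : ℤ) ≠ 0 := by exact_mod_cast (by omega : ℓ ≠ 0)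
  -- The order of a = `polarVec Q x` mod ℓ is controlled through a·x = 2m: if ℓ divides ta then it
  -- divides 2mt.
  obtain ⟨c, hcL, hli, hmono, hcℓ, hprod⟩ := hK ℓ M (polarVec Q x) hℓ (by
    intro t ht
    have h1 : (ℓ : ℤ) ∣ t * (polarVec Q x ⬝ᵥ x) := by
      rw [dotProduct, Finset.mul_sum]
      exact Finset.dvd_sum fun i _ => by
        rw [← mul_assoc]
        exact (ht i).mul_right _
    rw [polarVec_dotProduct, QuadraticMap.polar_self, hx.1, two_smul, ← two_mul, mul_comm] at h1
    rw [hM, Int.natCast_natAbs]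
    rcases abs_choice (2 * m) with h | h <;> rw [h]
    · exact h1
    · rw [neg_mul]
      exact h1.neg_right) hM1
  have hcdvd : ∀ y ∈ S, ∀ k, (ℓ : ℤ) ∣ c k ⬝ᵥ y := by
    intro y hy k
    obtain ⟨t, ht⟩ := hcL k
    exact dvd_dotProduct_of_dvd_sub ht
      (dvd_polarVec_dotProduct hℓz ((hS y hy).1.trans hx.1.symm))
  have hc0 : ∀ k, c k ≠ 0 := fun k h0 => hli.ne_zero k (by ext i; simp [h0, ratVec])
  have hμ0 : ∀ k, 0 < supAbs (c k) := fun k => supAbs_pos (hc0 k)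
  set μ : ℝ := ((supAbs (c 0) : ℕ) : ℝ) with hμ
  have hμpos : 0 < μ := by
    rw [hμ]
    exact_mod_cast hμ0 0
  have hpow0 : 0 < R ^ ((N : ℝ) + ε) := Real.rpow_pos_of_pos hR0 _
  by_cases hA : R * μ / ℓ ≤ G
  · -- slicing by the hyperplanes `c 0 ⬝ᵥ y = ℓ k`
    set k₀ : ℕ := (N + 3) * supAbs (c 0) * R' / ℓ with hk₀
    have hk₀le : (k₀ : ℝ) ≤ b * G := by
      calc (k₀ : ℝ) ≤ (((N + 3) * supAbs (c 0) * R' : ℕ) : ℝ) / ℓ := Nat.cast_div_le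
        _ = ((N + 3 : ℕ) : ℝ) * μ * R' / ℓ := by push_cast; rfl
        _ ≤ ((N + 3 : ℕ) : ℝ) * μ * (2 * R) / ℓ := by gcongr
        _ = b * (R * μ / ℓ) := by rw [hb]; ring
        _ ≤ b * G := by gcongr
    have hmaps : ∀ y ∈ S, (c 0 ⬝ᵥ y) / ℓ ∈ Finset.Icc (-(k₀ : ℤ)) k₀ := by
      intro y hy
      obtain ⟨r, hr⟩ := hcdvd y hy 0
      have h1 := abs_dotProduct_le (c 0) y (hSR y hy)
      rw [hr, Int.mul_ediv_cancel_left _ hℓz, Finset.mem_Icc, ← abs_le]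
      rw [hr, abs_mul, Nat.abs_cast] at h1
      rw [Int.abs_eq_natAbs] at h1 ⊢
      have h2 : ℓ * r.natAbs ≤ (N + 3) * supAbs (c 0) * R' := by exact_mod_cast h1
      rw [mul_comm] at h2
      exact_mod_cast (Nat.le_div_iff_mul_le (by omega)).2 h2
    have hsum := Finset.card_eq_sum_card_fiberwise hmaps
    have hfib : ∀ k ∈ Finset.Icc (-(k₀ : ℤ)) k₀,
        ((S.filter (fun y => (c 0 ⬝ᵥ y) / ℓ = k)).card : ℝ) ≤ C₁ * (R' : ℝ) ^ ((N : ℝ) + ε) := by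
      intro k _
      refine hC₁ (ratPolar Q) hB hs x m hmQ ℓ R' hℓ hR'1 (c 0) (ℓ * k) (hc0 0) _ fun y hy => ?_
      obtain ⟨hyS, hyk⟩ := Finset.mem_filter.1 hy
      refine ⟨hSR y hyS, ?_, hSB y hyS⟩
      rw [← hyk, Int.mul_ediv_cancel' (hcdvd y hyS 0)]
    have hR'pow : (R' : ℝ) ^ ((N : ℝ) + ε) ≤ 2 ^ ((N : ℝ) + ε) * R ^ ((N : ℝ) + ε) := by
      rw [← Real.mul_rpow (by norm_num) hR0.le]
      exact Real.rpow_le_rpow (by positivity) hR'le (by positivity)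
    have hcardIcc : ((Finset.Icc (-(k₀ : ℤ)) k₀).card : ℝ) ≤ (2 * b + 1) * G := by
      have : (Finset.Icc (-(k₀ : ℤ)) k₀).card = 2 * k₀ + 1 := by
        rw [Int.card_Icc]
        omega
      rw [this]
      push_cast
      linarith
    calc (S.card : ℝ) = ∑ k ∈ Finset.Icc (-(k₀ : ℤ)) k₀,
          ((S.filter (fun y => (c 0 ⬝ᵥ y) / ℓ = k)).card : ℝ) := by exact_mod_cast hsum
      _ ≤ ∑ k ∈ Finset.Icc (-(k₀ : ℤ)) k₀, C₁ * (R' : ℝ) ^ ((N : ℝ) + ε) := Finset.sum_le_sum hfib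
      _ = (Finset.Icc (-(k₀ : ℤ)) k₀).card * (C₁ * (R' : ℝ) ^ ((N : ℝ) + ε)) := by
          rw [Finset.sum_const, nsmul_eq_mul]
      _ ≤ ((2 * b + 1) * G) * (C₁ * (2 ^ ((N : ℝ) + ε) * R ^ ((N : ℝ) + ε))) := by gcongr
      _ = ((2 * b + 1) * (C₁ * 2 ^ ((N : ℝ) + ε))) * R ^ ((N : ℝ) + ε) * G := by ring
      _ ≤ _ := by
          gcongr
          exact le_add_of_nonneg_right (by positivity)
  -- c_0 is long: G ≥ 1 gives ℓ < Rμ, so that U 0 ≥ 1, and G ≥ Rg gives μ > ℓg.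
  · push Not at hA
    have hRμ : ℓ < R * μ := by
      have := hG1.trans_lt hA
      rwa [one_lt_div hℓpos] at this
    have hμg : ℓ * g < μ := by
      have h1 : R * g < R * μ / ℓ := hRg.trans_lt hA
      rw [lt_div_iff₀ hℓpos] at h1
      exact lt_of_mul_lt_mul_left (by linarith) hR0.le
    let U : Fin (N + 3) → ℕ := fun k => (N + 3) * supAbs (c k) * R' / ℓ
    have hUmono : Monotone U := fun i j hij => Nat.div_le_div_right (by
      have := hmono hij
      simp only at this
      gcongr)
    have hU0 : 1 ≤ U 0 := by
      rw [Nat.le_div_iff_mul_le (by omega), one_mul]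
      have h1 : (ℓ : ℝ) ≤ ((supAbs (c 0) * R' : ℕ) : ℝ) := by
        push_cast
        calc (ℓ : ℝ) ≤ R * μ := hRμ.le
          _ ≤ R' * μ := by gcongr
          _ = _ := by ring
      have h2 : ℓ ≤ supAbs (c 0) * R' := by exact_mod_cast h1
      calc ℓ ≤ 1 * (supAbs (c 0) * R') := by omega
        _ ≤ (N + 3) * (supAbs (c 0) * R') := Nat.mul_le_mul_right _ (by omega)
        _ = _ := by ring
    have hU1 : U 1 ≤ (N + 3) * R' := by
      refine Nat.div_le_of_le_mul ?_
      calc (N + 3) * supAbs (c 1) * R' ≤ (N + 3) * ℓ * R' := by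
            gcongr
            exact hcℓ 1
        _ = _ := by ring
    have hbound := hC₂ (ratPolar Q) hB hs x m hmQ ℓ hℓ c hli U ((N + 3) * R') hU0 hUmono hU1 S
      fun y hy => ⟨fun k => ⟨hcdvd y hy k, by
        obtain ⟨r, hr⟩ := hcdvd y hy k
        have h1 := abs_dotProduct_le (c k) y (hSR y hy)
        rw [hr, abs_mul, Nat.abs_cast] at h1 ⊢
        refine mul_le_mul_of_nonneg_left ?_ (by positivity)
        rw [Int.abs_eq_natAbs] at h1 ⊢
        have h2 : ℓ * r.natAbs ≤ (N + 3) * supAbs (c k) * R' := by exact_mod_cast h1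
        rw [mul_comm] at h2
        exact_mod_cast (Nat.le_div_iff_mul_le (by omega)).2 h2⟩, hSB y hy⟩
    have hUle : ∀ k, (U k : ℝ) ≤ b * R / ℓ * supAbs (c k) := by
      intro k
      calc (U k : ℝ) ≤ (((N + 3) * supAbs (c k) * R' : ℕ) : ℝ) / ℓ := Nat.cast_div_le
        _ = ((N + 3 : ℕ) : ℝ) * supAbs (c k) * R' / ℓ := by push_cast; rfl
        _ ≤ ((N + 3 : ℕ) : ℝ) * supAbs (c k) * (2 * R) / ℓ := by gcongr
        _ = _ := by rw [hb]; ring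
    set P : ℝ := ∏ i : Fin (N + 1), (supAbs (c i.succ.succ) : ℝ) with hP
    have hP0 : 0 ≤ P := Finset.prod_nonneg fun i _ => Nat.cast_nonneg _
    have hPle : P * μ ^ 2 ≤ K * M * ℓ ^ (N + 2) := by
      have h1 : (ℓ : ℝ) * ∏ k, (supAbs (c k) : ℝ) ≤ K * M * (ℓ : ℝ) ^ (N + 3) := by
        exact_mod_cast hprod
      rw [Fin.prod_univ_succ, Fin.prod_univ_succ] at h1
      have h2 : μ ≤ supAbs (c (Fin.succ 0)) := by
        have := hmono (Fin.zero_le (Fin.succ (0 : Fin (N + 2))))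
        simp only at this
        rw [hμ]
        exact_mod_cast this
      have h3 : (ℓ : ℝ) * (P * μ ^ 2) ≤ ℓ * (K * M * ℓ ^ (N + 2)) := by
        calc (ℓ : ℝ) * (P * μ ^ 2) = ℓ * (μ * (μ * P)) := by ring
          _ ≤ ℓ * (μ * (supAbs (c (Fin.succ 0)) * P)) := by gcongr
          _ ≤ K * M * (ℓ : ℝ) ^ (N + 3) := h1
          _ = _ := by ring
      exact le_of_mul_le_mul_left h3 hℓpos
    -- Both |c_0| and |c_1| are at least μ, and gμ² ≥ g(ℓg)² = ℓ·(ℓg³) ≥ ℓ; removing them from the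
    -- full product therefore gains the factor g/ℓ.
    have hPg : P ≤ K * M * ℓ ^ (N + 1) * g := by
      have h1 : ℓ ≤ g * μ ^ 2 := by
        calc (ℓ : ℝ) = ℓ * 1 := by ring
          _ ≤ ℓ * (ℓ * g ^ 3) := by gcongr
          _ = g * (ℓ * g) ^ 2 := by ring
          _ ≤ g * μ ^ 2 := by gcongr
      have h2 : P * μ ^ 2 ≤ (K * M * ℓ ^ (N + 1) * g) * μ ^ 2 := by
        calc P * μ ^ 2 ≤ K * M * ℓ ^ (N + 2) := hPle
          _ = K * M * ℓ ^ (N + 1) * ℓ := by ring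
          _ ≤ K * M * ℓ ^ (N + 1) * (g * μ ^ 2) := by gcongr
          _ = _ := by ring
      exact le_of_mul_le_mul_right h2 (by positivity)
    have hprodU : ∏ i : Fin (N + 1), (U i.succ.succ : ℝ) ≤ b ^ (N + 1) * R ^ (N + 1) * (K * M) * g := by
      calc ∏ i : Fin (N + 1), (U i.succ.succ : ℝ)
          ≤ ∏ i : Fin (N + 1), (b * R / ℓ * supAbs (c i.succ.succ) : ℝ) :=
            Finset.prod_le_prod (fun i _ => Nat.cast_nonneg _) fun i _ => hUle _
        _ = (b * R / ℓ) ^ (N + 1) * P := by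
            rw [Finset.prod_mul_distrib, Finset.prod_const, Finset.card_univ, Fintype.card_fin]
        _ ≤ (b * R / ℓ) ^ (N + 1) * (K * M * ℓ ^ (N + 1) * g) := by gcongr
        _ = _ := by
            rw [div_pow, mul_pow]
            field_simp
    have hT : (((N + 3) * R' : ℕ) : ℝ) ^ ε ≤ b ^ ε * R ^ ε := by
      rw [← Real.mul_rpow (by positivity) hR0.le]
      refine Real.rpow_le_rpow (by positivity) ?_ hε.le
      calc (((N + 3) * R' : ℕ) : ℝ) = ((N + 3 : ℕ) : ℝ) * R' := by push_cast; rfl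
        _ ≤ ((N + 3 : ℕ) : ℝ) * (2 * R) := by gcongr
        _ = b * R := by rw [hb]; ring
    calc (S.card : ℝ) ≤ C₂ * (∏ i : Fin (N + 1), (U i.succ.succ : ℝ)) * (((N + 3) * R' : ℕ) : ℝ) ^ ε :=
          hbound
      _ ≤ C₂ * (b ^ (N + 1) * R ^ (N + 1) * (K * M) * g) * (b ^ ε * R ^ ε) := by gcongr
      _ = (C₂ * b ^ (N + 1) * b ^ ε * (K * M)) * (R ^ N * R ^ ε) * (R * g) := by
          rw [pow_succ R N]
          ring
      _ = (C₂ * b ^ (N + 1) * b ^ ε * (K * M)) * R ^ ((N : ℝ) + ε) * (R * g) := by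
          rw [Real.rpow_add hR0, Real.rpow_natCast]
      _ ≤ (C₂ * b ^ (N + 1) * b ^ ε * (K * M)) * R ^ ((N : ℝ) + ε) * G := by gcongr
      _ ≤ _ := by
          gcongr
          exact le_add_of_nonneg_left (by positivity)
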